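/- Let $k$ be a field. A Poisson $k$-algebra is a $k$-vector space with a bilinear, commutative, associative (not necessarily unital) product $x\cdot y$ and a bilinear Lie bracket $(x,y)$ with $(x,y\cdot z)=(x,y)\cdot z+y\cdot(x,z)$; it is metabelian if it has an ideal $A$ such that both operations vanish on $A$ and on the quotient by $A$. Let $MP_k(X)$ be the free metabelian Poisson algebra on $X$, $\mathrm{Id}(S)$ the ideal generated by $S\subseteq MP_k(X)$, and $MP_k(X|S)=MP_k(X)/\mathrm{Id}(S)$. Write $[x_1,\dots,x_n]=(\dots((x_1,x_2),x_3),\dots,x_n)$. For a linearly ordered finite set $X$ let $MPB_k(X)$ be the set (a linear basis of $MP_k(X)$) of the following monomials, with all $a_i\in X$: $[a_1,\dots,a_n]$ with $n\ge1$, $a_2\le\dots\le a_n$, and $a_1>a_2$ if $n\ge2$; $a_1a_2$ with $a_1\le a_2$, and $a_1a_2a_3$ with $a_1\le a_2\le a_3$; $[a_1,a_2]\cdot a_3$ with $a_1>a_2$; and moreover, if $\operatorname{char}k\ne2$, $[a_1,a_2,a_3]\cdot a_4$ with $a_2<a_1\le a_4$, $a_2\le a_3<a_4$, or, if $\operatorname{char}k=2$,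 $[a_1,\dots,a_n]\cdot a_{n+1}$ with $n\ge3$, $a_1>a_2$, $a_2\le\dots\le a_{n+1}$. Monomials are ordered by comparing lexicographically first the length $\ell(W)$, then the number of brackets, then the sequence of letters. For $f\neq0$ let $\bar f$ and $\mathrm{lc}(f)$ be its leading monomial and leading coefficient; $f$ is monic if $\mathrm{lc}(f)=1$. The normal $S$-polynomials are the $s\in S$ and the $[s,a_1,\dots,a_n]$ with $s\in S$, $\ell(\bar s)\ge5$, $a_i\in X$. A set $R$ is a Gröbner–Shirshov basis for $MP_k(X)/I$ if $I=\mathrm{Id}(R)$ and every nonzero $f\in I$ satisfies $\bar f=\bar h$ for some normal $R$-polynomial $h$. Let $S$ be monic. Its multiplication compositions are $s\cdot a$, $s\cdot(a_1,a_2)$, $(s,(a_1,a_2))$ and, if $\ell(\bar s)\le4$, $(s,a)$, for $s\in S$ and letters $a$, $a_1>a_2$; such an $h$ is trivial if it is a linear combination of normal $S$-polynomials with leading monomials $\le\bar h$ (in particular if $h=0$). Its general compositions, for $s_1,s_2\in S$, are: $s_1-s_2$ with respect to $W=\bar s_1$ if $\bar s_1=\bar s_2$; and $[s_1,p_1,\dots,p_i]-[s_2,q_1,\dots,q_j]$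 with respect to $W=\overline{[s_1,p_1,\dots,p_i]}$, if either $\bar s_1=[a,a_1,\dots,a_n]$, $\bar s_2=[a,b_1,\dots,b_m]$, or $\bar s_1=[a,a_1,\dots,a_{n-1}]\cdot a_n$, $\bar s_2=[a,b_1,\dots,b_{m-1}]\cdot b_m$, where $n,m\ge4$, $p_1\le\dots\le p_i$ and $q_1\le\dots\le q_j$ are letters, and $a_1\cdots a_np_1\cdots p_i=b_1\cdots b_mq_1\cdots q_j$ is the least common multiple of $a_1\cdots a_n$ and $b_1\cdots b_m$ in the free commutative monoid on $X$; such a composition is trivial if it is a linear combination of normal $S$-polynomials with leading monomials $<W$. The completion of $S$ is the sequence $S_0=S$, $S_{n+1}=S_n\cup\{\mathrm{lc}(f)^{-1}f: f$ a nontrivial composition of $S_n\}$. A reduction step modulo a set $R$ of monic elements replaces $f\ne0$ by $f-\mathrm{lc}(f)h$, where $h$ is a monic normal $R$-polynomial with $\bar h=\bar f$. **Theorem.** (1) For every finite linearly ordered set $X$ and every $S\subseteq MP_k(X)$, the algebra $MP_k(X|S)$ has a finite Gröbner–Shirshov basis. (2) Every finitely generated metabelian Poisson $k$-algebra is finitely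 presented, i.e. isomorphic to some $MP_k(X|S)$ with $X$ and $S$ finite, and Noetherian, i.e. all of its ideals are finitely generated as ideals. (3) Let $X$ be a finite linearly ordered set and $S\subseteq MP_k(X)$ finite and monic. Then the completion becomes constant: there is $t$ with $S_n=S_t$ for all $n\ge t$, and $S_t$ is a finite monic Gröbner–Shirshov basis for $MP_k(X|S)$. There is no infinite sequence of reduction steps modulo $S_t$, and if $f$ is reduced in finitely many steps to some $g$ that admits no further step, then $f\in\mathrm{Id}(S)$ if and only if $g=0$. (4) If $k$ is a computable field (its elements are coded by natural numbers so that addition, multiplication, negation and inversion are computable) and $X$ is finite, then the word problem for finitely presented metabelian Poisson algebras on $X$ is solvable: there is an algorithm which, given a finite list $S$ of expressions and two expressions $u,v$ (built from letters of $X$ by the operations of a Poisson $k$-algebra), decides whether $u=v$ holds in $MP_k(X|S)$. -/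

import Mathlib

/-- A Poisson algebra over `k`: a vector space with a bilinear, commutative and associative (not
necessarily unital) product and a bilinear Lie bracket satisfying the Leibniz identity. -/
class PoissonAlgebra (k : Type*) (P : Type*) [Field k] [AddCommGroup P] [Module k P] where
  mul : P →ₗ[k] P →ₗ[k] P
  bracket : P →ₗ[k] P →ₗ[k] P
  mul_comm : ∀ x y, mul x y = mul y x
  mul_assoc : ∀ x y z, mul (mul x y) z = mul x (mul y z)
  bracket_self : ∀ x, bracket x x = 0
  jacobi : ∀ x y z,
    bracket x (bracket y z) + bracket y (bracket z x) + bracket z (bracket x y) = 0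
  leibniz : ∀ x y z, bracket x (mul y z) = mul (bracket x y) z + mul y (bracket x z)

section General

variable (k : Type*) {P : Type*} [Field k] [AddCommGroup P] [Module k P] [PoissonAlgebra k P]

/-- The commutative product `x · y`. -/
def pmul (x y : P) : P := PoissonAlgebra.mul (k := k) x y

/-- The Poisson bracket `(x, y)`. -/
def pbr (x y : P) : P := PoissonAlgebra.bracket (k := k) x y

variable {k} in
/-- Ideals of a Poisson algebra: subspaces stable under multiplication by and bracket with
arbitrary elements. -/
def IsPoissonIdeal (I : Submodule k P) : Prop :=
  ∀ x : P, ∀ y ∈ I, pmul k x y ∈ I ∧ pbr k x y ∈ I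

/-- `Id(S)`, the ideal generated by `S`. -/
def poissonIdealSpan (S : Set P) : Submodule k P :=
  sInf {I : Submodule k P | IsPoissonIdeal I ∧ S ⊆ I}

theorem isPoissonIdeal_span (S : Set P) : IsPoissonIdeal (poissonIdealSpan k S) := by
  intro x y hy
  rw [poissonIdealSpan, Submodule.mem_sInf] at hy
  constructor
  · rw [poissonIdealSpan, Submodule.mem_sInf]
    exact fun I hI => (hI.1 x y (hy I hI)).1
  · rw [poissonIdealSpan, Submodule.mem_sInf]
    exact fun I hI => (hI.1 x y (hy I hI)).2

/-- `P` is an extension of an abelian Poisson algebra by an abelian Poisson algebra: there is an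
ideal `A` with zero operations such that the operations of `P / A` are zero. -/
def IsMetabelianPoisson (P : Type*) [AddCommGroup P] [Module k P] [PoissonAlgebra k P] : Prop :=
  ∃ A : Submodule k P, IsPoissonIdeal A ∧
    (∀ x ∈ A, ∀ y ∈ A, pmul k x y = 0 ∧ pbr k x y = 0) ∧
    (∀ x y : P, pmul k x y ∈ A ∧ pbr k x y ∈ A)

/-- `P` is finitely generated as a Poisson algebra. -/
def IsFGPoisson (P : Type*) [AddCommGroup P] [Module k P] [PoissonAlgebra k P] : Prop :=
  ∃ s : Set P, s.Finite ∧ ∀ U : Submodule k P, s ⊆ U →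
    (∀ x ∈ U, ∀ y ∈ U, pmul k x y ∈ U ∧ pbr k x y ∈ U) → U = ⊤

/-- `P` is Noetherian: every ideal is generated, as an ideal, by a finite set. -/
def IsNoetherianPoisson (P : Type*) [AddCommGroup P] [Module k P] [PoissonAlgebra k P] : Prop :=
  ∀ I : Submodule k P, IsPoissonIdeal I → ∃ s : Set P, s.Finite ∧ I = poissonIdealSpan k s

/-- The left-normed bracket `[f, a₁, …, aₙ]`. -/
def leftNormed (f : P) (l : List P) : P := l.foldl (pbr k) f

theorem poissonIdealSpan_mul_mem {S : Set P} {x : P} (hx : x ∈ poissonIdealSpan k S) (y : P) :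
    PoissonAlgebra.mul (k := k) x y ∈ poissonIdealSpan k S := by
  rw [PoissonAlgebra.mul_comm]
  exact (isPoissonIdeal_span k S y x hx).1

theorem poissonIdealSpan_bracket_mem {S : Set P} {x : P} (hx : x ∈ poissonIdealSpan k S) (y : P) :
    PoissonAlgebra.bracket (k := k) x y ∈ poissonIdealSpan k S := by
  have h := PoissonAlgebra.bracket_self (k := k) (x + y)
  simp only [map_add, LinearMap.add_apply, PoissonAlgebra.bracket_self, zero_add, add_zero] at h
  rw [eq_neg_of_add_eq_zero_right h]
  exact neg_mem (isPoissonIdeal_span k S y x hx).2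

/-- The quotient Poisson algebra `P / Id(S)`. -/
instance quotientPoissonAlgebra (S : Set P) : PoissonAlgebra k (P ⧸ poissonIdealSpan k S) where
  mul := (poissonIdealSpan k S).liftQ
    { toFun := fun x => (poissonIdealSpan k S).mapQ (poissonIdealSpan k S)
        (PoissonAlgebra.mul (k := k) x) (fun y hy => (isPoissonIdeal_span k S x y hy).1)
      map_add' := fun x x' => by
        ext y
        exact congrArg (Submodule.Quotient.mk (p := poissonIdealSpan k S))
          (LinearMap.map_add₂ (PoissonAlgebra.mul (k := k)) x x' y)
      map_smul' := fun c x => by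
        ext y
        exact congrArg (Submodule.Quotient.mk (p := poissonIdealSpan k S))
          (LinearMap.map_smul₂ (PoissonAlgebra.mul (k := k)) c x y) }
    (fun x hx => by
      ext y
      change Submodule.Quotient.mk _ = (0 : P ⧸ poissonIdealSpan k S)
      exact (Submodule.Quotient.mk_eq_zero _).2 (poissonIdealSpan_mul_mem k hx y))
  bracket := (poissonIdealSpan k S).liftQ
    { toFun := fun x => (poissonIdealSpan k S).mapQ (poissonIdealSpan k S)
        (PoissonAlgebra.bracket (k := k) x) (fun y hy => (isPoissonIdeal_span k S x y hy).2)
      map_add' := fun x x' => by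
        ext y
        exact congrArg (Submodule.Quotient.mk (p := poissonIdealSpan k S))
          (LinearMap.map_add₂ (PoissonAlgebra.bracket (k := k)) x x' y)
      map_smul' := fun c x => by
        ext y
        exact congrArg (Submodule.Quotient.mk (p := poissonIdealSpan k S))
          (LinearMap.map_smul₂ (PoissonAlgebra.bracket (k := k)) c x y) }
    (fun x hx => by
      ext y
      change Submodule.Quotient.mk _ = (0 : P ⧸ poissonIdealSpan k S)
      exact (Submodule.Quotient.mk_eq_zero _).2 (poissonIdealSpan_bracket_mem k hx y))
  mul_comm x y := by
    induction x using Submodule.Quotient.induction_on with | _ x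
    induction y using Submodule.Quotient.induction_on with | _ y
    exact congrArg (Submodule.Quotient.mk (p := poissonIdealSpan k S))
      (PoissonAlgebra.mul_comm (k := k) x y)
  mul_assoc x y z := by
    induction x using Submodule.Quotient.induction_on with | _ x
    induction y using Submodule.Quotient.induction_on with | _ y
    induction z using Submodule.Quotient.induction_on with | _ z
    exact congrArg (Submodule.Quotient.mk (p := poissonIdealSpan k S))
      (PoissonAlgebra.mul_assoc (k := k) x y z)
  bracket_self x := by
    induction x using Submodule.Quotient.induction_on with | _ x
    exact congrArg (Submodule.Quotient.mk (p := poissonIdealSpan k S))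
      (PoissonAlgebra.bracket_self (k := k) x)
  jacobi x y z := by
    induction x using Submodule.Quotient.induction_on with | _ x
    induction y using Submodule.Quotient.induction_on with | _ y
    induction z using Submodule.Quotient.induction_on with | _ z
    exact congrArg (Submodule.Quotient.mk (p := poissonIdealSpan k S))
      (PoissonAlgebra.jacobi (k := k) x y z)
  leibniz x y z := by
    induction x using Submodule.Quotient.induction_on with | _ x
    induction y using Submodule.Quotient.induction_on with | _ y
    induction z using Submodule.Quotient.induction_on with | _ z
    exact congrArg (Submodule.Quotient.mk (p := poissonIdealSpan k S))
      (PoissonAlgebra.leibniz (k := k) x y z)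

end General

/-- Formal expressions in the letters `X` with the operations of a Poisson algebra over `k`. -/
inductive PTerm (k : Type*) (X : Type*) where
  | var (a : X) : PTerm k X
  | zero : PTerm k X
  | add (s t : PTerm k X) : PTerm k X
  | smul (c : k) (t : PTerm k X) : PTerm k X
  | mul (s t : PTerm k X) : PTerm k X
  | bracket (s t : PTerm k X) : PTerm k X

namespace PTerm

variable {k : Type*} {X : Type*}

/-- The term is a product or a bracket of two terms. -/
inductive IsProd : PTerm k X → Prop
  | mul (s t : PTerm k X) : IsProd (PTerm.mul s t)
  | bracket (s t : PTerm k X) : IsProd (PTerm.bracket s t)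

/-- Equality of terms modulo the identities of metabelian Poisson `k`-algebras. -/
inductive Rel [Field k] : PTerm k X → PTerm k X → Prop
  | refl (s) : Rel s s
  | symm {s t} : Rel s t → Rel t s
  | trans {s t u} : Rel s t → Rel t u → Rel s u
  | add_congr {s s' t t'} : Rel s s' → Rel t t' → Rel (add s t) (add s' t')
  | smul_congr (c : k) {t t'} : Rel t t' → Rel (smul c t) (smul c t')
  | mul_congr {s s' t t'} : Rel s s' → Rel t t' → Rel (mul s t) (mul s' t')
  | bracket_congr {s s' t t'} : Rel s s' → Rel t t' → Rel (bracket s t) (bracket s' t')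
  | add_comm (s t) : Rel (add s t) (add t s)
  | add_assoc (s t u) : Rel (add (add s t) u) (add s (add t u))
  | zero_add (s) : Rel (add zero s) s
  | smul_add (c : k) (s t) : Rel (smul c (add s t)) (add (smul c s) (smul c t))
  | add_smul (c d : k) (s) : Rel (smul (c + d) s) (add (smul c s) (smul d s))
  | smul_smul (c d : k) (s) : Rel (smul (c * d) s) (smul c (smul d s))
  | one_smul (s) : Rel (smul 1 s) s
  | zero_smul (s) : Rel (smul 0 s) zero
  | mul_comm (s t) : Rel (mul s t) (mul t s)
  | mul_assoc (s t u) : Rel (mul (mul s t) u) (mul s (mul t u))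
  | mul_add (s t u) : Rel (mul s (add t u)) (add (mul s t) (mul s u))
  | mul_smul (c : k) (s t) : Rel (mul s (smul c t)) (smul c (mul s t))
  | bracket_self (s) : Rel (bracket s s) zero
  | add_bracket (s t u) : Rel (bracket (add s t) u) (add (bracket s u) (bracket t u))
  | bracket_add (s t u) : Rel (bracket s (add t u)) (add (bracket s t) (bracket s u))
  | smul_bracket (c : k) (s t) : Rel (bracket (smul c s) t) (smul c (bracket s t))
  | bracket_smul (c : k) (s t) : Rel (bracket s (smul c t)) (smul c (bracket s t))
  | jacobi (s t u) :
      Rel (add (add (bracket s (bracket t u)) (bracket t (bracket u s)))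
        (bracket u (bracket s t))) zero
  | leibniz (s t u) :
      Rel (bracket s (mul t u)) (add (mul (bracket s t) u) (mul t (bracket s u)))
  | metabelian_mul {s t} : IsProd s → IsProd t → Rel (mul s t) zero
  | metabelian_bracket {s t} : IsProd s → IsProd t → Rel (bracket s t) zero

/-- The congruence `Rel` as a setoid. -/
def relSetoid (k : Type*) (X : Type*) [Field k] : Setoid (PTerm k X) :=
  ⟨Rel, Rel.refl, Rel.symm, Rel.trans⟩

/-- The alphabet in which terms are written: scalars, letters, and the four symbols
`0` (`0`), `1` (`+`), `2` (product), `3` (bracket). -/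
abbrev Token (k : Type*) (X : Type*) := (k ⊕ X) ⊕ Fin 4

/-- A term as a string, in Polish notation. A scalar symbol `c` stands for the unary operation
`c • _`. -/
def toTokens : PTerm k X → List (Token k X)
  | var a => [Sum.inl (Sum.inr a)]
  | zero => [Sum.inr 0]
  | add s t => Sum.inr 1 :: (s.toTokens ++ t.toTokens)
  | smul c t => Sum.inl (Sum.inl c) :: t.toTokens
  | mul s t => Sum.inr 2 :: (s.toTokens ++ t.toTokens)
  | bracket s t => Sum.inr 3 :: (s.toTokens ++ t.toTokens)

end PTerm

/-- The free metabelian Poisson algebra `MP_k(X)`. -/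
def FreeMP (k : Type*) (X : Type*) [Field k] : Type _ := Quotient (PTerm.relSetoid k X)

namespace FreeMP

variable (k : Type*) {X : Type*} [Field k]

/-- The element of `MP_k(X)` denoted by a term. -/
def ofTerm {k : Type*} [Field k] (t : PTerm k X) : FreeMP k X :=
  Quotient.mk (PTerm.relSetoid k X) t

/-- A letter as an element of `MP_k(X)`. -/
def ofLetter (a : X) : FreeMP k X := ofTerm (PTerm.var a)

variable {k}

instance : Zero (FreeMP k X) := ⟨ofTerm PTerm.zero⟩

instance : Add (FreeMP k X) :=
  ⟨Quotient.map₂ PTerm.add fun _ _ h _ _ h' => PTerm.Rel.add_congr h h'⟩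

instance : SMul k (FreeMP k X) :=
  ⟨fun c => Quotient.map (PTerm.smul c) fun _ _ h => PTerm.Rel.smul_congr c h⟩

instance : AddCommGroup (FreeMP k X) where
  add_assoc := by
    rintro ⟨s⟩ ⟨t⟩ ⟨u⟩
    exact Quotient.sound (PTerm.Rel.add_assoc s t u)
  zero_add := by
    rintro ⟨s⟩
    exact Quotient.sound (PTerm.Rel.zero_add s)
  add_zero := by
    rintro ⟨s⟩
    exact Quotient.sound ((PTerm.Rel.add_comm s _).trans (PTerm.Rel.zero_add s))
  add_comm := by
    rintro ⟨s⟩ ⟨t⟩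
    exact Quotient.sound (PTerm.Rel.add_comm s t)
  nsmul := nsmulRec
  neg x := (-1 : k) • x
  zsmul := @zsmulRec _ _ _ ⟨fun x => (-1 : k) • x⟩ nsmulRec
  neg_add_cancel := by
    rintro ⟨s⟩
    refine Quotient.sound ?_
    have h := PTerm.Rel.add_smul (-1 : k) 1 s
    rw [neg_add_cancel] at h
    exact ((PTerm.Rel.add_congr (PTerm.Rel.refl _) (PTerm.Rel.one_smul s).symm).trans
      h.symm).trans (PTerm.Rel.zero_smul s)

instance : Module k (FreeMP k X) where
  one_smul := by
    rintro ⟨s⟩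
    exact Quotient.sound (PTerm.Rel.one_smul s)
  mul_smul := by
    rintro c d ⟨s⟩
    exact Quotient.sound (PTerm.Rel.smul_smul c d s)
  smul_zero := by
    intro c
    have h := PTerm.Rel.smul_smul c 0 (PTerm.zero : PTerm k X)
    rw [mul_zero] at h
    exact Quotient.sound (((PTerm.Rel.smul_congr c (PTerm.Rel.zero_smul _)).symm.trans
      h.symm).trans (PTerm.Rel.zero_smul _))
  smul_add := by
    rintro c ⟨s⟩ ⟨t⟩
    exact Quotient.sound (PTerm.Rel.smul_add c s t)
  add_smul := by
    rintro c d ⟨s⟩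
    exact Quotient.sound (PTerm.Rel.add_smul c d s)
  zero_smul := by
    rintro ⟨s⟩
    exact Quotient.sound (PTerm.Rel.zero_smul s)

instance : PoissonAlgebra k (FreeMP k X) where
  mul := LinearMap.mk₂ k
    (Quotient.map₂ PTerm.mul fun _ _ h _ _ h' => PTerm.Rel.mul_congr h h')
    (by
      rintro ⟨s⟩ ⟨t⟩ ⟨u⟩
      exact Quotient.sound (((PTerm.Rel.mul_comm _ _).trans (PTerm.Rel.mul_add u s t)).trans
        (PTerm.Rel.add_congr (PTerm.Rel.mul_comm _ _) (PTerm.Rel.mul_comm _ _))))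
    (by
      rintro c ⟨s⟩ ⟨t⟩
      exact Quotient.sound (((PTerm.Rel.mul_comm _ _).trans (PTerm.Rel.mul_smul c t s)).trans
        (PTerm.Rel.smul_congr c (PTerm.Rel.mul_comm _ _))))
    (by
      rintro ⟨s⟩ ⟨t⟩ ⟨u⟩
      exact Quotient.sound (PTerm.Rel.mul_add s t u))
    (by
      rintro c ⟨s⟩ ⟨t⟩
      exact Quotient.sound (PTerm.Rel.mul_smul c s t))
  bracket := LinearMap.mk₂ k
    (Quotient.map₂ PTerm.bracket fun _ _ h _ _ h' => PTerm.Rel.bracket_congr h h')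
    (by
      rintro ⟨s⟩ ⟨t⟩ ⟨u⟩
      exact Quotient.sound (PTerm.Rel.add_bracket s t u))
    (by
      rintro c ⟨s⟩ ⟨t⟩
      exact Quotient.sound (PTerm.Rel.smul_bracket c s t))
    (by
      rintro ⟨s⟩ ⟨t⟩ ⟨u⟩
      exact Quotient.sound (PTerm.Rel.bracket_add s t u))
    (by
      rintro c ⟨s⟩ ⟨t⟩
      exact Quotient.sound (PTerm.Rel.bracket_smul c s t))
  mul_comm := by
    rintro ⟨s⟩ ⟨t⟩
    exact Quotient.sound (PTerm.Rel.mul_comm s t)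
  mul_assoc := by
    rintro ⟨s⟩ ⟨t⟩ ⟨u⟩
    exact Quotient.sound (PTerm.Rel.mul_assoc s t u)
  bracket_self := by
    rintro ⟨s⟩
    exact Quotient.sound (PTerm.Rel.bracket_self s)
  jacobi := by
    rintro ⟨s⟩ ⟨t⟩ ⟨u⟩
    exact Quotient.sound (PTerm.Rel.jacobi s t u)
  leibniz := by
    rintro ⟨s⟩ ⟨t⟩ ⟨u⟩
    exact Quotient.sound (PTerm.Rel.leibniz s t u)

end FreeMP

/-- The metabelian Poisson algebra `MP_k(X | S) = MP_k(X) / Id(S)`. -/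
abbrev PresentedMP (k : Type*) (X : Type*) [Field k] (S : Set (FreeMP k X)) :=
  FreeMP k X ⧸ poissonIdealSpan k S

/-- `P` is isomorphic to `MP_k(X | S)` for a finite set `X` and a finite set `S`. -/
def IsFPMetabelianPoisson (k : Type*) (P : Type*) [Field k] [AddCommGroup P] [Module k P]
    [PoissonAlgebra k P] : Prop :=
  ∃ (n : ℕ) (S : Set (FreeMP k (Fin n))), S.Finite ∧
    ∃ e : PresentedMP k (Fin n) S ≃ₗ[k] P,
      ∀ x y, e (pmul k x y) = pmul k (e x) (e y) ∧ e (pbr k x y) = pbr k (e x) (e y)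

/-- Formal monomials: `lie a [a₂, …, aₙ]` is `[a, a₂, …, aₙ]`, `com [a₁, …, aₙ]` is `a₁ ⋯ aₙ`,
and `mix a [a₂, …, aₙ] b` is `[a, a₂, …, aₙ] · b`. -/
inductive MPWord (X : Type*) where
  | lie (a : X) (l : List X) : MPWord X
  | com (l : List X) : MPWord X
  | mix (a : X) (l : List X) (b : X) : MPWord X

namespace MPWord

variable {X : Type*}

/-- The letters of a monomial from left to right. -/
def letters : MPWord X → List X
  | lie a l => a :: l
  | com l => l
  | mix a l b => a :: (l ++ [b])

/-- The length `ℓ(W)`. -/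
def len (W : MPWord X) : ℕ := W.letters.length

/-- The number `Pb(W)` of Poisson brackets. -/
def pb : MPWord X → ℕ
  | lie _ l => l.length
  | com _ => 0
  | mix _ l _ => l.length

variable [LinearOrder X]

/-- `W₁ < W₂`: lexicographic comparison of `(ℓ(W), Pb(W), a₁, …, aₙ)`. -/
def lt (W₁ W₂ : MPWord X) : Prop :=
  W₁.len < W₂.len ∨ W₁.len = W₂.len ∧
    (W₁.pb < W₂.pb ∨ W₁.pb = W₂.pb ∧ List.Lex (· < ·) W₁.letters W₂.letters)

/-- The set `MPB_k(X)` of basis monomials; it depends on whether `char k = 2`. -/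
inductive IsBasic (k : Type*) [Field k] : MPWord X → Prop
  | letter (a : X) : IsBasic k (lie a [])
  | lie (a b : X) (l : List X) : b < a → (b :: l).Pairwise (· ≤ ·) → IsBasic k (lie a (b :: l))
  | com₂ (a b : X) : a ≤ b → IsBasic k (com [a, b])
  | com₃ (a b c : X) : a ≤ b → b ≤ c → IsBasic k (com [a, b, c])
  | mix₂ (a₁ a₂ a₃ : X) : a₂ < a₁ → IsBasic k (mix a₁ [a₂] a₃)
  | mix₃ (a₁ a₂ a₃ a₄ : X) : ¬ CharP k 2 → a₂ < a₁ → a₁ ≤ a₄ → a₂ ≤ a₃ → a₃ < a₄ →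
      IsBasic k (mix a₁ [a₂, a₃] a₄)
  | mix (a b : X) (l : List X) (c : X) : CharP k 2 → l ≠ [] → b < a →
      (b :: (l ++ [c])).Pairwise (· ≤ ·) → IsBasic k (mix a (b :: l) c)

/-- The element of `MP_k(X)` given by a monomial. -/
def eval (k : Type*) [Field k] {X : Type*} : MPWord X → FreeMP k X
  | lie a l => leftNormed k (FreeMP.ofLetter k a) (l.map (FreeMP.ofLetter k))
  | com [] => 0
  | com (a :: l) => (l.map (FreeMP.ofLetter k)).foldl (pmul k) (FreeMP.ofLetter k a)
  | mix a l b =>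
      pmul k (leftNormed k (FreeMP.ofLetter k a) (l.map (FreeMP.ofLetter k)))
        (FreeMP.ofLetter k b)

end MPWord

section GroebnerShirshov

variable {k : Type*} {X : Type*} [Field k] [LinearOrder X]

/-- The span of the basis monomials that are smaller than `W`. -/
def lowerSpan (k : Type*) [Field k] (W : MPWord X) : Submodule k (FreeMP k X) :=
  Submodule.span k {f | ∃ V : MPWord X, V.IsBasic k ∧ V.lt W ∧ f = V.eval k}

/-- `W` is the leading monomial of `f` and `c` is its leading coefficient: `f` is `c • W` plus a
combination of smaller basis monomials, and it is not a combination of the smaller ones alone.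
The zero polynomial has no leading term. -/
def IsLeadingTerm (f : FreeMP k X) (c : k) (W : MPWord X) : Prop :=
  W.IsBasic k ∧ f - c • W.eval k ∈ lowerSpan k W ∧ f ∉ lowerSpan k W

/-- `W` is the leading monomial of `f`. -/
def IsLeadingMonomial (f : FreeMP k X) (W : MPWord X) : Prop := ∃ c : k, IsLeadingTerm f c W

/-- All elements of `S` have leading coefficient `1`. -/
def IsMonicSet (S : Set (FreeMP k X)) : Prop := ∀ s ∈ S, ∃ W, IsLeadingTerm s 1 W

/-- The bracket `[f, a₁, …, aₙ]` of an element with letters. -/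
def bracketLetters (f : FreeMP k X) (l : List X) : FreeMP k X :=
  leftNormed k f (l.map (FreeMP.ofLetter k))

/-- Normal `S`-polynomials. -/
inductive IsNormalPoly (S : Set (FreeMP k X)) : FreeMP k X → Prop
  | base (s) : s ∈ S → IsNormalPoly S s
  | bracket (s) (W : MPWord X) (l : List X) : s ∈ S → IsLeadingMonomial s W → 5 ≤ W.len →
      IsNormalPoly S (bracketLetters s l)

/-- `R` is a Gröbner–Shirshov basis for the quotient `MP_k(X) / I`. -/
def IsGroebnerShirshovBasis (R : Set (FreeMP k X)) (I : Submodule k (FreeMP k X)) : Prop :=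
  I = poissonIdealSpan k R ∧
    ∀ f ∈ I, f ≠ 0 → ∃ h W, IsNormalPoly R h ∧ IsLeadingMonomial f W ∧ IsLeadingMonomial h W

/-- Multiplication compositions of `S`. -/
inductive IsMulComposition (S : Set (FreeMP k X)) : FreeMP k X → Prop
  | mul_letter (s) (a : X) : s ∈ S → IsMulComposition S (pmul k s (FreeMP.ofLetter k a))
  | mul_bracket (s) (a₁ a₂ : X) : s ∈ S → a₂ < a₁ →
      IsMulComposition S (pmul k s (pbr k (FreeMP.ofLetter k a₁) (FreeMP.ofLetter k a₂)))
  | bracket_bracket (s) (a₁ a₂ : X) : s ∈ S → a₂ < a₁ →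
      IsMulComposition S (pbr k s (pbr k (FreeMP.ofLetter k a₁) (FreeMP.ofLetter k a₂)))
  | bracket_letter (s) (W : MPWord X) (a : X) : s ∈ S → IsLeadingMonomial s W → W.len ≤ 4 →
      IsMulComposition S (pbr k s (FreeMP.ofLetter k a))

/-- `h` is a combination of normal `S`-polynomials whose leading monomials do not exceed that
of `h`; the zero composition is trivial. -/
def IsTrivialMulComposition (S : Set (FreeMP k X)) (h : FreeMP k X) : Prop :=
  h = 0 ∨ ∃ V, IsLeadingMonomial h V ∧
    h ∈ Submodule.span k
      {g | IsNormalPoly S g ∧ ∃ W, IsLeadingMonomial g W ∧ (W.lt V ∨ W = V)}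

/-- `IsGeneralComposition S f W`: `f` is a general composition of `S` with respect to `W`.
In the last two cases `l₁ p = l₂ q`, with `p` and `q` disjoint, is the least common multiple of
`l₁` and `l₂` in the free commutative monoid on `X`. -/
inductive IsGeneralComposition (S : Set (FreeMP k X)) : FreeMP k X → MPWord X → Prop
  | sub (s₁ s₂) (W : MPWord X) : s₁ ∈ S → s₂ ∈ S →
      IsLeadingMonomial s₁ W → IsLeadingMonomial s₂ W → IsGeneralComposition S (s₁ - s₂) W
  | lie (s₁ s₂) (a : X) (l₁ l₂ p q : List X) (W : MPWord X) : s₁ ∈ S → s₂ ∈ S →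
      IsLeadingMonomial s₁ (MPWord.lie a l₁) → IsLeadingMonomial s₂ (MPWord.lie a l₂) →
      4 ≤ l₁.length → 4 ≤ l₂.length →
      (l₁ ++ p).Perm (l₂ ++ q) → p.Disjoint q →
      p.Pairwise (· ≤ ·) → q.Pairwise (· ≤ ·) →
      IsLeadingMonomial (bracketLetters s₁ p) W →
      IsGeneralComposition S (bracketLetters s₁ p - bracketLetters s₂ q) W
  | mix (s₁ s₂) (a : X) (l₁ : List X) (b₁ : X) (l₂ : List X) (b₂ : X) (p q : List X)
      (W : MPWord X) : s₁ ∈ S → s₂ ∈ S →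
      IsLeadingMonomial s₁ (MPWord.mix a l₁ b₁) → IsLeadingMonomial s₂ (MPWord.mix a l₂ b₂) →
      4 ≤ (l₁ ++ [b₁]).length → 4 ≤ (l₂ ++ [b₂]).length →
      ((l₁ ++ [b₁]) ++ p).Perm ((l₂ ++ [b₂]) ++ q) → p.Disjoint q →
      p.Pairwise (· ≤ ·) → q.Pairwise (· ≤ ·) →
      IsLeadingMonomial (bracketLetters s₁ p) W →
      IsGeneralComposition S (bracketLetters s₁ p - bracketLetters s₂ q) W

/-- `f` is a combination of normal `S`-polynomials whose leading monomials are smaller than `W`. -/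
def IsTrivialModulo (S : Set (FreeMP k X)) (f : FreeMP k X) (W : MPWord X) : Prop :=
  f ∈ Submodule.span k {g | IsNormalPoly S g ∧ ∃ V, IsLeadingMonomial g V ∧ V.lt W}

/-- `f` is a nontrivial composition of `S`. -/
def IsNontrivialComposition (S : Set (FreeMP k X)) (f : FreeMP k X) : Prop :=
  (IsMulComposition S f ∧ ¬ IsTrivialMulComposition S f) ∨
    ∃ W, IsGeneralComposition S f W ∧ ¬ IsTrivialModulo S f W

/-- The completion procedure: at every step all nontrivial compositions, divided by their leading
coefficients, are added. -/
def completion (S : Set (FreeMP k X)) : ℕ → Set (FreeMP k X)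
  | 0 => S
  | n + 1 => completion S n ∪
      {g | ∃ f c W, IsNontrivialComposition (completion S n) f ∧ IsLeadingTerm f c W ∧
        g = c⁻¹ • f}

/-- One step of the reduction modulo `R`: `f` is replaced by `f - lc(f) h`, where `h` is a monic
normal `R`-polynomial with the same leading monomial as `f`. -/
def ReducesTo (R : Set (FreeMP k X)) (f g : FreeMP k X) : Prop :=
  ∃ h c W, IsNormalPoly R h ∧ IsLeadingTerm h 1 W ∧ IsLeadingTerm f c W ∧ g = f - c • h

end GroebnerShirshov

/-- The field `k`, with elements coded by natural numbers, is a computable field. -/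
structure IsComputableField (k : Type*) [Field k] [Primcodable k] : Prop where
  add : Computable₂ fun x y : k => x + y
  mul : Computable₂ fun x y : k => x * y
  neg : Computable fun x : k => -x
  inv : Computable fun x : k => x⁻¹

/-! ### Identities in Poisson algebras and their ideals -/

section PoissonGeneral

variable {k : Type*} {P : Type*} [Field k] [AddCommGroup P] [Module k P] [PoissonAlgebra k P]

/-! Let D be the span of all products and brackets in `FreeMP k X`. It is an ideal with zero
operations, so on D brackets with letters commute, two products with letters give zero, and [f, x]·y
= -[f, y]·x. Hence long monomials have only two shapes, [a, b, m] and [a, b, l]·c. The second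
vanishes from length five on unless the characteristic is two, and in characteristic two all its
letters after b may be permuted as well. Both shapes straighten by at most one Jacobi step
(`opEval_mem_degSpan`), so a long basis monomial amounts to a flag, a first letter and an element of
the free commutative monoid (`MPWord.big`).

A representation by polynomials over the dual numbers separates the monomials of length at least
five (`MPWord.IsBasic.eval_notMem_lowerSpan`). Independence of the shorter ones is never used. From
length five on, a bracket with a letter multiplies the commutative part of the leading monomial by
that letter (`IsLeadingTerm.pbr_letter`). Apart from finitely many short monomials, the leading
monomials of an ideal therefore form finitely many subsets of a free commutative monoid that are
closed under multiplication, and Dickson's lemma gives finite Gröbner–Shirshov bases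
(`exists_finite_groebnerShirshov`). Finite presentation and the Noetherian property follow by
pulling ideals back to a free algebra.

Completion rests on the composition-diamond lemma `IsCompositionClosed.isGroebnerShirshovBasis`. In
the union of all stages every composition is trivial, so the union is a Gröbner–Shirshov basis. By
Dickson's lemma finitely many of its leading monomials suffice, and these appear at a finite stage.
From then on each stage is itself a Gröbner–Shirshov basis and has no nontrivial composition, so
nothing more is added.

The word problem is solved without running the completion. An equality has a certificate, namely an
expression of the difference by consequences of the identities and relations. An inequality is
witnessed by a finite-dimensional algebra given by a multiplication table: D is a finitely generated
module over the commutative algebra generated by the operators of the letters, and Krull's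
intersection theorem with the Nullstellensatz makes such modules residually finite-dimensional
(`FreeMP.exists_finite_quotient`). A search through both kinds of certificates always ends. -/

theorem pmul_add (x y z : P) : pmul k x (y + z) = pmul k x y + pmul k x z := map_add _ _ _
theorem add_pmul (x y z : P) : pmul k (x + y) z = pmul k x z + pmul k y z :=
  LinearMap.map_add₂ _ _ _ _
theorem pmul_smul (c : k) (x y : P) : pmul k x (c • y) = c • pmul k x y := map_smul _ _ _
theorem smul_pmul (c : k) (x y : P) : pmul k (c • x) y = c • pmul k x y :=
  LinearMap.map_smul₂ _ _ _ _
@[simp] theorem pmul_zero (x : P) : pmul k x 0 = 0 := map_zero _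
@[simp] theorem zero_pmul (x : P) : pmul k 0 x = 0 := LinearMap.map_zero₂ _ _
theorem neg_pmul (x y : P) : pmul k (-x) y = - pmul k x y := LinearMap.map_neg₂ _ _ _
theorem pmul_neg (x y : P) : pmul k x (-y) = - pmul k x y := map_neg _ _
theorem pmul_comm (x y : P) : pmul k x y = pmul k y x := PoissonAlgebra.mul_comm x y
theorem pmul_assoc (x y z : P) : pmul k (pmul k x y) z = pmul k x (pmul k y z) :=
  PoissonAlgebra.mul_assoc x y z

theorem pbr_add (x y z : P) : pbr k x (y + z) = pbr k x y + pbr k x z := map_add _ _ _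
theorem add_pbr (x y z : P) : pbr k (x + y) z = pbr k x z + pbr k y z :=
  LinearMap.map_add₂ _ _ _ _
theorem pbr_smul (c : k) (x y : P) : pbr k x (c • y) = c • pbr k x y := map_smul _ _ _
theorem smul_pbr (c : k) (x y : P) : pbr k (c • x) y = c • pbr k x y :=
  LinearMap.map_smul₂ _ _ _ _
@[simp] theorem pbr_zero (x : P) : pbr k x 0 = 0 := map_zero _
@[simp] theorem zero_pbr (x : P) : pbr k 0 x = 0 := LinearMap.map_zero₂ _ _
theorem neg_pbr (x y : P) : pbr k (-x) y = - pbr k x y := LinearMap.map_neg₂ _ _ _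
theorem pbr_neg (x y : P) : pbr k x (-y) = - pbr k x y := map_neg _ _
theorem sub_pbr (x y z : P) : pbr k (x - y) z = pbr k x z - pbr k y z :=
  LinearMap.map_sub₂ _ _ _ _
@[simp] theorem pbr_self (x : P) : pbr k x x = 0 := PoissonAlgebra.bracket_self x

theorem pbr_skew (x y : P) : pbr k x y = - pbr k y x := by
  have h := pbr_self (k := k) (x + y)
  rw [add_pbr, pbr_add, pbr_add, pbr_self, pbr_self, zero_add, add_zero] at h
  exact eq_neg_of_add_eq_zero_left h

/-- The bracket with a fixed element on the right is a derivation of the bracket. -/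
theorem pbr_pbr_left (x y z : P) :
    pbr k (pbr k x y) z = pbr k (pbr k x z) y + pbr k x (pbr k y z) := by
  have h : pbr k x (pbr k y z) + pbr k y (pbr k z x) + pbr k z (pbr k x y) = 0 :=
    PoissonAlgebra.jacobi x y z
  rw [pbr_skew (pbr k x y) z, pbr_skew (pbr k x z) y, pbr_skew x z, pbr_neg, neg_neg]
  rw [← sub_eq_zero, ← neg_eq_zero, ← h]
  abel

/-- The bracket with a fixed element on the right is a derivation of the product. -/
theorem pbr_pmul_left (x y z : P) :
    pbr k (pmul k x y) z = pmul k (pbr k x z) y + pmul k x (pbr k y z) := by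
  have h : pbr k z (pmul k x y) = pmul k (pbr k z x) y + pmul k x (pbr k z y) :=
    PoissonAlgebra.leibniz z x y
  rw [pbr_skew, h, pbr_skew z x, pbr_skew z y, neg_pmul, pmul_neg]
  abel

theorem pbr_pmul_right (x y z : P) :
    pbr k x (pmul k y z) = pmul k (pbr k x y) z + pmul k y (pbr k x z) :=
  PoissonAlgebra.leibniz x y z

theorem IsPoissonIdeal.pmul_left {I : Submodule k P} (hI : IsPoissonIdeal I) (x : P) {y : P}
    (hy : y ∈ I) : pmul k x y ∈ I := (hI x y hy).1

theorem IsPoissonIdeal.pbr_left {I : Submodule k P} (hI : IsPoissonIdeal I) (x : P) {y : P}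
    (hy : y ∈ I) : pbr k x y ∈ I := (hI x y hy).2

theorem IsPoissonIdeal.pmul_right {I : Submodule k P} (hI : IsPoissonIdeal I) {x : P}
    (hx : x ∈ I) (y : P) : pmul k x y ∈ I := by
  rw [pmul_comm]; exact (hI y x hx).1

theorem IsPoissonIdeal.pbr_right {I : Submodule k P} (hI : IsPoissonIdeal I) {x : P}
    (hx : x ∈ I) (y : P) : pbr k x y ∈ I := by
  rw [pbr_skew]; exact neg_mem (hI y x hx).2

theorem IsPoissonIdeal.leftNormed {I : Submodule k P} (hI : IsPoissonIdeal I) {x : P}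
    (hx : x ∈ I) (l : List P) : leftNormed k x l ∈ I := by
  induction l generalizing x with
  | nil => exact hx
  | cons a l ih => exact ih (hI.pbr_right hx a)

theorem subset_poissonIdealSpan (S : Set P) : S ⊆ poissonIdealSpan k S := by
  intro s hs
  rw [poissonIdealSpan, SetLike.mem_coe, Submodule.mem_sInf]
  exact fun I hI => hI.2 hs

theorem poissonIdealSpan_le {S : Set P} {I : Submodule k P} (hI : IsPoissonIdeal I)
    (h : S ⊆ I) : poissonIdealSpan k S ≤ I := sInf_le ⟨hI, h⟩

theorem IsPoissonIdeal.sup {I J : Submodule k P} (hI : IsPoissonIdeal I)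
    (hJ : IsPoissonIdeal J) : IsPoissonIdeal (I ⊔ J) := by
  intro x y hy
  obtain ⟨i, hi, j, hj, rfl⟩ := Submodule.mem_sup.1 hy
  rw [pmul_add, pbr_add]
  exact ⟨Submodule.add_mem_sup (hI x i hi).1 (hJ x j hj).1,
    Submodule.add_mem_sup (hI x i hi).2 (hJ x j hj).2⟩

theorem leftNormed_cons (x y : P) (l : List P) :
    leftNormed k x (y :: l) = leftNormed k (pbr k x y) l := rfl

theorem leftNormed_append (x : P) (l l' : List P) :
    leftNormed k x (l ++ l') = leftNormed k (leftNormed k x l) l' := List.foldl_append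

theorem leftNormed_add (x y : P) (l : List P) :
    leftNormed k (x + y) l = leftNormed k x l + leftNormed k y l := by
  induction l generalizing x y with
  | nil => rfl
  | cons a l ih => rw [leftNormed_cons, add_pbr, ih]; rfl

theorem leftNormed_smul (c : k) (x : P) (l : List P) :
    leftNormed k (c • x) l = c • leftNormed k x l := by
  induction l generalizing x with
  | nil => rfl
  | cons a l ih => rw [leftNormed_cons, smul_pbr, ih]; rfl

theorem leftNormed_neg (x : P) (l : List P) : leftNormed k (-x) l = -leftNormed k x l := by
  simpa using leftNormed_smul (-1 : k) x l

theorem leftNormed_sub (x y : P) (l : List P) :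
    leftNormed k (x - y) l = leftNormed k x l - leftNormed k y l := by
  rw [sub_eq_add_neg, leftNormed_add, leftNormed_neg, sub_eq_add_neg]

end PoissonGeneral

/-! ### Induction in the free algebra and its derived ideal -/

namespace FreeMP

variable {k : Type*} {X : Type*} [Field k]

theorem ofTerm_surjective : Function.Surjective (ofTerm : PTerm k X → FreeMP k X) :=
  Quotient.exists_rep

/-- Structural induction in the free metabelian Poisson algebra. -/
theorem induction {p : FreeMP k X → Prop} (letter : ∀ a, p (ofLetter k a)) (zero : p 0)
    (add : ∀ x y, p x → p y → p (x + y)) (smul : ∀ (c : k) x, p x → p (c • x))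
    (mul : ∀ x y, p x → p y → p (pmul k x y)) (bracket : ∀ x y, p x → p y → p (pbr k x y))
    (x : FreeMP k X) : p x := by
  obtain ⟨t, rfl⟩ := ofTerm_surjective x
  induction t with
  | var a => exact letter a
  | zero => exact zero
  | add s t hs ht => exact add _ _ hs ht
  | smul c t ht => exact smul c _ ht
  | mul s t hs ht => exact mul _ _ hs ht
  | bracket s t hs ht => exact bracket _ _ hs ht

/-- A subspace stable under multiplication by and bracket with letters is an ideal. -/
theorem isPoissonIdeal_of_letters {N : Submodule k (FreeMP k X)}
    (hmul : ∀ n ∈ N, ∀ a, pmul k n (ofLetter k a) ∈ N)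
    (hbr : ∀ n ∈ N, ∀ a, pbr k n (ofLetter k a) ∈ N) : IsPoissonIdeal N := by
  have key : ∀ x : FreeMP k X, ∀ n ∈ N, pmul k n x ∈ N ∧ pbr k n x ∈ N := by
    intro x
    induction x using FreeMP.induction with
    | letter a => exact fun n hn => ⟨hmul n hn a, hbr n hn a⟩
    | zero => intro n hn; simp
    | add x y hx hy =>
      intro n hn
      rw [pmul_add, pbr_add]
      exact ⟨add_mem (hx n hn).1 (hy n hn).1, add_mem (hx n hn).2 (hy n hn).2⟩
    | smul c x hx =>
      intro n hn
      rw [pmul_smul, pbr_smul]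
      exact ⟨N.smul_mem c (hx n hn).1, N.smul_mem c (hx n hn).2⟩
    | mul x y hx hy =>
      intro n hn
      rw [← pmul_assoc, pbr_pmul_right, pmul_comm x]
      exact ⟨(hy _ (hx n hn).1).1, add_mem (hy _ (hx n hn).2).1 (hx _ (hy n hn).2).1⟩
    | bracket x y hx hy =>
      intro n hn
      -- The derivation rule is solved for n·(x, y), and the Jacobi identity for (n, (x, y)), so
      -- that only operations with x and with y separately remain.
      have h1 : pmul k n (pbr k x y) = pbr k (pmul k n x) y - pmul k (pbr k n y) x := by
        rw [pbr_pmul_left]; abel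
      have h2 : pbr k n (pbr k x y) = pbr k (pbr k n x) y - pbr k (pbr k n y) x := by
        rw [pbr_pbr_left n x y]; abel
      rw [h1, h2]
      exact ⟨sub_mem (hy _ (hx n hn).1).2 (hx _ (hy n hn).2).1,
        sub_mem (hy _ (hx n hn).2).2 (hx _ (hy n hn).2).2⟩
  intro x y hy
  refine ⟨?_, ?_⟩
  · rw [pmul_comm]; exact (key x y hy).1
  · rw [pbr_skew]; exact neg_mem (key x y hy).2

/-- The span of all products and brackets. -/
def derived (k : Type*) (X : Type*) [Field k] : Submodule k (FreeMP k X) :=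
  Submodule.span k {f | ∃ x y, f = pmul k x y ∨ f = pbr k x y}

theorem pmul_mem_derived (x y : FreeMP k X) : pmul k x y ∈ derived k X :=
  Submodule.subset_span ⟨x, y, Or.inl rfl⟩

theorem pbr_mem_derived (x y : FreeMP k X) : pbr k x y ∈ derived k X :=
  Submodule.subset_span ⟨x, y, Or.inr rfl⟩

theorem isPoissonIdeal_derived : IsPoissonIdeal (derived k X) :=
  fun x y _ => ⟨pmul_mem_derived x y, pbr_mem_derived x y⟩

/-- The metabelian relations are imposed on terms that are products or brackets; bilinearity carries
them over to the span. -/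
theorem derived_mul_derived {x y : FreeMP k X} (hx : x ∈ derived k X) (hy : y ∈ derived k X) :
    pmul k x y = 0 ∧ pbr k x y = 0 := by
  induction hx, hy using Submodule.span_induction₂ with
  | mem_mem x y hx hy =>
    obtain ⟨x₁, x₂, hx⟩ := hx
    obtain ⟨y₁, y₂, hy⟩ := hy
    obtain ⟨s₁, rfl⟩ := ofTerm_surjective x₁
    obtain ⟨s₂, rfl⟩ := ofTerm_surjective x₂
    obtain ⟨t₁, rfl⟩ := ofTerm_surjective y₁
    obtain ⟨t₂, rfl⟩ := ofTerm_surjective y₂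
    have hs : ∃ s : PTerm k X, s.IsProd ∧ x = ofTerm s := by
      rcases hx with rfl | rfl
      exacts [⟨_, .mul s₁ s₂, rfl⟩, ⟨_, .bracket s₁ s₂, rfl⟩]
    have ht : ∃ s : PTerm k X, s.IsProd ∧ y = ofTerm s := by
      rcases hy with rfl | rfl
      exacts [⟨_, .mul t₁ t₂, rfl⟩, ⟨_, .bracket t₁ t₂, rfl⟩]
    obtain ⟨s, hs, rfl⟩ := hs
    obtain ⟨t, ht, rfl⟩ := ht
    exact ⟨Quotient.sound (PTerm.Rel.metabelian_mul hs ht),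
      Quotient.sound (PTerm.Rel.metabelian_bracket hs ht)⟩
  | zero_left => simp
  | zero_right => simp
  | add_left x y z _ _ _ h1 h2 => simp [add_pmul, add_pbr, h1, h2]
  | add_right x y z _ _ _ h1 h2 => simp [pmul_add, pbr_add, h1, h2]
  | smul_left c x y _ _ h => simp [smul_pmul, smul_pbr, h]
  | smul_right c x y _ _ h => simp [pmul_smul, pbr_smul, h]

end FreeMP

/-! ### The universal property of the free algebra -/

section Lift

variable {k : Type*} {X : Type*} {P : Type*} [Field k] [AddCommGroup P] [Module k P]
  [PoissonAlgebra k P]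

/-- The value of a term in a Poisson algebra. -/
def PTerm.evalIn (g : X → P) : PTerm k X → P
  | var a => g a
  | zero => 0
  | add s t => s.evalIn g + t.evalIn g
  | smul c t => c • t.evalIn g
  | mul s t => pmul k (s.evalIn g) (t.evalIn g)
  | bracket s t => pbr k (s.evalIn g) (t.evalIn g)

/-- Each defining relation is an axiom of vector spaces or Poisson algebras, except the two
metabelian ones; these hold because products and brackets take values in the abelian ideal `A`. -/
theorem PTerm.Rel.evalIn_eq (hP : IsMetabelianPoisson k P) (g : X → P) {s t : PTerm k X}
    (h : Rel s t) : s.evalIn g = t.evalIn g := by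
  obtain ⟨A, hA, hAA, hPA⟩ := hP
  have hprod : ∀ s : PTerm k X, s.IsProd → s.evalIn g ∈ A := by
    rintro _ (⟨s, t⟩ | ⟨s, t⟩)
    exacts [(hPA _ _).1, (hPA _ _).2]
  induction h with
  | refl => rfl
  | symm _ h => exact h.symm
  | trans _ _ h h' => exact h.trans h'
  | add_congr _ _ h h' => simp only [PTerm.evalIn, h, h']
  | smul_congr c _ h => simp only [PTerm.evalIn, h]
  | mul_congr _ _ h h' => simp only [PTerm.evalIn, h, h']
  | bracket_congr _ _ h h' => simp only [PTerm.evalIn, h, h']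
  | add_comm => exact _root_.add_comm _ _
  | add_assoc => exact _root_.add_assoc _ _ _
  | zero_add => exact _root_.zero_add _
  | smul_add => exact _root_.smul_add _ _ _
  | add_smul => exact _root_.add_smul _ _ _
  | smul_smul c d s => exact (_root_.smul_smul c d _).symm
  | one_smul => exact _root_.one_smul _ _
  | zero_smul => exact _root_.zero_smul _ _
  | mul_comm => exact pmul_comm _ _
  | mul_assoc => exact pmul_assoc _ _ _
  | mul_add => exact pmul_add _ _ _
  | mul_smul => exact pmul_smul _ _ _
  | bracket_self => exact pbr_self _
  | add_bracket => exact add_pbr _ _ _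
  | bracket_add => exact pbr_add _ _ _
  | smul_bracket => exact smul_pbr _ _ _
  | bracket_smul => exact pbr_smul _ _ _
  | jacobi => exact PoissonAlgebra.jacobi _ _ _
  | leibniz => exact PoissonAlgebra.leibniz _ _ _
  | metabelian_mul hs ht => exact (hAA _ (hprod _ hs) _ (hprod _ ht)).1
  | metabelian_bracket hs ht => exact (hAA _ (hprod _ hs) _ (hprod _ ht)).2

/-- The homomorphism from the free metabelian Poisson algebra given by the images of letters. -/
def FreeMP.lift (hP : IsMetabelianPoisson k P) (g : X → P) : FreeMP k X →ₗ[k] P where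
  toFun := Quotient.lift (PTerm.evalIn g) fun _ _ h => PTerm.Rel.evalIn_eq hP g h
  map_add' := by rintro ⟨s⟩ ⟨t⟩; rfl
  map_smul' := by rintro c ⟨s⟩; rfl

namespace FreeMP

variable (hP : IsMetabelianPoisson k P) (g : X → P)

@[simp] theorem lift_pmul (x y : FreeMP k X) :
    lift hP g (pmul k x y) = pmul k (lift hP g x) (lift hP g y) := by
  obtain ⟨s, rfl⟩ := ofTerm_surjective x
  obtain ⟨t, rfl⟩ := ofTerm_surjective y
  rfl

@[simp] theorem lift_pbr (x y : FreeMP k X) :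
    lift hP g (pbr k x y) = pbr k (lift hP g x) (lift hP g y) := by
  obtain ⟨s, rfl⟩ := ofTerm_surjective x
  obtain ⟨t, rfl⟩ := ofTerm_surjective y
  rfl

end FreeMP

end Lift

/-! ### Straightening of monomials -/

section Straightening

open FreeMP

variable {k : Type*} {X : Type*} [Field k]

local notation "ℓ" => FreeMP.ofLetter k

/-- By the Jacobi identity the two sides differ by (f, (x, y)), a bracket of two elements of the
derived ideal. -/
theorem FreeMP.derived_pbr_comm {f : FreeMP k X} (hf : f ∈ derived k X) (x y : FreeMP k X) :
    pbr k (pbr k f x) y = pbr k (pbr k f y) x := by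
  rw [pbr_pbr_left f x y, (derived_mul_derived hf (pbr_mem_derived x y)).2, add_zero]

theorem FreeMP.derived_pmul_pmul {f : FreeMP k X} (hf : f ∈ derived k X) (x y : FreeMP k X) :
    pmul k (pmul k f x) y = 0 := by
  rw [pmul_assoc, (derived_mul_derived hf (pmul_mem_derived x y)).1]

/-- Of the two terms of the derivation rule, f·(x, y) is a product inside the derived ideal and
vanishes. -/
theorem FreeMP.derived_pbr_pmul {f : FreeMP k X} (hf : f ∈ derived k X) (x y : FreeMP k X) :
    pbr k (pmul k f x) y = pmul k (pbr k f y) x := by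
  rw [pbr_pmul_left, (derived_mul_derived hf (pbr_mem_derived x y)).1, add_zero]

/-- Expand (f, x·y) = 0 by the Leibniz rule. The conflict between this sign and the commutation of
brackets is what separates characteristic two from all others. -/
theorem FreeMP.derived_pmul_pbr_skew {f : FreeMP k X} (hf : f ∈ derived k X)
    (x y : FreeMP k X) : pmul k (pbr k f x) y = - pmul k (pbr k f y) x := by
  have h := (derived_mul_derived hf (pmul_mem_derived x y)).2
  rw [pbr_pmul_right, pmul_comm x] at h
  exact eq_neg_of_add_eq_zero_left h

theorem bracketLetters_cons (f : FreeMP k X) (a : X) (l : List X) :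
    bracketLetters f (a :: l) = bracketLetters (pbr k f (ℓ a)) l := rfl

theorem bracketLetters_append (f : FreeMP k X) (l l' : List X) :
    bracketLetters f (l ++ l') = bracketLetters (bracketLetters f l) l' := by
  simp only [bracketLetters, List.map_append, leftNormed_append]

theorem bracketLetters_concat (f : FreeMP k X) (l : List X) (a : X) :
    bracketLetters f (l ++ [a]) = pbr k (bracketLetters f l) (ℓ a) := by
  rw [bracketLetters_append]; rfl

theorem bracketLetters_sub (f g : FreeMP k X) (l : List X) :
    bracketLetters (f - g) l = bracketLetters f l - bracketLetters g l := leftNormed_sub _ _ _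

/-- `opEval true f [a₁, …, aₙ]` is `[f, a₁, …, aₙ]` and `opEval false f [a₁, …, aₙ]` is
`[f, a₁, …, aₙ₋₁] · aₙ`. -/
def opEval (t : Bool) (f : FreeMP k X) : List X → FreeMP k X
  | [] => cond t f 0
  | [c] => cond t (pbr k f (ofLetter k c)) (pmul k f (ofLetter k c))
  | c :: d :: m => opEval t (pbr k f (ofLetter k c)) (d :: m)

theorem opEval_true (f : FreeMP k X) (m : List X) : opEval true f m = bracketLetters f m := by
  induction m generalizing f with
  | nil => rfl
  | cons c m ih =>
    cases m with
    | nil => rfl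
    | cons d m => exact ih _

theorem opEval_false_concat (f : FreeMP k X) (m : List X) (c : X) :
    opEval false f (m ++ [c]) = pmul k (bracketLetters f m) (ℓ c) := by
  induction m generalizing f with
  | nil => rfl
  | cons d m ih =>
    cases m with
    | nil => rfl
    | cons e m => exact ih _

theorem opEval_cons {t : Bool} {m : List X} (h : t = true ∨ m ≠ []) (f : FreeMP k X) (c : X) :
    opEval t f (c :: m) = opEval t (pbr k f (ℓ c)) m := by
  cases m with
  | nil =>
    cases t
    · simp at h
    · rfl
  | cons d m => rfl

theorem opEval_add (t : Bool) (f g : FreeMP k X) (m : List X) :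
    opEval t (f + g) m = opEval t f m + opEval t g m := by
  induction m generalizing f g with
  | nil => cases t <;> simp [opEval]
  | cons c m ih =>
    cases m with
    | nil => cases t <;> simp [opEval, add_pbr, add_pmul]
    | cons d m => simp only [opEval, add_pbr]; exact ih _ _

theorem opEval_smul (t : Bool) (c : k) (f : FreeMP k X) (m : List X) :
    opEval t (c • f) m = c • opEval t f m := by
  induction m generalizing f with
  | nil => cases t <;> simp [opEval]
  | cons c m ih =>
    cases m with
    | nil => cases t <;> simp [opEval, smul_pbr, smul_pmul]
    | cons d m => simp only [opEval, smul_pbr]; exact ih _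

theorem opEval_neg (t : Bool) (f : FreeMP k X) (m : List X) :
    opEval t (-f) m = -opEval t f m := by
  simpa using opEval_smul t (-1) f m

@[simp] theorem opEval_zero (t : Bool) (m : List X) : opEval t (0 : FreeMP k X) m = 0 := by
  simpa using opEval_smul t (0 : k) (0 : FreeMP k X) m

theorem charTwo_neg [CharP k 2] {M : Type*} [AddCommGroup M] [Module k M] (x : M) : -x = x := by
  have h : (-1 : k) = 1 := CharTwo.neg_eq 1
  rw [← one_smul k x, ← neg_smul, h]

/-- Bracket letters commute on the derived ideal. With the product flag, exchanging the last bracket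
letter with the product letter costs a sign, which is invisible in characteristic two. -/
theorem opEval_perm {t : Bool} (ht : t = true ∨ CharP k 2) {f : FreeMP k X}
    (hf : f ∈ derived k X) {m m' : List X} (h : m.Perm m') : opEval t f m = opEval t f m' := by
  induction h generalizing f with
  | nil => rfl
  | @cons c l l' h ih =>
    by_cases hl : l = []
    · subst hl; rw [List.nil_perm.1 h]
    · have hl' : l' ≠ [] := fun h' => hl (by subst h'; exact List.perm_nil.1 h)
      rw [opEval_cons (.inr hl), opEval_cons (.inr hl'), ih (pbr_mem_derived _ _)]
  | swap c d l =>
    cases l with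
    | nil =>
      cases t
      · have := ht.resolve_left (by simp)
        simp only [opEval, cond_false]
        rw [derived_pmul_pbr_skew hf, charTwo_neg (k := k)]
      · simp only [opEval, cond_true]
        rw [derived_pbr_comm hf]
    | cons e l => simp only [opEval]; rw [derived_pbr_comm hf]
  | trans _ _ ih ih' => rw [ih hf, ih' hf]

theorem bracketLetters_perm {f : FreeMP k X} (hf : f ∈ derived k X) {m m' : List X}
    (h : m.Perm m') : bracketLetters f m = bracketLetters f m' := by
  rw [← opEval_true, ← opEval_true, opEval_perm (.inl rfl) hf h]

theorem bracketLetters_mem_derived {f : FreeMP k X} (hf : f ∈ derived k X) (m : List X) :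
    bracketLetters f m ∈ derived k X := isPoissonIdeal_derived.leftNormed hf _

/-- The new bracket slips past the product letter by `derived_pbr_pmul` and past the bracket letters
by `derived_pbr_comm`. Neither produces a sign, so the characteristic plays no role. -/
theorem pbr_opEval {t : Bool} {m : List X} (h : t = true ∨ m ≠ []) {f : FreeMP k X}
    (hf : f ∈ derived k X) (c : X) : pbr k (opEval t f m) (ℓ c) = opEval t f (c :: m) := by
  induction m generalizing f with
  | nil =>
    cases t
    · simp at h
    · rfl
  | cons d m ih =>
    cases m with
    | nil =>
      cases t
      · simp only [opEval, cond_false]; rw [derived_pbr_pmul hf]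
      · simp only [opEval, cond_true]; rw [derived_pbr_comm hf]
    | cons e m =>
      have := ih (.inr (by simp)) (pbr_mem_derived f (ℓ d))
      simp only [opEval] at this ⊢
      rw [this, derived_pbr_comm hf]

/-- The condition on `t` and `m` guarantees that the letter in front of `m` is a bracket letter and
not the product letter, so the Jacobi identity applies to the innermost three letters. -/
theorem opEval_jacobi {t : Bool} {m : List X} (h : t = true ∨ m ≠ []) (a b c : X) :
    opEval t (pbr k (ℓ a) (ℓ b)) (c :: m) =
      opEval t (pbr k (ℓ a) (ℓ c)) (b :: m) - opEval t (pbr k (ℓ b) (ℓ c)) (a :: m) := by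
  rw [opEval_cons h, opEval_cons h, opEval_cons h, pbr_pbr_left, opEval_add,
    pbr_skew (ℓ a) (pbr k _ _), opEval_neg, sub_eq_add_neg]

namespace MPWord

/-- The monomial `[a, m]` or, if the flag is off, `[a, l]·c` where `m = l ++ [c]`. -/
def big (t : Bool) (a : X) (m : List X) : MPWord X :=
  -- The default `a` of `getLastD` is a dummy, read only when `m` is empty.
  cond t (lie a m) (mix a m.dropLast (m.getLastD a))

theorem big_false_concat (a : X) (m : List X) (c : X) :
    big false a (m ++ [c]) = mix a m c := by
  simp [big]

theorem letters_big {t : Bool} {m : List X} (h : t = true ∨ m ≠ []) (a : X) :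
    (big t a m).letters = a :: m := by
  cases t
  · obtain ⟨m, c, rfl⟩ := (List.eq_nil_or_concat' m).resolve_left (h.resolve_left (by simp))
    rw [big_false_concat]; rfl
  · rfl

theorem len_big {t : Bool} {m : List X} (h : t = true ∨ m ≠ []) (a : X) :
    (big t a m).len = m.length + 1 := by
  rw [len, letters_big h]; rfl

theorem pb_big (t : Bool) (a : X) (m : List X) :
    (big t a m).pb = m.length - cond t 0 1 := by
  cases t <;> simp [big, pb]

theorem eval_big {t : Bool} {m : List X} (h : t = true ∨ m ≠ []) (a b : X) :
    (big t a (b :: m)).eval k = opEval t (pbr k (ℓ a) (ℓ b)) m := by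
  cases t
  · obtain ⟨m, c, rfl⟩ := (List.eq_nil_or_concat' m).resolve_left (h.resolve_left (by simp))
    rw [opEval_false_concat, ← List.cons_append, big_false_concat]
    rfl
  · rw [opEval_true]; rfl

end MPWord

theorem two_ne_zero_of_not_charP (h : ¬ CharP k 2) : (2 : k) ≠ 0 := fun h2 =>
  h (CharTwo.of_one_ne_zero_of_two_eq_zero one_ne_zero h2)

/-- `[a, b, c]·d`. -/
def curv (k : Type*) [Field k] {X : Type*} (a b c d : X) : FreeMP k X :=
  pmul k (pbr k (pbr k (ofLetter k a) (ofLetter k b)) (ofLetter k c)) (ofLetter k d)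

theorem curv_skew_left (a b c d : X) : curv k a b c d = -curv k b a c d := by
  rw [curv, pbr_skew (ℓ a), neg_pbr, neg_pmul]; rfl

theorem curv_skew_right (a b c d : X) : curv k a b c d = -curv k a b d c :=
  derived_pmul_pbr_skew (pbr_mem_derived _ _) _ _

/-- The first Bianchi identity: with the two skew-symmetries above, `curv` behaves like a curvature
tensor. -/
theorem curv_jacobi (a b c d : X) : curv k a b c d = curv k a c b d - curv k b c a d := by
  simp only [curv]
  rw [pbr_pbr_left, add_pmul, pbr_skew (ℓ a) (pbr k _ _), neg_pmul, sub_eq_add_neg]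

theorem curv_self_right (h : (2 : k) ≠ 0) (a b c : X) : curv k a b c c = 0 := by
  have h1 := curv_skew_right (k := k) a b c c
  rw [eq_neg_iff_add_eq_zero, ← two_smul k] at h1
  exact (smul_eq_zero.1 h1).resolve_left h

/-- The pair symmetry of a curvature tensor. A signed sum of four Bianchi identities leaves, after
skew-symmetry, twice the difference of the two sides. -/
theorem curv_pair (h : (2 : k) ≠ 0) (a b c d : X) : curv k a b c d = curv k c d a b := by
  have key : (2 : k) • (curv k a b c d - curv k c d a b) = 0 := by
    have e1 := curv_jacobi (k := k) a b c d
    have e2 := curv_jacobi (k := k) a b d c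
    have e3 := curv_jacobi (k := k) a c d b
    have e4 := curv_jacobi (k := k) b c d a
    rw [curv_skew_right a b d c] at e2
    rw [curv_skew_right a c d b, curv_skew_right a d c b] at e3
    rw [curv_skew_right b c d a, curv_skew_right b d c a, curv_skew_right c d b a] at e4
    linear_combination (norm := module) (1 : k) • e1 - (1 : k) • e2 - (1 : k) • e3 + (1 : k) • e4
  exact sub_eq_zero.1 ((smul_eq_zero.1 key).resolve_left h)

/-- In [f, c, e]·d the exchange of c and e changes nothing and the exchange of e and d changes the
sign. Three exchanges of each kind, in alternation, restore the order of the letters with sign -1,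
so twice the element is zero. -/
theorem pmul_bracketLetters_eq_zero (h : (2 : k) ≠ 0) {f : FreeMP k X} (hf : f ∈ derived k X)
    {m : List X} (hm : 2 ≤ m.length) (d : X) : pmul k (bracketLetters f m) (ℓ d) = 0 := by
  have key : ∀ (f : FreeMP k X), f ∈ derived k X → ∀ c e, 
      pmul k (pbr k (pbr k f (ℓ c)) (ℓ e)) (ℓ d) = 0 := by
    intro f hf c e
    have hd : ∀ x, pbr k f x ∈ derived k X := pbr_mem_derived f
    have h1 : pmul k (pbr k (pbr k f (ℓ c)) (ℓ e)) (ℓ d) =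
        -pmul k (pbr k (pbr k f (ℓ c)) (ℓ e)) (ℓ d) := by
      conv_lhs =>
        rw [derived_pmul_pbr_skew (hd _), derived_pbr_comm hf, derived_pmul_pbr_skew (hd _),
          derived_pbr_comm hf, derived_pmul_pbr_skew (hd _), derived_pbr_comm hf, neg_neg]
    rw [eq_neg_iff_add_eq_zero, ← two_smul k] at h1
    exact (smul_eq_zero.1 h1).resolve_left h
  obtain ⟨m', e, rfl⟩ := (List.eq_nil_or_concat' m).resolve_left (by rintro rfl; simp at hm)
  obtain ⟨m, c, rfl⟩ := (List.eq_nil_or_concat' m').resolve_left (by rintro rfl; simp at hm)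
  rw [bracketLetters_concat, bracketLetters_concat]
  exact key _ (bracketLetters_mem_derived hf m) _ _

/-- The conditions under which `[a, b, m]` resp. `[a, b, l]·c`, `m = l ++ [c]`, straighten as
in a free metabelian Lie algebra. -/
def IsLieLike (k : Type*) [Field k] (t : Bool) (m : List X) : Prop :=
  t = true ∨ CharP k 2 ∧ 2 ≤ m.length

theorem IsLieLike.char {t : Bool} {m : List X} (h : IsLieLike k t m) : t = true ∨ CharP k 2 :=
  h.imp_right And.left

theorem IsLieLike.ne_nil {t : Bool} {m : List X} (h : IsLieLike k t m) : t = true ∨ m ≠ [] :=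
  h.imp_right fun h' => by rintro rfl; simp at h'

theorem IsLieLike.tail_ne_nil {t : Bool} {c : X} {m : List X} (h : IsLieLike k t (c :: m)) :
    t = true ∨ m ≠ [] :=
  h.imp_right fun h' => by rintro rfl; simp at h'

theorem IsLieLike.of_length {t : Bool} {m m' : List X} (h : IsLieLike k t m)
    (hm : m.length ≤ m'.length) : IsLieLike k t m' :=
  h.imp_right fun h' => ⟨h'.1, h'.2.trans hm⟩

variable [LinearOrder X]

theorem MPWord.IsBasic.big {t : Bool} {a b : X} {m : List X} (h : IsLieLike k t m) (hab : b < a)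
    (hs : (b :: m).Pairwise (· ≤ ·)) : (big t a (b :: m)).IsBasic k := by
  cases t
  · have h' := h.resolve_left (by simp)
    obtain ⟨m, c, rfl⟩ := (List.eq_nil_or_concat' m).resolve_left (h.ne_nil.resolve_left (by simp))
    rw [← List.cons_append, big_false_concat]
    refine .mix a b m c h'.1 ?_ hab hs
    rintro rfl
    simp at h'
  · exact .lie a b m hab hs

/-- Every long basis monomial is of one of the two regular shapes. -/
theorem MPWord.IsBasic.exists_big {W : MPWord X} (hW : W.IsBasic k) (h5 : 5 ≤ W.len) :
    ∃ t a b m, W = MPWord.big t a (b :: m) ∧ IsLieLike k t m ∧ 3 ≤ m.length ∧ b < a ∧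
      (b :: m).Pairwise (· ≤ ·) := by
  cases hW with
  | letter a => simp [MPWord.len, MPWord.letters] at h5
  | lie a b l hab hs =>
    exact ⟨true, a, b, l, rfl, .inl rfl, by simpa [MPWord.len, MPWord.letters] using h5, hab, hs⟩
  | com₂ a b => simp [MPWord.len, MPWord.letters] at h5
  | com₃ a b c => simp [MPWord.len, MPWord.letters] at h5
  | mix₂ => simp [MPWord.len, MPWord.letters] at h5
  | mix₃ => simp [MPWord.len, MPWord.letters] at h5
  | mix a b l c hk hl hab hs =>
    have h3 : 3 ≤ (l ++ [c]).length := by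
      simp [MPWord.len, MPWord.letters] at h5; simp; omega
    refine ⟨false, a, b, l ++ [c], ?_, .inr ⟨hk, by omega⟩, h3, hab, hs⟩
    rw [← List.cons_append, MPWord.big_false_concat]

theorem sort_cons_of_le {b : X} {m : List X} (h : ∀ x ∈ m, b ≤ x) :
    (b :: m.insertionSort (· ≤ ·)).Pairwise (· ≤ ·) := by
  rw [List.pairwise_cons]
  exact ⟨fun x hx => h x ((List.mem_insertionSort _).1 hx), List.pairwise_insertionSort _ _⟩

/-- A letter of a list that is smaller than `b`, if `b` is not a lower bound, chosen minimal. -/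
theorem exists_min_perm {b : X} {m : List X} (h : ¬ ∀ x ∈ m, b ≤ x) :
    ∃ c m', m.Perm (c :: m') ∧ c < b ∧ ∀ x ∈ m', c ≤ x := by
  have hs := List.pairwise_insertionSort (· ≤ ·) m
  have hp := List.perm_insertionSort (· ≤ ·) m
  cases hm : m.insertionSort (· ≤ ·) with
  | nil => rw [hm, List.nil_perm] at hp; subst hp; simp at h
  | cons c m' =>
    rw [hm] at hs hp
    refine ⟨c, m', hp.symm, ?_, (List.pairwise_cons.1 hs).1⟩
    by_contra hbc
    refine h fun x hx => ?_
    rcases List.mem_cons.1 (hp.mem_iff.2 hx) with rfl | hx'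
    · exact not_lt.1 hbc
    · exact (not_lt.1 hbc).trans ((List.pairwise_cons.1 hs).1 x hx')

/-- The span of basis monomials of length at most `n`. -/
def degSpan (k : Type*) (X : Type*) [Field k] [LinearOrder X] (n : ℕ) :
    Submodule k (FreeMP k X) :=
  Submodule.span k {f | ∃ V : MPWord X, V.IsBasic k ∧ V.len ≤ n ∧ f = V.eval k}

theorem eval_mem_degSpan {V : MPWord X} (hV : V.IsBasic k) {n : ℕ} (h : V.len ≤ n) :
    V.eval k ∈ degSpan k X n := Submodule.subset_span ⟨V, hV, h, rfl⟩

theorem degSpan_mono {m n : ℕ} (h : m ≤ n) : degSpan k X m ≤ degSpan k X n :=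
  Submodule.span_mono fun _ ⟨V, hV, hl, hf⟩ => ⟨V, hV, hl.trans h, hf⟩

theorem opEval_eq_eval {t : Bool} {a b : X} {m : List X} (h : IsLieLike k t m) :
    opEval t (pbr k (ℓ a) (ℓ b)) m = (MPWord.big t a (b :: m.insertionSort (· ≤ ·))).eval k := by
  rw [MPWord.eval_big (h.of_length (by simp)).ne_nil]
  exact opEval_perm h.char (pbr_mem_derived _ _) (List.perm_insertionSort _ _).symm

theorem IsBasic_big_sort {t : Bool} {a b : X} {m : List X} (h : IsLieLike k t m) (hab : b < a)
    (hm : ∀ x ∈ m, b ≤ x) :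
    (MPWord.big t a (b :: m.insertionSort (· ≤ ·))).IsBasic k :=
  .big (h.of_length (by simp)) hab (sort_cons_of_le hm)

/-- If `b` is at most every letter of `m`, sorting `m` gives a basis monomial. Otherwise a Jacobi
step with the least letter of `m` puts that letter into second place in both resulting terms, and
both are of the first kind. No recursion is needed. -/
theorem opEval_mem_degSpan {t : Bool} {m : List X} (h : IsLieLike k t m) (a b : X) :
    opEval t (pbr k (ℓ a) (ℓ b)) m ∈ degSpan k X (m.length + 2) := by
  have base : ∀ {a b : X} {m : List X}, IsLieLike k t m → b < a → (∀ x ∈ m, b ≤ x) →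
      opEval t (pbr k (ℓ a) (ℓ b)) m ∈ degSpan k X (m.length + 2) := by
    intro a b m h hab hm
    rw [opEval_eq_eval h]
    refine eval_mem_degSpan (IsBasic_big_sort h hab hm) ?_
    rw [MPWord.len_big (.inr (by simp))]
    simp
  have main : ∀ {a b : X}, b < a →
      opEval t (pbr k (ℓ a) (ℓ b)) m ∈ degSpan k X (m.length + 2) := by
    intro a b hab
    by_cases hm : ∀ x ∈ m, b ≤ x
    · exact base h hab hm
    · obtain ⟨c, m', hp, hcb, hc⟩ := exists_min_perm hm
      have hl := hp.length_eq
      have hreg : ∀ x, IsLieLike k t (x :: m') := fun x => h.of_length (by simp [hl])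
      rw [opEval_perm h.char (pbr_mem_derived _ _) hp, opEval_jacobi (hreg c).tail_ne_nil, hl]
      refine sub_mem (base (hreg b) (hcb.trans hab) ?_) (base (hreg a) hcb ?_)
      · simpa [hcb.le] using hc
      · simpa [(hcb.trans hab).le] using hc
  rcases lt_trichotomy a b with hab | rfl | hab
  · rw [pbr_skew, opEval_neg]
    exact neg_mem (main hab)
  · simp
  · exact main hab

/-- Skew-symmetry reduces to b < a and c < d. If the intervals from b to a and from c to d are
ordered at both endpoints, the pair symmetry suffices. If one lies strictly inside the other, the
Bianchi identity leads to two ordered cases. -/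
theorem curv_mem_degSpan (h : ¬ CharP k 2) (a b c d : X) : curv k a b c d ∈ degSpan k X 4 := by
  have h2 := two_ne_zero_of_not_charP h
  have base : ∀ {a b c d : X}, b < a → a ≤ d → b ≤ c → c < d → curv k a b c d ∈ degSpan k X 4 :=
    fun hab had hbc hcd => eval_mem_degSpan (.mix₃ _ _ _ _ h hab had hbc hcd) le_rfl
  have swap : ∀ {a b c d : X}, b < a → c < d → c ≤ b → d ≤ a → curv k a b c d ∈ degSpan k X 4 := by
    intro a b c d hab hcd hcb hda
    rw [curv_pair h2, curv_skew_left, curv_skew_right, neg_neg]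
    exact base hcd hda hcb hab
  have nest : ∀ {a b c d : X}, b < c → c < d → d < a → curv k a b c d ∈ degSpan k X 4 := by
    intro a b c d hbc hcd hda
    rw [curv_jacobi, curv_skew_left b c, curv_skew_right c b, neg_neg]
    exact sub_mem (swap (hcd.trans hda) (hbc.trans hcd) hbc.le hda.le)
      (base hbc (hcd.trans hda).le (hbc.trans hcd).le hda)
  have main : ∀ {a b c d : X}, b < a → c < d → curv k a b c d ∈ degSpan k X 4 := by
    intro a b c d hab hcd
    rcases le_or_gt b c with hbc | hbc <;> rcases le_or_gt a d with had | had
    · exact base hab had hbc hcd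
    · rcases hbc.eq_or_lt with rfl | hbc
      · exact swap hab hcd le_rfl had.le
      · exact nest hbc hcd had
    · rw [curv_pair h2, curv_skew_left, curv_skew_right, neg_neg]
      rcases had.eq_or_lt with rfl | had
      · exact base hcd le_rfl hbc.le hab
      · exact nest hbc hab had
    · exact swap hab hcd hbc.le had.le
  have main' : ∀ {a b c d : X}, c < d → curv k a b c d ∈ degSpan k X 4 := by
    intro a b c d hcd
    rcases lt_trichotomy a b with hab | rfl | hab
    · rw [curv_skew_left]; exact neg_mem (main hab hcd)
    · simp [curv]
    · exact main hab hcd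
  rcases lt_trichotomy c d with hcd | rfl | hcd
  · exact main' hcd
  · rw [curv_self_right h2]; exact zero_mem _
  · rw [curv_skew_right]; exact neg_mem (main' hcd)

theorem pbr_letter_mem_degSpan (a b : X) : pbr k (ℓ a) (ℓ b) ∈ degSpan k X 2 :=
  opEval_mem_degSpan (t := true) (m := []) (.inl rfl) a b

theorem pmul_letter_mem_degSpan (a b : X) : pmul k (ℓ a) (ℓ b) ∈ degSpan k X 2 := by
  rcases le_total a b with h | h
  · exact eval_mem_degSpan (.com₂ a b h) le_rfl
  · rw [pmul_comm]
    exact eval_mem_degSpan (.com₂ b a h) le_rfl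

theorem pmul_pmul_letter_mem_degSpan (a b c : X) :
    pmul k (pmul k (ℓ a) (ℓ b)) (ℓ c) ∈ degSpan k X 3 := by
  have base : ∀ {a b c : X}, a ≤ b → b ≤ c → pmul k (pmul k (ℓ a) (ℓ b)) (ℓ c) ∈ degSpan k X 3 :=
    fun hab hbc => eval_mem_degSpan (.com₃ _ _ _ hab hbc) le_rfl
  have comm : ∀ a b c : X, pmul k (pmul k (ℓ a) (ℓ b)) (ℓ c) = pmul k (pmul k (ℓ a) (ℓ c)) (ℓ b) :=
    fun a b c => by rw [pmul_assoc, pmul_comm (ℓ b), pmul_assoc]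
  have main : ∀ {a b c : X}, a ≤ b → pmul k (pmul k (ℓ a) (ℓ b)) (ℓ c) ∈ degSpan k X 3 := by
    intro a b c hab
    rcases le_total b c with h | h
    · exact base hab h
    · rw [comm]
      rcases le_total a c with h' | h'
      · exact base h' h
      · rw [pmul_comm (ℓ a)]
        exact base h' hab
  rcases le_total a b with h | h
  · exact main h
  · rw [pmul_comm (ℓ a)]
    exact main h

theorem pmul_pbr_letter_mem_degSpan (a b c : X) :
    pmul k (pbr k (ℓ a) (ℓ b)) (ℓ c) ∈ degSpan k X 3 := by
  rcases lt_trichotomy a b with h | rfl | h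
  · rw [pbr_skew, neg_pmul]
    exact neg_mem (eval_mem_degSpan (.mix₂ b a c h) le_rfl)
  · simp
  · exact eval_mem_degSpan (.mix₂ a b c h) le_rfl

/-- `[a, b, m]·c` is a combination of basis monomials of at most the same length. -/
theorem pmul_bracketLetters_mem_degSpan (a b : X) (m : List X) (c : X) :
    pmul k (bracketLetters (pbr k (ℓ a) (ℓ b)) m) (ℓ c) ∈ degSpan k X (m.length + 3) := by
  match m with
  | [] => exact pmul_pbr_letter_mem_degSpan a b c
  | d :: m =>
    -- In characteristic two the product shape straightens like a Lie monomial. Otherwise it is a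
    -- `curv` when one letter remains in `m`, and zero when there are more.
    by_cases h : CharP k 2
    · rw [← opEval_false_concat]
      have := opEval_mem_degSpan (k := k) (t := false) (m := d :: m ++ [c])
        (.inr ⟨h, by simp⟩) a b
      simpa using this
    · match m with
      | [] => exact curv_mem_degSpan h a b d c
      | e :: m =>
        rw [pmul_bracketLetters_eq_zero (two_ne_zero_of_not_charP h) (pbr_mem_derived _ _) (by simp)]
        exact zero_mem _

/-- Multiplication by a letter and bracket with a letter raise the degree by at most one. -/
theorem MPWord.IsBasic.op_letter_mem_degSpan {V : MPWord X} (hV : V.IsBasic k) (a : X) :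
    pmul k (V.eval k) (ℓ a) ∈ degSpan k X (V.len + 1) ∧
      pbr k (V.eval k) (ℓ a) ∈ degSpan k X (V.len + 1) := by
  have pbr_mix : ∀ (b c : X) (m : List X) (d : X), (MPWord.mix b (c :: m) d).IsBasic k →
      pmul k ((MPWord.mix b (c :: m) d).eval k) (ℓ a) ∈
          degSpan k X ((MPWord.mix b (c :: m) d).len + 1) ∧
        pbr k ((MPWord.mix b (c :: m) d).eval k) (ℓ a) ∈
          degSpan k X ((MPWord.mix b (c :: m) d).len + 1) := by
    intro b c m d _
    have hd : bracketLetters (pbr k (ℓ b) (ℓ c)) m ∈ derived k X :=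
      bracketLetters_mem_derived (pbr_mem_derived _ _) m
    have he : (MPWord.mix b (c :: m) d).eval k =
      pmul k (bracketLetters (pbr k (ℓ b) (ℓ c)) m) (ℓ d) := rfl
    rw [he, derived_pmul_pmul hd, derived_pbr_pmul hd, ← bracketLetters_concat]
    refine ⟨zero_mem _, ?_⟩
    have := pmul_bracketLetters_mem_degSpan (k := k) b c (m ++ [a]) d
    simpa [MPWord.len, MPWord.letters] using this
  cases hV with
  | letter b => exact ⟨pmul_letter_mem_degSpan b a, pbr_letter_mem_degSpan b a⟩
  | lie b c l hbc hs =>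
    refine ⟨pmul_bracketLetters_mem_degSpan b c l a, ?_⟩
    have := opEval_mem_degSpan (k := k) (t := true) (m := l ++ [a]) (.inl rfl) b c
    rw [opEval_true, bracketLetters_concat] at this
    rw [List.length_append] at this
    exact this
  | com₂ b c h =>
    refine ⟨pmul_pmul_letter_mem_degSpan b c a, ?_⟩
    change pbr k (pmul k (ℓ b) (ℓ c)) (ℓ a) ∈ _
    rw [pbr_pmul_left, pmul_comm (ℓ b)]
    exact add_mem (pmul_pbr_letter_mem_degSpan _ _ _) (pmul_pbr_letter_mem_degSpan _ _ _)
  | com₃ b c d h h' =>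
    -- Everything vanishes here: after the Leibniz rule each term is an element of the derived ideal
    -- multiplied by two letters.
    have hd := pmul_mem_derived (ℓ b) (ℓ c)
    have he : (MPWord.com [b, c, d]).eval k = pmul k (pmul k (ℓ b) (ℓ c)) (ℓ d) := rfl
    rw [he, derived_pmul_pmul hd, derived_pbr_pmul hd, pbr_pmul_left, add_pmul,
      pmul_comm (ℓ b), derived_pmul_pmul (pbr_mem_derived _ _),
      derived_pmul_pmul (pbr_mem_derived _ _), add_zero]
    exact ⟨zero_mem _, zero_mem _⟩
  | mix₂ b c d h => exact pbr_mix b c [] d (.mix₂ b c d h)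
  | mix₃ b c d e hk h1 h2 h3 h4 => exact pbr_mix b c [d] e (.mix₃ b c d e hk h1 h2 h3 h4)
  | mix b c l d hk hl h hs => exact pbr_mix b c l d (.mix b c l d hk hl h hs)

theorem op_letter_mem_degSpan {n : ℕ} {f : FreeMP k X} (hf : f ∈ degSpan k X n) (a : X) :
    pmul k f (ℓ a) ∈ degSpan k X (n + 1) ∧ pbr k f (ℓ a) ∈ degSpan k X (n + 1) := by
  induction hf using Submodule.span_induction with
  | mem f hf =>
    obtain ⟨V, hV, hl, rfl⟩ := hf
    exact ⟨degSpan_mono (by omega) (hV.op_letter_mem_degSpan a).1,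
      degSpan_mono (by omega) (hV.op_letter_mem_degSpan a).2⟩
  | zero => simp
  | add x y _ _ hx hy =>
    rw [add_pmul, add_pbr]; exact ⟨add_mem hx.1 hy.1, add_mem hx.2 hy.2⟩
  | smul c x _ hx =>
    rw [smul_pmul, smul_pbr]
    exact ⟨Submodule.smul_mem _ c hx.1, Submodule.smul_mem _ c hx.2⟩

/-- The basis monomials span the free metabelian Poisson algebra. -/
theorem span_basic_eq_top :
    Submodule.span k {f : FreeMP k X | ∃ V : MPWord X, V.IsBasic k ∧ f = V.eval k} = ⊤ := by
  set U := Submodule.span k {f : FreeMP k X | ∃ V : MPWord X, V.IsBasic k ∧ f = V.eval k}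
  have hle : ∀ n, degSpan k X n ≤ U := fun n =>
    Submodule.span_mono fun f ⟨V, hV, _, hf⟩ => ⟨V, hV, hf⟩
  have hop : ∀ f ∈ U, ∀ a, pmul k f (ℓ a) ∈ U ∧ pbr k f (ℓ a) ∈ U := by
    intro f hf a
    induction hf using Submodule.span_induction with
    | mem f hf =>
      obtain ⟨V, hV, rfl⟩ := hf
      exact ⟨hle _ (hV.op_letter_mem_degSpan a).1, hle _ (hV.op_letter_mem_degSpan a).2⟩
    | zero => simp
    | add x y _ _ hx hy =>
      rw [add_pmul, add_pbr]; exact ⟨add_mem hx.1 hy.1, add_mem hx.2 hy.2⟩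
    | smul c x _ hx =>
      rw [smul_pmul, smul_pbr]
      exact ⟨Submodule.smul_mem _ c hx.1, Submodule.smul_mem _ c hx.2⟩
  have hI : IsPoissonIdeal U :=
    isPoissonIdeal_of_letters (fun f hf a => (hop f hf a).1) fun f hf a => (hop f hf a).2
  rw [Submodule.eq_top_iff']
  intro x
  induction x using FreeMP.induction with
  | letter a => exact Submodule.subset_span ⟨_, .letter a, rfl⟩
  | zero => exact zero_mem _
  | add x y hx hy => exact add_mem hx hy
  | smul c x hx => exact U.smul_mem c hx
  | mul x y _ hy => exact hI.pmul_left x hy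
  | bracket x y _ hy => exact hI.pbr_left x hy

end Straightening

/-! ### A representation over the dual numbers -/

section Model

/-- The Poisson algebra `R × N` with `((u, m), (v, n)) = (0, v m - u n)` and
`(u, m) · (v, n) = (0, ε (v m + u n))`. -/
@[reducible] def modelPoisson (k R N : Type*) [Field k] [CommRing R] [Algebra k R] [AddCommGroup N]
    [Module R N] [Module k N] [IsScalarTower k R N] (ε : R) (h₁ : ε * ε = 0) (h₂ : 2 * ε = 0) :
    PoissonAlgebra k (R × N) where
  mul := LinearMap.mk₂ k (fun x y => (0, ε • (y.1 • x.2 + x.1 • y.2)))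
    (fun x x' y => by ext <;> simp; module)
    (fun c x y => by ext <;> simp [smul_comm c])
    (fun x y y' => by ext <;> simp; module)
    (fun c x y => by ext <;> simp [smul_comm c])
  bracket := LinearMap.mk₂ k (fun x y => (0, y.1 • x.2 - x.1 • y.2))
    (fun x x' y => by ext <;> simp; module)
    (fun c x y => by ext <;> simp [smul_comm c, smul_sub])
    (fun x y y' => by ext <;> simp; module)
    (fun c x y => by ext <;> simp [smul_comm c, smul_sub])
  mul_comm x y := by simp [add_comm]
  mul_assoc x y z := by
    -- Both bracketings of a triple product carry the factor ε² and are zero.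
    have h : ∀ n : N, ε • ε • n = 0 := fun n => by rw [smul_smul, h₁, zero_smul]
    ext
    · simp
    · simp [smul_comm _ ε, h]
  bracket_self x := by simp
  jacobi x y z := by
    ext
    · simp
    · simp; module
  leibniz x y z := by
    -- With indices for the components, the two sides of the Leibniz rule differ by 2ε·y₁z₁x₂.
    have h : ∀ n : N, (2 * ε) • n = 0 := fun n => by rw [h₂, zero_smul]
    ext
    · simp
    · simp only [LinearMap.mk₂_apply, Prod.snd_add, zero_smul, zero_sub, add_zero,
        zero_add]
      linear_combination (norm := module) (-1 : R) • h (y.1 • z.1 • x.2)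

/-- The abelian ideal is 0 × N: all operations take values there, and they use first components as
coefficients. -/
theorem isMetabelian_model (k R N : Type*) [Field k] [CommRing R] [Algebra k R] [AddCommGroup N]
    [Module R N] [Module k N] [IsScalarTower k R N] (ε : R) (h₁ : ε * ε = 0) (h₂ : 2 * ε = 0) :
    @IsMetabelianPoisson k _ (R × N) _ _ (modelPoisson k R N ε h₁ h₂) := by
  let _ := modelPoisson k R N ε h₁ h₂
  refine ⟨LinearMap.ker (LinearMap.fst k R N), fun x y _ => ⟨?_, ?_⟩,
    fun x hx y hy => ⟨?_, ?_⟩, fun x y => ⟨?_, ?_⟩⟩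
  · rfl
  · rfl
  · have hx' : x.1 = 0 := hx
    have hy' : y.1 = 0 := hy
    change ((0 : R), ε • (y.1 • x.2 + x.1 • y.2)) = 0
    simp [hx', hy']
  · have hx' : x.1 = 0 := hx
    have hy' : y.1 = 0 := hy
    change ((0 : R), y.1 • x.2 - x.1 • y.2) = 0
    simp [hx', hy']
  · rfl
  · rfl

section ModelHom

variable {k X R N : Type*} [Field k] [CommRing R] [Algebra k R] [AddCommGroup N]
    [Module R N] [Module k N] [IsScalarTower k R N] (ε : R) (h₁ : ε * ε = 0) (h₂ : 2 * ε = 0)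
    (g : X → R × N)

/-- The homomorphism to `R × N` given by the images of letters. -/
def modelHom : FreeMP k X →ₗ[k] R × N :=
  @FreeMP.lift k X (R × N) _ _ _ (modelPoisson k R N ε h₁ h₂) (isMetabelian_model k R N ε h₁ h₂) g

theorem modelHom_pmul (x y : FreeMP k X) : modelHom ε h₁ h₂ g (pmul k x y) =
    (0, ε • ((modelHom ε h₁ h₂ g y).1 • (modelHom ε h₁ h₂ g x).2 +
      (modelHom ε h₁ h₂ g x).1 • (modelHom ε h₁ h₂ g y).2)) := by
  let _ := modelPoisson k R N ε h₁ h₂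
  exact FreeMP.lift_pmul (isMetabelian_model k R N ε h₁ h₂) g x y

theorem modelHom_pbr (x y : FreeMP k X) : modelHom ε h₁ h₂ g (pbr k x y) =
    (0, (modelHom ε h₁ h₂ g y).1 • (modelHom ε h₁ h₂ g x).2 -
      (modelHom ε h₁ h₂ g x).1 • (modelHom ε h₁ h₂ g y).2) := by
  let _ := modelPoisson k R N ε h₁ h₂
  exact FreeMP.lift_pbr (isMetabelian_model k R N ε h₁ h₂) g x y

end ModelHom

variable (k : Type*) (X : Type*) [Field k]

/-- Polynomials in `X` over the dual numbers. -/
abbrev DualPoly := AddMonoidAlgebra (DualNumber k) (Multiset X)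

open Classical in
/-- The infinitesimal of the dual numbers in characteristic two, and zero otherwise. -/
noncomputable def dualEps : DualNumber k := if CharP k 2 then DualNumber.eps else 0

theorem dualEps_mul_self : dualEps k * dualEps k = 0 := by
  unfold dualEps
  split_ifs
  · exact DualNumber.eps_mul_eps
  · simp

theorem two_mul_dualEps : 2 * dualEps k = 0 := by
  unfold dualEps
  split_ifs with h
  · rw [two_mul]
    ext
    · simp
    · simp [CharTwo.add_self_eq_zero]
  · simp

variable {k X}

@[simp] theorem fst_dualEps : (dualEps k).fst = 0 := by
  unfold dualEps; split_ifs <;> simp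

theorem snd_dualEps [CharP k 2] : (dualEps k).snd = 1 := by
  simp [dualEps, ‹CharP k 2›]

noncomputable section

open FreeMP AddMonoidAlgebra

theorem polyEps_mul_self :
    (single 0 (dualEps k) : DualPoly k X) * single 0 (dualEps k) = 0 := by
  simp [dualEps_mul_self]

theorem two_mul_polyEps : 2 * (single 0 (dualEps k) : DualPoly k X) = 0 := by
  rw [two_mul, ← single_add, ← two_mul, two_mul_dualEps, single_zero]

variable [DecidableEq X]

/-- The homomorphism from the free algebra to the model that sends `a` to `(a, e_a)`. -/
def toModel : FreeMP k X →ₗ[k] DualPoly k X × (X → DualPoly k X) :=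
  modelHom (R := DualPoly k X) (N := X → DualPoly k X) (single 0 (dualEps k))
    polyEps_mul_self two_mul_polyEps fun a => (single {a} 1, Pi.single a 1)

theorem toModel_ofLetter (a : X) :
    toModel (ofLetter k a) = (single {a} 1, Pi.single a 1) := rfl

theorem toModel_pmul (x y : FreeMP k X) : toModel (pmul k x y) =
    (0, (single 0 (dualEps k) : DualPoly k X) •
      ((toModel y).1 • (toModel x).2 + (toModel x).1 • (toModel y).2)) :=
  modelHom_pmul _ _ _ _ x y

theorem toModel_pbr (x y : FreeMP k X) : toModel (pbr k x y) =
    (0, (toModel y).1 • (toModel x).2 - (toModel x).1 • (toModel y).2) :=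
  modelHom_pbr _ _ _ _ x y

/-- On elements with first component zero, a bracket with a letter is multiplication by the
corresponding variable, and a product with a letter brings in the factor ε besides. What survives is
the multiset of letters and the flag. -/
theorem toModel_opEval {t : Bool} {m : List X} (h : t = true ∨ m ≠ []) {f : FreeMP k X}
    (hf : (toModel f).1 = 0) : toModel (opEval t f m) =
      (0, (single (m : Multiset X) (cond t 1 (dualEps k)) : DualPoly k X) • (toModel f).2) := by
  induction m generalizing f with
  | nil =>
    have ht : t = true := h.resolve_right (by simp)
    subst ht
    have : (single (([] : List X) : Multiset X) 1 : DualPoly k X) = 1 := rfl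
    simp only [opEval, cond_true, this, one_smul]
    exact Prod.ext hf rfl
  | cons c m ih =>
    cases m with
    | nil =>
      cases t
      · simp only [opEval, cond_false, toModel_pmul, toModel_ofLetter, hf, zero_smul, add_zero,
          smul_smul, single_mul_single]
        simp
      · simp only [opEval, cond_true, toModel_pbr, toModel_ofLetter, hf, zero_smul, sub_zero]
        simp
    | cons d m =>
      simp only [opEval]
      rw [ih (.inr (by simp)) (by rw [toModel_pbr]), toModel_pbr]
      simp only [toModel_ofLetter, hf, zero_smul, sub_zero, smul_smul, single_mul_single, mul_one]
      rw [add_comm, Multiset.singleton_add]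
      rfl

/-- The coefficient of `e_a · m` in the model: the classical part if the flag is on, the
infinitesimal part otherwise. -/
def coeffAt (t : Bool) (a : X) (m : Multiset X) : FreeMP k X →ₗ[k] k where
  toFun f := cond t (((toModel f).2 a).coeff m).fst (((toModel f).2 a).coeff m).snd
  map_add' f g := by cases t <;> simp
  map_smul' c f := by cases t <;> simp

theorem coeffAt_apply (t : Bool) (a : X) (m : Multiset X) (f : FreeMP k X) :
    coeffAt t a m f =
      cond t (((toModel f).2 a).coeff m).fst (((toModel f).2 a).coeff m).snd := rfl

/-- In the model the bracket of `a'` and `b'` has second component b'·e_{a'} - a'·e_{b'}; each of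
the two terms is tested at the position given by `a` and `m`. -/
theorem coeffAt_opEval (t : Bool) {t' : Bool} {m' : List X} (h : t' = true ∨ m' ≠ [])
    (a a' b' : X) (m : Multiset X) :
    coeffAt t a m (opEval t' (pbr k (ofLetter k a') (ofLetter k b')) m') =
      (cond t (cond t' 1 (dualEps k)).fst (cond t' 1 (dualEps k)).snd) *
        ((if a = a' ∧ m = (b' :: m' : List X) then 1 else 0) -
          if a = b' ∧ m = (a' :: m' : List X) then 1 else 0) := by
  have h1 : ∀ (x y : X) (c : DualNumber k), (single (m' : Multiset X) c * (single {x} 1 *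
      (Pi.single y 1 : X → DualPoly k X) a) : DualPoly k X) =
        if a = y then single ((x :: m' : List X) : Multiset X) c else 0 := by
    intro x y c
    by_cases hay : a = y
    · subst hay
      simp only [Pi.single_eq_same, mul_one, single_mul_single, if_true]
      rw [add_comm, Multiset.singleton_add]
      rfl
    · simp [hay]
  have h2 : ∀ (p : Prop) [Decidable p] (s : Multiset X) (z : DualNumber k),
      ((if p then single s z else 0 : DualPoly k X).coeff m) =
        if p ∧ m = s then z else 0 := by
    intro p _ s z
    by_cases hp : p
    · by_cases hm : m = s
      · subst hm; simp [hp]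
      · simp [hp, hm, Finsupp.single_eq_of_ne hm]
    · simp [hp]
  rw [coeffAt_apply, toModel_opEval h (by rw [toModel_pbr]), toModel_pbr]
  simp only [toModel_ofLetter, Pi.smul_apply, Pi.sub_apply, smul_eq_mul, mul_sub, h1]
  rw [coeff_sub, Finsupp.sub_apply, h2, h2]
  cases t <;> split_ifs <;> simp

end

end Model

/-! ### The order on monomials -/

theorem MPWord.pb_le_len {X : Type*} (W : MPWord X) : W.pb ≤ W.len := by
  cases W <;> simp [pb, len, letters]; omega

namespace MPWord

variable {k : Type*} {X : Type*} [Field k] [LinearOrder X]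

/-- The data by which monomials are compared. -/
def key (W : MPWord X) : ℕ ×ₗ (ℕ ×ₗ List X) := toLex (W.len, toLex (W.pb, W.letters))

theorem lt_iff_key {V W : MPWord X} : V.lt W ↔ V.key < W.key := by
  simp only [key, Prod.Lex.toLex_lt_toLex]
  rfl

theorem lt.trans {U V W : MPWord X} (h : U.lt V) (h' : V.lt W) : U.lt W := by
  rw [lt_iff_key] at *; exact _root_.lt_trans h h'

theorem lt_irrefl (W : MPWord X) : ¬ W.lt W := by
  rw [lt_iff_key]; exact _root_.lt_irrefl _

theorem lt.len_le {V W : MPWord X} (h : V.lt W) : V.len ≤ W.len := by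
  rcases h with h | h
  · exact h.le
  · exact h.1.le

theorem IsBasic.shape {W : MPWord X} (hW : W.IsBasic k) :
    (∃ a l, W = MPWord.lie a l) ∨ (∃ l, W = com l ∧ 2 ≤ l.length) ∨
      ∃ a l b, W = MPWord.mix a l b ∧ 0 < l.length := by
  cases hW with
  | letter a => exact .inl ⟨_, _, rfl⟩
  | lie a b l => exact .inl ⟨_, _, rfl⟩
  | com₂ a b => exact .inr (.inl ⟨_, rfl, by simp⟩)
  | com₃ a b c => exact .inr (.inl ⟨_, rfl, by simp⟩)
  | mix₂ a b c => exact .inr (.inr ⟨_, _, _, rfl, Nat.succ_pos _⟩)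
  | mix₃ a b c d => exact .inr (.inr ⟨_, _, _, rfl, Nat.succ_pos _⟩)
  | mix a b l c => exact .inr (.inr ⟨_, _, _, rfl, Nat.succ_pos _⟩)

/-- The key determines the shape: the length exceeds the number of brackets by one exactly for Lie
monomials, and among the others the number of brackets is zero for commutative monomials and
positive for mixed ones. -/
theorem IsBasic.eq_of_key_eq {V W : MPWord X} (hV : V.IsBasic k) (hW : W.IsBasic k)
    (h : V.key = W.key) : V = W := by
  have h' : (V.len, (V.pb, V.letters)) = (W.len, (W.pb, W.letters)) := h
  simp only [Prod.mk.injEq] at h'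
  obtain ⟨h1, h2, h3⟩ := h'
  rcases hV.shape with ⟨a, l, rfl⟩ | ⟨l, rfl, hl⟩ | ⟨a, l, b, rfl, hl⟩ <;>
  rcases hW.shape with ⟨a', l', rfl⟩ | ⟨l', rfl, hl'⟩ | ⟨a', l', b', rfl, hl'⟩ <;>
  simp only [len, pb, letters, List.length_cons, List.length_append, List.length_nil,
    List.cons.injEq] at h1 h2 h3 <;> try omega
  · rw [h3.1, h3.2]
  · rw [h3]
  · obtain ⟨h3, h4⟩ := h3
    have := List.append_inj' h4 rfl
    simp only [List.cons.injEq, and_true] at this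
    rw [h3, this.1, this.2]

theorem IsBasic.trichotomy {V W : MPWord X} (hV : V.IsBasic k) (hW : W.IsBasic k) :
    V.lt W ∨ V = W ∨ W.lt V := by
  rcases lt_trichotomy V.key W.key with h | h | h
  · exact .inl (lt_iff_key.2 h)
  · exact .inr (.inl (hV.eq_of_key_eq hW h))
  · exact .inr (.inr (lt_iff_key.2 h))

/-- Over a finite alphabet only finitely many keys lie below a given one, since the length bounds
the letters and the number of brackets. The number of these keys is a strictly monotone rank. -/
theorem wellFounded_lt [Finite X] : WellFounded (lt : MPWord X → MPWord X → Prop) := by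
  let B : MPWord X → Set (ℕ ×ₗ (ℕ ×ₗ List X)) := fun W => {κ | κ < W.key ∧ ∃ V : MPWord X, κ = V.key}
  have hfin : ∀ W, (B W).Finite := by
    intro W
    have h1 : (Set.Iic W.len ×ˢ (Set.Iic W.len ×ˢ {l : List X | l.length ≤ W.len})).Finite :=
      (Set.finite_Iic _).prod ((Set.finite_Iic _).prod (List.finite_length_le X _))
    refine (h1.image fun p => (toLex (p.1, toLex p.2) : ℕ ×ₗ (ℕ ×ₗ List X))).subset ?_
    rintro κ ⟨hκ, V, rfl⟩
    have := (lt_iff_key.2 hκ).len_le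
    exact ⟨(V.len, V.pb, V.letters), ⟨this, V.pb_le_len.trans this, this⟩, rfl⟩
  refine Subrelation.wf (r := InvImage (· < ·) fun W => (B W).ncard) ?_
    (InvImage.wf _ _root_.wellFounded_lt)
  intro V W h
  have h := lt_iff_key.1 h
  refine Set.ncard_lt_ncard ⟨fun κ hκ => ⟨hκ.1.trans h, hκ.2⟩, fun hs => ?_⟩ (hfin W)
  exact absurd (hs (show V.key ∈ B W from ⟨h, V, rfl⟩)).1 (_root_.lt_irrefl _)

end MPWord

/-! ### Independence of the long monomials -/

section Coefficients

open FreeMP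

variable {k : Type*} {X : Type*} [Field k] [LinearOrder X]

theorem smul_smul_smul_eq_zero {R N : Type*} [CommRing R] [AddCommGroup N] [Module R N] {e : R}
    (he : e * e = 0) (z : R) (n : N) : e • z • e • n = 0 := by
  rw [smul_smul, smul_smul, mul_right_comm, he, zero_mul, zero_smul]

theorem eq_of_coe_eq_of_sorted {l l' : List X} (h : (l : Multiset X) = l')
    (hl : l.Pairwise (· ≤ ·)) (hl' : l'.Pairwise (· ≤ ·)) : l = l' :=
  (Multiset.coe_eq_coe.1 h).eq_of_pairwise (fun _ _ _ _ => le_antisymm) hl hl'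

theorem coeffAt_big_self {t : Bool} {a b : X} {m : List X} (h : IsLieLike k t m) (hab : b < a) :
    coeffAt t a ((b :: m : List X) : Multiset X) ((MPWord.big t a (b :: m)).eval k) = 1 := by
  rw [MPWord.eval_big h.ne_nil, coeffAt_opEval t h.ne_nil]
  rw [if_pos ⟨rfl, rfl⟩, if_neg fun hh => hab.ne' hh.1]
  cases t
  · have := h.char.resolve_left (by simp)
    simp [snd_dualEps]
  · simp

/-- The term at e_{b'} does not contribute: if `b'` = `a`, then `a` would be least among the
letters, although the smaller `b` is one of them. The term at e_{a'} contributes only for the same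
sorted list, hence with the other flag, and then classical and infinitesimal part tell the two
apart. Sortedness is required only at equal length because the short mixed basis monomials need not
be sorted. -/
theorem coeffAt_big_of_ne {t t' : Bool} {a b a' b' : X} {m m' : List X}
    (hab : b < a) (hm : (b :: m).Pairwise (· ≤ ·))
    (h' : t' = true ∨ m' ≠ []) (hm' : m'.length = m.length → (b' :: m').Pairwise (· ≤ ·))
    (hab' : b' < a') (hne : MPWord.big t' a' (b' :: m') ≠ MPWord.big t a (b :: m)) :
    coeffAt t a ((b :: m : List X) : Multiset X) ((MPWord.big t' a' (b' :: m')).eval k) = 0 := by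
  rw [MPWord.eval_big h', coeffAt_opEval t h']
  have hlen : ∀ {x y : X}, ((x :: m : List X) : Multiset X) = (y :: m' : List X) →
      m'.length = m.length := by
    intro x y h
    have := congrArg Multiset.card h
    simpa using this.symm
  have h2 : ¬ (a = b' ∧ ((b :: m : List X) : Multiset X) = (a' :: m' : List X)) := by
    rintro ⟨rfl, h⟩
    have hs := List.pairwise_cons.1 (hm' (hlen h))
    have hb : b ∈ ((a' :: m' : List X) : Multiset X) := by rw [← h]; simp
    rcases List.mem_cons.1 (Multiset.mem_coe.1 hb) with rfl | hb
    · exact absurd hab hab'.asymm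
    · exact absurd (hs.1 b hb) hab.not_ge
  rw [if_neg h2, sub_zero]
  by_cases h1 : a = a' ∧ ((b :: m : List X) : Multiset X) = (b' :: m' : List X)
  · have htt : t ≠ t' := by
      rintro rfl
      obtain ⟨rfl, h1⟩ := h1
      have := eq_of_coe_eq_of_sorted h1 hm (hm' (hlen h1))
      rw [this] at hne
      exact hne rfl
    cases t <;> cases t' <;> simp at htt ⊢
  · rw [if_neg h1, mul_zero]

/-- The short monomials have too few letters to reach this coefficient; a product of three letters
is even zero in the model, since it carries ε². All others are regular and fall under
`coeffAt_big_of_ne`. -/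
theorem coeffAt_basic_of_ne {t : Bool} {a b : X} {m : List X} (hab : b < a)
    (hm : (b :: m).Pairwise (· ≤ ·)) (h3 : 3 ≤ m.length) {V : MPWord X} (hV : V.IsBasic k)
    (hne : V ≠ MPWord.big t a (b :: m)) :
    coeffAt t a ((b :: m : List X) : Multiset X) (V.eval k) = 0 := by
  cases hV with
  | letter x =>
    change coeffAt t a _ (ofLetter k x) = 0
    rw [coeffAt_apply, toModel_ofLetter]
    have h0 : ((1 : DualPoly k X).coeff ((b :: m : List X) : Multiset X)) = 0 := by
      rw [AddMonoidAlgebra.one_def, AddMonoidAlgebra.coeff_single]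
      exact Finsupp.single_eq_of_ne (by simp)
    by_cases hx : a = x
    · subst hx
      cases t <;> simp [h0]
    · cases t <;> simp [Pi.single_eq_of_ne hx]
  | lie a' b' l hab' hs =>
    exact coeffAt_big_of_ne (t' := true) hab hm (.inl rfl) (fun _ => hs) hab' hne
  | com₂ x y =>
    change coeffAt t a _ (pmul k (ofLetter k x) (ofLetter k y)) = 0
    rw [coeffAt_apply, toModel_pmul]
    have h0 : ∀ (x y : X) (z : DualNumber k), (AddMonoidAlgebra.single 0 z *
        (AddMonoidAlgebra.single {x} 1 * (Pi.single y 1 : X → DualPoly k X) a) :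
          DualPoly k X).coeff ((b :: m : List X) : Multiset X) = 0 := by
      intro x y z
      by_cases hy : a = y
      · subst hy
        simp only [Pi.single_eq_same, mul_one, AddMonoidAlgebra.single_mul_single, 
          AddMonoidAlgebra.coeff_single, zero_add]
        refine Finsupp.single_eq_of_ne fun h => ?_
        have := congrArg Multiset.card h
        simp at this
        subst this
        simp at h3
      · simp [Pi.single_eq_of_ne hy]
    simp only [toModel_ofLetter, Pi.smul_apply, Pi.add_apply, smul_eq_mul, mul_add]
    rw [AddMonoidAlgebra.coeff_add, Finsupp.add_apply, h0, h0]
    cases t <;> simp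
  | com₃ x y z =>
    change coeffAt t a _ (pmul k (pmul k (ofLetter k x) (ofLetter k y)) (ofLetter k z)) = 0
    rw [coeffAt_apply, toModel_pmul, toModel_pmul]
    have h0 : ∀ n : X → DualPoly k X, (AddMonoidAlgebra.single 0 (dualEps k) : DualPoly k X) •
        (toModel (ofLetter k z)).1 • (AddMonoidAlgebra.single 0 (dualEps k) : DualPoly k X) • n = 0 :=
      fun n => smul_smul_smul_eq_zero (R := DualPoly k X) (N := X → DualPoly k X)
        (polyEps_mul_self (k := k) (X := X)) _ n
    simp only [zero_smul, add_zero]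
    rw [h0]
    cases t <;> simp
  | mix₂ a' b' c hab' =>
    refine coeffAt_big_of_ne (t' := false) (m' := [c]) hab hm (.inr (by simp)) (fun h => ?_) hab' hne
    rw [List.length_singleton] at h; omega
  | mix₃ a' b' c d hk hab' =>
    refine coeffAt_big_of_ne (t' := false) (m' := [c, d]) hab hm (.inr (by simp)) (fun h => ?_) hab' hne
    simp at h; omega
  | mix a' b' l c hk hl hab' hs =>
    have := MPWord.big_false_concat a' (b' :: l) c
    rw [← this] at hne ⊢
    exact coeffAt_big_of_ne (t' := false) (m' := l ++ [c]) hab hm (.inr (by simp)) (fun _ => hs) hab' hne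

/-- A functional `coeffAt` takes the value one at this monomial and vanishes at all other basis
monomials. -/
theorem MPWord.IsBasic.eval_notMem_lowerSpan {W : MPWord X} (hW : W.IsBasic k) (h5 : 5 ≤ W.len) :
    W.eval k ∉ lowerSpan k W := by
  obtain ⟨t, a, b, m, rfl, hreg, h3, hab, hs⟩ := hW.exists_big h5
  intro hmem
  have hle : lowerSpan k (MPWord.big t a (b :: m)) ≤
      LinearMap.ker (coeffAt (k := k) t a ((b :: m : List X) : Multiset X)) := by
    refine Submodule.span_le.2 ?_
    rintro _ ⟨V, hV, hlt, rfl⟩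
    exact coeffAt_basic_of_ne hab hs h3 hV fun h => MPWord.lt_irrefl _ (h ▸ hlt)
  have := hle hmem
  rw [LinearMap.mem_ker, coeffAt_big_self hreg hab] at this
  exact one_ne_zero this

end Coefficients

/-! ### Leading terms -/

section Leading

open FreeMP

variable {k : Type*} {X : Type*} [Field k] [LinearOrder X]

theorem eval_mem_lowerSpan {V W : MPWord X} (hV : V.IsBasic k) (h : V.lt W) :
    V.eval k ∈ lowerSpan k W := Submodule.subset_span ⟨V, hV, h, rfl⟩

theorem lowerSpan_mono {V W : MPWord X} (h : V.lt W) : lowerSpan k V ≤ lowerSpan k W :=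
  Submodule.span_mono fun _ ⟨U, hU, hl, hf⟩ => ⟨U, hU, hl.trans h, hf⟩

theorem degSpan_le_lowerSpan {n : ℕ} {W : MPWord X} (h : n < W.len) :
    degSpan k X n ≤ lowerSpan k W :=
  Submodule.span_mono fun _ ⟨U, hU, hl, hf⟩ => ⟨U, hU, .inl (hl.trans_lt h), hf⟩

theorem lowerSpan_le_degSpan (W : MPWord X) : lowerSpan k W ≤ degSpan k X W.len :=
  Submodule.span_mono fun _ ⟨U, hU, hl, hf⟩ => ⟨U, hU, hl.len_le, hf⟩

/-- A combination of vectors indexed by a set of basis monomials involves a largest one. -/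
theorem exists_max_of_mem_span {G : MPWord X → Set (FreeMP k X)} {T : Set (MPWord X)}
    (hT : ∀ V ∈ T, V.IsBasic k) {f : FreeMP k X}
    (hf : f ∈ Submodule.span k {g | ∃ V ∈ T, g ∈ G V}) (h0 : f ≠ 0) :
    ∃ W ∈ T, f ∈ Submodule.span k {g | ∃ V ∈ T, (V.lt W ∨ V = W) ∧ g ∈ G V} := by
  have key : f = 0 ∨ ∃ W ∈ T, f ∈ Submodule.span k {g | ∃ V ∈ T, (V.lt W ∨ V = W) ∧ g ∈ G V} := by
    clear h0
    have mono : ∀ {V W : MPWord X}, V.lt W ∨ V = W →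
        Submodule.span k {g | ∃ U ∈ T, (U.lt V ∨ U = V) ∧ g ∈ G U} ≤
          Submodule.span k {g | ∃ U ∈ T, (U.lt W ∨ U = W) ∧ g ∈ G U} := by
      intro V W h
      refine Submodule.span_mono fun g ⟨U, hU, hl, hg⟩ => ⟨U, hU, ?_, hg⟩
      rcases h with h | rfl
      · rcases hl with hl | rfl
        exacts [.inl (hl.trans h), .inl h]
      · exact hl
    induction hf using Submodule.span_induction with
    | mem f hf =>
      obtain ⟨V, hV, hf⟩ := hf
      exact .inr ⟨V, hV, Submodule.subset_span ⟨V, hV, .inr rfl, hf⟩⟩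
    | zero => exact .inl rfl
    | add x y _ _ hx hy =>
      rcases hx with rfl | ⟨V, hV, hx⟩
      · rwa [zero_add]
      rcases hy with rfl | ⟨W, hW, hy⟩
      · rw [add_zero]; exact .inr ⟨V, hV, hx⟩
      rcases (hT V hV).trichotomy (hT W hW) with h | rfl | h
      · exact .inr ⟨W, hW, add_mem (mono (.inl h) hx) hy⟩
      · exact .inr ⟨V, hV, add_mem hx hy⟩
      · exact .inr ⟨V, hV, add_mem hx (mono (.inl h) hy)⟩
    | smul c x _ hx =>
      rcases hx with rfl | ⟨V, hV, hx⟩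
      · exact .inl (smul_zero c)
      · exact .inr ⟨V, hV, Submodule.smul_mem _ c hx⟩
  exact key.resolve_left h0

theorem IsLeadingTerm.coeff_ne_zero {f : FreeMP k X} {c : k} {W : MPWord X}
    (h : IsLeadingTerm f c W) : c ≠ 0 := by
  rintro rfl
  have h1 := h.2.1
  rw [zero_smul, sub_zero] at h1
  exact h.2.2 h1

theorem IsLeadingTerm.eval_notMem {f : FreeMP k X} {c : k} {W : MPWord X}
    (h : IsLeadingTerm f c W) : W.eval k ∉ lowerSpan k W := fun hW => h.2.2 (by
  have := add_mem h.2.1 (Submodule.smul_mem _ c hW)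
  rwa [sub_add_cancel] at this)

/-- The assumption `hn` holds for long monomials by `eval_notMem_lowerSpan`. For short ones it is
taken from an element already known to have the leading monomial `W`, which is why independence of
short monomials is not needed. -/
theorem IsLeadingTerm.mk' {f : FreeMP k X} {c : k} {W : MPWord X} (hW : W.IsBasic k)
    (hn : W.eval k ∉ lowerSpan k W) (hc : c ≠ 0) (h : f - c • W.eval k ∈ lowerSpan k W) :
    IsLeadingTerm f c W := by
  refine ⟨hW, h, fun hf => hn ?_⟩
  have := Submodule.smul_mem _ c⁻¹ (sub_mem hf h)
  rwa [sub_sub_cancel, smul_smul, inv_mul_cancel₀ hc, one_smul] at this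

theorem IsLeadingTerm.monomial {f : FreeMP k X} {c : k} {W : MPWord X}
    (h : IsLeadingTerm f c W) : IsLeadingMonomial f W := ⟨c, h⟩

theorem IsLeadingMonomial.isBasic {f : FreeMP k X} {W : MPWord X}
    (h : IsLeadingMonomial f W) : W.IsBasic k := h.choose_spec.1

theorem IsLeadingMonomial.notMem {f : FreeMP k X} {W : MPWord X}
    (h : IsLeadingMonomial f W) : f ∉ lowerSpan k W := h.choose_spec.2.2

theorem IsLeadingMonomial.ne_zero {f : FreeMP k X} {W : MPWord X}
    (h : IsLeadingMonomial f W) : f ≠ 0 := by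
  rintro rfl
  exact h.notMem (zero_mem _)

theorem IsLeadingMonomial.mem_lowerSpan {f : FreeMP k X} {V W : MPWord X}
    (h : IsLeadingMonomial f V) (hl : V.lt W) : f ∈ lowerSpan k W := by
  obtain ⟨c, hV, h1, -⟩ := h
  have := add_mem (lowerSpan_mono hl h1) (Submodule.smul_mem _ c (eval_mem_lowerSpan hV hl))
  rwa [sub_add_cancel] at this

theorem IsLeadingMonomial.mem_degSpan {f : FreeMP k X} {W : MPWord X}
    (h : IsLeadingMonomial f W) : f ∈ degSpan k X W.len := by
  obtain ⟨c, hW, h1, -⟩ := h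
  have := add_mem (lowerSpan_le_degSpan W h1)
    (Submodule.smul_mem _ c (eval_mem_degSpan hW le_rfl))
  rwa [sub_add_cancel] at this

theorem IsLeadingMonomial.unique {f : FreeMP k X} {V W : MPWord X}
    (h : IsLeadingMonomial f V) (h' : IsLeadingMonomial f W) : V = W := by
  rcases h.isBasic.trichotomy h'.isBasic with hl | rfl | hl
  · exact absurd (h.mem_lowerSpan hl) h'.notMem
  · rfl
  · exact absurd (h'.mem_lowerSpan hl) h.notMem

theorem IsLeadingMonomial.lt_of_mem {f : FreeMP k X} {V W : MPWord X}
    (h : IsLeadingMonomial f V) (hW : W.IsBasic k) (hf : f ∈ lowerSpan k W) : V.lt W := by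
  rcases h.isBasic.trichotomy hW with hl | rfl | hl
  · exact hl
  · exact absurd hf h.notMem
  · exact absurd (lowerSpan_mono hl hf) h.notMem

theorem IsLeadingMonomial.len_le_of_mem {f : FreeMP k X} {V : MPWord X} {n : ℕ}
    (h : IsLeadingMonomial f V) (hf : f ∈ degSpan k X n) : V.len ≤ n := by
  by_contra hn
  exact h.notMem (degSpan_le_lowerSpan (not_le.1 hn) hf)

theorem IsLeadingTerm.smul {f : FreeMP k X} {c d : k} {W : MPWord X}
    (h : IsLeadingTerm f c W) (hd : d ≠ 0) : IsLeadingTerm (d • f) (d * c) W := by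
  refine .mk' h.1 h.eval_notMem (mul_ne_zero hd h.coeff_ne_zero) ?_
  rw [mul_smul, ← smul_sub]
  exact Submodule.smul_mem _ d h.2.1

/-- Elements with the same leading term differ by lower terms. -/
theorem IsLeadingTerm.sub_mem {f g : FreeMP k X} {c : k} {W : MPWord X}
    (hf : IsLeadingTerm f c W) (hg : IsLeadingTerm g c W) : f - g ∈ lowerSpan k W := by
  have := _root_.sub_mem hf.2.1 hg.2.1
  rwa [sub_sub_sub_cancel_right] at this

/-- Subtracting the multiple of `h` that cancels the leading term. -/
theorem IsLeadingTerm.sub_smul_mem {f h : FreeMP k X} {c d : k} {W : MPWord X}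
    (hf : IsLeadingTerm f c W) (hh : IsLeadingTerm h d W) :
    f - (c * d⁻¹) • h ∈ lowerSpan k W := by
  have hd := hh.coeff_ne_zero
  have h1 := hh.smul (mul_ne_zero hf.coeff_ne_zero (inv_ne_zero hd))
  rw [mul_assoc, inv_mul_cancel₀ hd, mul_one] at h1
  exact hf.sub_mem h1

theorem IsLeadingTerm.unique {f : FreeMP k X} {c d : k} {V W : MPWord X}
    (h : IsLeadingTerm f c V) (h' : IsLeadingTerm f d W) : c = d := by
  obtain rfl := h.monomial.unique h'.monomial
  by_contra hcd
  have h1 := _root_.sub_mem h'.2.1 h.2.1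
  rw [sub_sub_sub_cancel_left, ← sub_smul] at h1
  have h2 := Submodule.smul_mem _ (c - d)⁻¹ h1
  rw [smul_smul, inv_mul_cancel₀ (sub_ne_zero.2 hcd), one_smul] at h2
  exact h.eval_notMem h2

theorem setOf_le_eq_insert {T : MPWord X → Prop} {W : MPWord X} (hW : T W) :
    {f : FreeMP k X | ∃ V, T V ∧ (V.lt W ∨ V = W) ∧ f = V.eval k} =
      insert (W.eval k) {f | ∃ V, T V ∧ V.lt W ∧ f = V.eval k} := by
  ext f
  constructor
  · rintro ⟨V, hV, hl | rfl, rfl⟩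
    exacts [.inr ⟨V, hV, hl, rfl⟩, .inl rfl]
  · rintro (rfl | ⟨V, hV, hl, rfl⟩)
    exacts [⟨W, hW, .inr rfl, rfl⟩, ⟨V, hV, .inl hl, rfl⟩]

/-- Every nonzero element has a leading term. -/
theorem exists_isLeadingTerm [Finite X] {f : FreeMP k X} (hf : f ≠ 0) :
    ∃ c W, IsLeadingTerm f c W := by
  let D : Set (MPWord X) := {W | W.IsBasic k ∧
    f ∈ Submodule.span k {g | ∃ V : MPWord X, V.IsBasic k ∧ (V.lt W ∨ V = W) ∧ g = V.eval k}}
  have hne : D.Nonempty := by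
    have hmem : f ∈ Submodule.span k
        {f : FreeMP k X | ∃ V : MPWord X, V.IsBasic k ∧ f = V.eval k} := by
      rw [span_basic_eq_top]; trivial
    obtain ⟨W, hW, h⟩ := exists_max_of_mem_span (G := fun V => {V.eval k})
      (T := {V | V.IsBasic k}) (fun _ h => h) hmem hf
    exact ⟨W, hW, h⟩
  -- `W` is the least monomial such that `f` is a combination of basis monomials up to `W`. If
  -- smaller ones sufficed, the largest of those involved would contradict minimality.
  obtain ⟨W, ⟨hW, hfW⟩, hmin⟩ := MPWord.wellFounded_lt.has_min D hne
  rw [setOf_le_eq_insert hW, Submodule.mem_span_insert] at hfW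
  obtain ⟨c, g, hg, rfl⟩ := hfW
  refine ⟨c, W, hW, ?_, fun hlow => ?_⟩
  · rw [add_sub_cancel_left]; exact hg
  · have hmem : c • W.eval k + g ∈ Submodule.span k
        {f : FreeMP k X | ∃ V ∈ {V : MPWord X | V.IsBasic k ∧ V.lt W}, f ∈ ({V.eval k} : Set _)} := by
      refine Submodule.span_mono ?_ hlow
      rintro _ ⟨V, hV, hl, rfl⟩
      exact ⟨V, ⟨hV, hl⟩, rfl⟩
    obtain ⟨V, hV, h⟩ := exists_max_of_mem_span (fun _ h => h.1) hmem hf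
    refine hmin V ⟨hV.1, Submodule.span_mono ?_ h⟩ hV.2
    rintro _ ⟨U, hU, hl, rfl⟩
    exact ⟨U, hU.1, hl, rfl⟩

/-! ### Leading terms of brackets with letters -/

/-- At the first difference of the two lists the letter `c` has already entered both, or enters one
or both there, or enters both later; the order persists in each case. Equal length excludes proper
prefixes, for which insertion can reverse the order. -/
theorem orderedInsert_lt_orderedInsert (c : X) {m m' : List X} (h : m < m')
    (hl : m.length = m'.length) :
    m.orderedInsert (· ≤ ·) c < m'.orderedInsert (· ≤ ·) c := by
  induction m generalizing m' with
  | nil =>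
    rw [List.length_nil, eq_comm, List.length_eq_zero_iff] at hl
    subst hl
    exact absurd h (lt_irrefl _)
  | cons x xs ih =>
    cases m' with
    | nil => simp at hl
    | cons y ys =>
      simp only [List.orderedInsert_cons]
      rcases List.cons_lt_cons_iff.1 h with hxy | ⟨rfl, hlt⟩
      · by_cases hcx : c ≤ x
        · rw [if_pos hcx, if_pos (hcx.trans hxy.le)]
          exact List.cons_lt_cons_iff.2 (.inr ⟨rfl, h⟩)
        · rw [if_neg hcx]
          split_ifs
          · exact List.cons_lt_cons_iff.2 (.inl (not_le.1 hcx))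
          · exact List.cons_lt_cons_iff.2 (.inl hxy)
      · split_ifs
        · exact List.cons_lt_cons_iff.2 (.inr ⟨rfl, h⟩)
        · exact List.cons_lt_cons_iff.2 (.inr ⟨rfl, ih hlt (by simpa using hl)⟩)

theorem pairwise_orderedInsert {m : List X} (h : m.Pairwise (· ≤ ·)) (c : X) :
    (m.orderedInsert (· ≤ ·) c).Pairwise (· ≤ ·) := h.orderedInsert c m

theorem isBasic_big_orderedInsert {t : Bool} {a b : X} {m : List X} (h : IsLieLike k t m)
    (hab : b < a) (hs : (b :: m).Pairwise (· ≤ ·)) (c : X) :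
    (MPWord.big t a ((b :: m).orderedInsert (· ≤ ·) c)).IsBasic k := by
  have hs' := pairwise_orderedInsert hs c
  rw [List.orderedInsert_cons] at hs' ⊢
  split_ifs at hs' ⊢ with hcb
  · exact .big (h.of_length (by simp)) (hcb.trans_lt hab) hs'
  · exact .big (h.of_length (by simp [List.orderedInsert_length])) hab hs'

theorem big_lt_big {t : Bool} {a a' : X} {m m' : List X} (hm : m ≠ []) (hl : m.length = m'.length)
    (h : a :: m < a' :: m') : (MPWord.big t a m).lt (MPWord.big t a' m') := by
  have hm' : m' ≠ [] := by rintro rfl; simp at hl; exact hm hl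
  refine .inr ⟨?_, .inr ⟨?_, ?_⟩⟩
  · rw [MPWord.len_big (.inr hm), MPWord.len_big (.inr hm'), hl]
  · rw [MPWord.pb_big, MPWord.pb_big, hl]
  · rw [MPWord.letters_big (.inr hm), MPWord.letters_big (.inr hm')]
    exact h

/-- If `b` is at most `c`, sorting gives an equality. If `c` < `b`, the Jacobi identity gives the
expected monomial and one with first letter `b` in place of `a`, which is smaller. -/
theorem pbr_big_sub_mem {t : Bool} {a b : X} {m : List X} (h : IsLieLike k t m)
    (hab : b < a) (hs : (b :: m).Pairwise (· ≤ ·)) (c : X) :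
    pbr k ((MPWord.big t a (b :: m)).eval k) (ofLetter k c) -
        (MPWord.big t a ((b :: m).orderedInsert (· ≤ ·) c)).eval k ∈
      lowerSpan k (MPWord.big t a ((b :: m).orderedInsert (· ≤ ·) c)) := by
  rw [MPWord.eval_big h.ne_nil, pbr_opEval h.ne_nil (pbr_mem_derived _ _)]
  have hb := (List.pairwise_cons.1 hs).1
  have hreg : ∀ x, IsLieLike k t (x :: m) := fun x => h.of_length (by simp)
  by_cases hcb : c < b
  · rw [List.orderedInsert_cons, if_pos hcb.le, opEval_jacobi h.ne_nil,
      MPWord.eval_big (hreg b).ne_nil, sub_sub_cancel_left]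
    have hc : ∀ x ∈ a :: m, c ≤ x := by
      intro x hx
      rcases List.mem_cons.1 hx with rfl | hx
      · exact (hcb.trans hab).le
      · exact hcb.le.trans (hb x hx)
    rw [opEval_eq_eval (hreg a)]
    refine neg_mem (eval_mem_lowerSpan (IsBasic_big_sort (hreg a) hcb hc) ?_)
    refine big_lt_big (by simp) (by simp [List.length_insertionSort, List.orderedInsert_length]) ?_
    exact List.cons_lt_cons_iff.2 (.inl hab)
  · have hbc := not_lt.1 hcb
    have hc : ∀ x ∈ c :: m, b ≤ x := by
      intro x hx
      rcases List.mem_cons.1 hx with rfl | hx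
      · exact hbc
      · exact hb x hx
    have he : (b :: m).orderedInsert (· ≤ ·) c = b :: (c :: m).insertionSort (· ≤ ·) := by
      refine List.Perm.eq_of_pairwise (fun _ _ _ _ => le_antisymm) (pairwise_orderedInsert hs c)
        (sort_cons_of_le hc) ?_
      exact (List.perm_orderedInsert _ _ _).trans ((List.Perm.swap _ _ _).trans
        ((List.perm_insertionSort _ _).symm.cons b))
    rw [he, opEval_eq_eval (hreg c), sub_self]
    exact zero_mem _

/-- Shorter monomials stay below by degree. Monomials of the same length are regular; if the flags
agree, insertion of `c` preserves the order of the letters, and if not, the number of brackets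
decides before and after. -/
theorem pbr_mem_lowerSpan {t : Bool} {a : X} {m : List X}
    (h5 : 5 ≤ (MPWord.big t a m).len) (hm : m ≠ []) (c : X) {f : FreeMP k X}
    (hf : f ∈ lowerSpan k (MPWord.big t a m)) :
    pbr k f (ofLetter k c) ∈ lowerSpan k (MPWord.big t a (m.orderedInsert (· ≤ ·) c)) := by
  have hne : ∀ m : List X, m.orderedInsert (· ≤ ·) c ≠ [] := fun m =>
    List.ne_nil_of_length_pos (by simp [List.orderedInsert_length])
  have hlen : (MPWord.big t a (m.orderedInsert (· ≤ ·) c)).len = (MPWord.big t a m).len + 1 := by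
    rw [MPWord.len_big (.inr hm), MPWord.len_big (.inr (hne m)), List.orderedInsert_length]
  induction hf using Submodule.span_induction with
  | zero => simp
  | add x y _ _ hx hy => rw [add_pbr]; exact add_mem hx hy
  | smul d x _ hx => rw [smul_pbr]; exact Submodule.smul_mem _ d hx
  | mem f hf =>
    obtain ⟨V, hV, hlt, rfl⟩ := hf
    rcases lt_or_eq_of_le hlt.len_le with hl | hl
    · exact degSpan_le_lowerSpan (by omega) (hV.op_letter_mem_degSpan c).2
    obtain ⟨t', a', b', m', rfl, hreg, h3, hab', hs'⟩ := hV.exists_big (by omega)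
    have hlt' : (MPWord.big t' a' ((b' :: m').orderedInsert (· ≤ ·) c)).lt
        (MPWord.big t a (m.orderedInsert (· ≤ ·) c)) := by
      rw [MPWord.len_big (.inr (by simp)), MPWord.len_big (.inr hm)] at hl
      have hl' : (b' :: m').length = m.length := by omega
      rcases hlt with hlt | ⟨-, hlt | ⟨hpb, hlt⟩⟩
      · rw [MPWord.len_big (.inr (by simp)), MPWord.len_big (.inr hm)] at hlt; omega
      · refine .inr ⟨?_, .inl ?_⟩
        · rw [MPWord.len_big (.inr (hne _)), MPWord.len_big (.inr (hne _)),
            List.orderedInsert_length, List.orderedInsert_length, hl']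
        · rw [MPWord.pb_big, MPWord.pb_big] at hlt ⊢
          rw [List.orderedInsert_length, List.orderedInsert_length]
          rw [hl'] at hlt ⊢
          cases t <;> cases t' <;> simp at hlt ⊢; omega
      · have htt : t' = t := by
          rw [MPWord.pb_big, MPWord.pb_big, hl'] at hpb
          have : 1 ≤ m.length := List.length_pos_iff_ne_nil.2 hm
          cases t <;> cases t' <;> simp at hpb ⊢ <;> omega
        subst htt
        refine big_lt_big (hne _) (by rw [List.orderedInsert_length, List.orderedInsert_length, hl']) ?_
        rw [MPWord.letters_big (.inr (by simp)), MPWord.letters_big (.inr hm)] at hlt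
        have hlt : a' :: (b' :: m') < a :: m := hlt
        rcases List.cons_lt_cons_iff.1 hlt with h | ⟨rfl, h⟩
        · exact List.cons_lt_cons_iff.2 (.inl h)
        · exact List.cons_lt_cons_iff.2 (.inr ⟨rfl, orderedInsert_lt_orderedInsert c h hl'⟩)
    have h1 := lowerSpan_mono hlt' (pbr_big_sub_mem (k := k) hreg hab' hs' c)
    have h2 := eval_mem_lowerSpan (isBasic_big_orderedInsert (k := k) hreg hab' hs' c) hlt'
    have := add_mem h1 h2
    rwa [sub_add_cancel] at this

/-- The leading term of the bracket of an element of degree at least five with a letter. -/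
theorem IsLeadingTerm.pbr_letter {f : FreeMP k X} {d : k} {t : Bool} {a : X} {m : List X}
    (h : IsLeadingTerm f d (MPWord.big t a m)) (h5 : 5 ≤ (MPWord.big t a m).len) (hm : m ≠ [])
    (c : X) :
    IsLeadingTerm (pbr k f (ofLetter k c)) d (MPWord.big t a (m.orderedInsert (· ≤ ·) c)) := by
  have hlen : (MPWord.big t a (m.orderedInsert (· ≤ ·) c)).len = (MPWord.big t a m).len + 1 := by
    rw [MPWord.len_big (.inr hm), MPWord.len_big (.inr (List.ne_nil_of_length_pos
      (by simp [List.orderedInsert_length]))), List.orderedInsert_length]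
  have key : (MPWord.big t a (m.orderedInsert (· ≤ ·) c)).IsBasic k ∧
      pbr k ((MPWord.big t a m).eval k) (ofLetter k c) -
        (MPWord.big t a (m.orderedInsert (· ≤ ·) c)).eval k ∈
      lowerSpan k (MPWord.big t a (m.orderedInsert (· ≤ ·) c)) := by
    obtain ⟨t', a', b', m', he, hreg, h3, hab', hs'⟩ := h.1.exists_big h5
    have hl := congrArg MPWord.letters he
    rw [MPWord.letters_big (.inr hm), MPWord.letters_big (.inr (by simp)), List.cons.injEq] at hl
    obtain ⟨rfl, rfl⟩ := hl
    have htt : t = t' := by cases t <;> cases t' <;> simp [MPWord.big] at he ⊢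
    subst htt
    exact ⟨isBasic_big_orderedInsert hreg hab' hs' c, pbr_big_sub_mem hreg hab' hs' c⟩
  refine .mk' key.1 (key.1.eval_notMem_lowerSpan (by omega)) h.coeff_ne_zero ?_
  have h1 := pbr_mem_lowerSpan h5 hm c h.2.1
  rw [sub_pbr, smul_pbr] at h1
  have := add_mem h1 (Submodule.smul_mem _ d key.2)
  rwa [smul_sub, sub_add_sub_cancel] at this

theorem IsLeadingTerm.bracketLetters {f : FreeMP k X} {d : k} {t : Bool} {a : X} {m : List X}
    (h : IsLeadingTerm f d (MPWord.big t a m)) (h5 : 5 ≤ (MPWord.big t a m).len) (hm : m ≠ [])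
    (p : List X) :
    IsLeadingTerm (bracketLetters f p) d (MPWord.big t a ((m ++ p).insertionSort (· ≤ ·))) := by
  induction p generalizing f m with
  | nil =>
    have hs : m.Pairwise (· ≤ ·) := by
      obtain ⟨t', a', b', m', he, hreg, h3, hab', hs'⟩ := h.1.exists_big h5
      have hl := congrArg MPWord.letters he
      rw [MPWord.letters_big (.inr hm), MPWord.letters_big (.inr (by simp)), List.cons.injEq] at hl
      rw [hl.2]; exact hs'
    rw [List.append_nil, hs.insertionSort_eq]
    exact h
  | cons c p ih =>
    have hne : m.orderedInsert (· ≤ ·) c ≠ [] := List.ne_nil_of_length_pos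
      (by simp [List.orderedInsert_length])
    have := ih (h.pbr_letter h5 hm c) (by
      rw [MPWord.len_big (.inr hm)] at h5
      rw [MPWord.len_big (.inr hne), List.orderedInsert_length]; omega) hne
    have hp : (m.orderedInsert (· ≤ ·) c ++ p).insertionSort (· ≤ ·) =
        (m ++ c :: p).insertionSort (· ≤ ·) := by
      refine List.Perm.eq_of_pairwise (fun _ _ _ _ => le_antisymm)
        (List.pairwise_insertionSort _ _) (List.pairwise_insertionSort _ _) ?_
      refine (List.perm_insertionSort _ _).trans (.trans ?_ (List.perm_insertionSort _ _).symm)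
      exact ((List.perm_orderedInsert _ _ _).append_right p).trans List.perm_middle.symm
    rw [hp] at this
    exact this

end Leading

/-! ### Minimal elements in well-quasi-orders -/

section Dickson

/-- A finite set of minimal members for a map into a well-quasi-ordered set. -/
theorem exists_finite_le_of_wqo {α β : Type*} [PartialOrder β] [WellQuasiOrderedLE β] (φ : α → β)
    (T : Set α) : ∃ F ⊆ T, F.Finite ∧ ∀ x ∈ T, ∃ y ∈ F, φ y ≤ φ x := by
  have hpwo : (φ '' T).IsPWO := Set.isPWO_of_wellQuasiOrderedLE _
  have hfin : {b | Minimal (· ∈ φ '' T) b}.Finite :=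
    (setOfPred_minimal_antichain _).finite_of_partiallyWellOrderedOn
      (hpwo.mono fun b hb => hb.prop)
  have := hfin.to_subtype
  choose g hgT hg using fun b : {b | Minimal (· ∈ φ '' T) b} => b.2.prop
  refine ⟨Set.range g, ?_, Set.finite_range g, fun x hx => ?_⟩
  · rintro _ ⟨b, rfl⟩
    exact hgT b
  · obtain ⟨b, hbx, hb⟩ := hpwo.exists_le_minimal (Set.mem_image_of_mem φ hx)
    exact ⟨g ⟨b, hb⟩, ⟨_, rfl⟩, (hg ⟨b, hb⟩).trans_le hbx⟩

end Dickson

/-! ### Leading monomials of ideals and finite Gröbner–Shirshov bases -/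

section LeadingSets

open FreeMP

variable {k : Type*} {X : Type*} [Field k] [LinearOrder X]

/-- `W` is obtained from `V` by bracketing with letters. -/
def MPWord.Divides (V W : MPWord X) : Prop :=
  V = W ∨ ∃ t a m p, 5 ≤ V.len ∧ m ≠ [] ∧ V = MPWord.big t a m ∧
    W = MPWord.big t a ((m ++ p).insertionSort (· ≤ ·))

theorem finite_basic_len_le [Finite X] (n : ℕ) :
    {W : MPWord X | W.IsBasic k ∧ W.len ≤ n}.Finite := by
  have h1 : (Set.Iic n ×ˢ (Set.Iic n ×ˢ {l : List X | l.length ≤ n})).Finite :=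
    (Set.finite_Iic _).prod ((Set.finite_Iic _).prod (List.finite_length_le X _))
  refine Set.Finite.of_finite_image (f := MPWord.key) ?_
    fun V hV W hW h => hV.1.eq_of_key_eq hW.1 h
  refine (h1.image fun p => (toLex (p.1, toLex p.2) : ℕ ×ₗ (ℕ ×ₗ List X))).subset ?_
  rintro _ ⟨V, hV, rfl⟩
  exact ⟨(V.len, V.pb, V.letters), ⟨hV.2, V.pb_le_len.trans hV.2, hV.2⟩, rfl⟩

/-- Dickson's lemma for basis monomials. -/
theorem exists_finite_divides [Finite X] (T : Set (MPWord X)) (hT : ∀ W ∈ T, W.IsBasic k) :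
    ∃ F ⊆ T, F.Finite ∧ ∀ W ∈ T, ∃ V ∈ F, V.Divides W := by
  classical
  -- For a fixed flag and first letter the other letters are recorded by their multiplicities.
  -- Tuples of natural numbers with finite index set are well-quasi-ordered, and comparison of
  -- multiplicities is divisibility.
  have hbig : ∀ q : Bool × X, ∃ F ⊆ {m : List X | 4 ≤ m.length ∧ m.Pairwise (· ≤ ·) ∧
      MPWord.big q.1 q.2 m ∈ T}, F.Finite ∧ ∀ m ∈ {m : List X | 4 ≤ m.length ∧
        m.Pairwise (· ≤ ·) ∧ MPWord.big q.1 q.2 m ∈ T}, ∃ m' ∈ F,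
          (fun x => m'.count x) ≤ fun x => m.count x :=
    fun q => exists_finite_le_of_wqo (fun (m : List X) (x : X) => m.count x) _
  choose F hFT hFfin hF using hbig
  -- Monomials of length at most four are all kept; over a finite alphabet there are finitely many.
  refine ⟨{W | W ∈ T ∧ W.len ≤ 4} ∪ ⋃ q : Bool × X, (MPWord.big q.1 q.2) '' F q, ?_, ?_, ?_⟩
  · rintro W (h | h)
    · exact h.1
    · obtain ⟨q, m, hm, rfl⟩ := Set.mem_iUnion.1 h
      exact (hFT q hm).2.2
  · refine ((finite_basic_len_le (k := k) 4).subset fun W hW => ⟨hT W hW.1, hW.2⟩).union ?_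
    exact Set.finite_iUnion fun q => (hFfin q).image _
  · intro W hW
    by_cases h4 : W.len ≤ 4
    · exact ⟨W, .inl ⟨hW, h4⟩, .inl rfl⟩
    obtain ⟨t, a, b, m, rfl, hreg, h3, hab, hs⟩ := (hT W hW).exists_big (by omega)
    obtain ⟨m', hm', hle⟩ := hF (t, a) (b :: m) ⟨by simp; omega, hs, hW⟩
    have hm4 := (hFT _ hm').1
    have hne : m' ≠ [] := by rintro rfl; simp at hm4
    refine ⟨_, .inr (Set.mem_iUnion.2 ⟨(t, a), m', hm', rfl⟩), .inr ⟨t, a, m', (b :: m).diff m', ?_,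
      hne, rfl, ?_⟩⟩
    · rw [MPWord.len_big (.inr hne)]; omega
    · congr 1
      refine List.Perm.eq_of_pairwise (fun _ _ _ _ => le_antisymm) hs
        (List.pairwise_insertionSort _ _) (.trans ?_ (List.perm_insertionSort _ _).symm)
      refine (List.subperm_append_diff_self_of_count_le ?_).symm
      intro x _
      exact hle x

theorem IsNormalPoly.of_divides {S : Set (FreeMP k X)} {s : FreeMP k X} (hs : s ∈ S) {c : k}
    {V W : MPWord X} (h : IsLeadingTerm s c V) (hd : V.Divides W) :
    ∃ g, IsNormalPoly S g ∧ IsLeadingTerm g c W := by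
  rcases hd with rfl | ⟨t, a, m, p, h5, hm, rfl, rfl⟩
  · exact ⟨s, .base s hs, h⟩
  · exact ⟨bracketLetters s p, .bracket s _ p hs h.monomial h5, h.bracketLetters h5 hm p⟩

/-- Normal polynomials have leading terms with leading coefficient coming from the set. -/
theorem IsNormalPoly.exists_divides {S : Set (FreeMP k X)} {g : FreeMP k X}
    (hg : IsNormalPoly S g) (hS : ∀ s ∈ S, s ≠ 0) [Finite X] :
    ∃ s ∈ S, ∃ c V W, IsLeadingTerm s c V ∧ V.Divides W ∧ IsLeadingTerm g c W := by
  cases hg with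
  | base _ hs =>
    obtain ⟨c, W, h⟩ := exists_isLeadingTerm (hS _ hs)
    exact ⟨g, hs, c, W, W, h, .inl rfl, h⟩
  | bracket s W l hs hW h5 =>
    obtain ⟨c, h⟩ := hW
    obtain ⟨t, a, b, m, rfl, hreg, h3, hab, -⟩ := h.1.exists_big h5
    exact ⟨s, hs, c, _, _, h, .inr ⟨t, a, b :: m, l, h5, by simp, rfl, rfl⟩,
      h.bracketLetters h5 (by simp) l⟩

theorem IsNormalPoly.mem_ideal {S : Set (FreeMP k X)} {I : Submodule k (FreeMP k X)}
    (hI : IsPoissonIdeal I) (hS : S ⊆ I) {g : FreeMP k X} (hg : IsNormalPoly S g) : g ∈ I := by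
  cases hg with
  | base _ hs => exact hS hs
  | bracket s W l hs => exact hI.leftNormed (hS hs) _

theorem IsNormalPoly.mono {S S' : Set (FreeMP k X)} (h : S ⊆ S') {g : FreeMP k X}
    (hg : IsNormalPoly S g) : IsNormalPoly S' g := by
  cases hg with
  | base _ hs => exact .base _ (h hs)
  | bracket s W l hs hW h5 => exact .bracket s W l (h hs) hW h5

/-- The span of the normal polynomials whose leading monomials satisfy `Q`. -/
def normalSpan (S : Set (FreeMP k X)) (Q : MPWord X → Prop) : Submodule k (FreeMP k X) :=
  Submodule.span k {g | IsNormalPoly S g ∧ ∃ W, IsLeadingMonomial g W ∧ Q W}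

theorem normalSpan_mono {S S' : Set (FreeMP k X)} (h : S ⊆ S') {Q Q' : MPWord X → Prop}
    (hQ : ∀ W, Q W → Q' W) : normalSpan S Q ≤ normalSpan S' Q' :=
  Submodule.span_mono fun _ ⟨hg, W, hW, hq⟩ => ⟨hg.mono h, W, hW, hQ W hq⟩

/-- If every leading monomial of the ideal is one of a normal polynomial, then every element of
the ideal is a combination of normal polynomials that are not larger. -/
theorem mem_normalSpan_of_leading [Finite X] {R : Set (FreeMP k X)} {I : Submodule k (FreeMP k X)}
    (hI : IsPoissonIdeal I) (hR : R ⊆ I)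
    (h : ∀ f ∈ I, f ≠ 0 → ∃ h W, IsNormalPoly R h ∧ IsLeadingMonomial f W ∧ IsLeadingMonomial h W)
    {f : FreeMP k X} (hf : f ∈ I) {W : MPWord X} (hW : IsLeadingMonomial f W) :
    f ∈ normalSpan R fun V => V.lt W ∨ V = W := by
  revert f
  refine MPWord.wellFounded_lt.induction (C := fun W => ∀ {f}, f ∈ I → IsLeadingMonomial f W →
    f ∈ normalSpan R fun V => V.lt W ∨ V = W) W ?_
  · intro W ih f hf hW
    obtain ⟨g, W', hg, hfW, ⟨d, hgW⟩⟩ := h f hf hW.ne_zero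
    obtain rfl := hW.unique hfW
    obtain ⟨c, hc⟩ := hW
    -- One division step: cancelling the leading term lowers the leading monomial inside `I`, and
    -- induction treats the remainder.
    have hlow := hc.sub_smul_mem hgW
    set f' := f - (c * d⁻¹) • g with hf'
    have hmem : f' ∈ normalSpan R fun V => V.lt W ∨ V = W := by
      by_cases h0 : f' = 0
      · rw [h0]; exact zero_mem _
      · obtain ⟨c', V, hV⟩ := exists_isLeadingTerm h0
        have hlt := hV.monomial.lt_of_mem hc.1 hlow
        have hfI : f' ∈ I := sub_mem hf (I.smul_mem _ (hg.mem_ideal hI hR))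
        refine normalSpan_mono subset_rfl ?_ (ih V hlt hfI hV.monomial)
        rintro U (hU | rfl)
        exacts [.inl (hU.trans hlt), .inl hlt]
    have hgm : g ∈ normalSpan R fun V => V.lt W ∨ V = W :=
      Submodule.subset_span ⟨hg, W, ⟨d, hgW⟩, .inr rfl⟩
    have := add_mem hmem (Submodule.smul_mem _ (c * d⁻¹) hgm)
    rwa [hf', sub_add_cancel] at this

/-- The condition on leading monomials alone implies that `R` generates `I`, since division writes
every element of `I` by normal polynomials. -/
theorem isGroebnerShirshovBasis_of_leading [Finite X] {R : Set (FreeMP k X)}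
    {I : Submodule k (FreeMP k X)} (hI : IsPoissonIdeal I) (hR : R ⊆ I)
    (h : ∀ f ∈ I, f ≠ 0 → ∃ h W, IsNormalPoly R h ∧ IsLeadingMonomial f W ∧
      IsLeadingMonomial h W) : IsGroebnerShirshovBasis R I := by
  refine ⟨le_antisymm (fun f hf => ?_) (poissonIdealSpan_le hI hR), h⟩
  by_cases h0 : f = 0
  · rw [h0]; exact zero_mem _
  · obtain ⟨c, W, hW⟩ := exists_isLeadingTerm h0
    refine (Submodule.span_le.2 ?_) (mem_normalSpan_of_leading hI hR h hf hW.monomial)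
    rintro g ⟨hg, -⟩
    exact hg.mem_ideal (isPoissonIdeal_span k R) (subset_poissonIdealSpan R)

/-- Every ideal has a finite Gröbner–Shirshov basis. -/
theorem exists_finite_groebnerShirshov [Finite X] {I : Submodule k (FreeMP k X)}
    (hI : IsPoissonIdeal I) :
    ∃ R : Set (FreeMP k X), R.Finite ∧ IsGroebnerShirshovBasis R I := by
  obtain ⟨F, hFT, hFfin, hF⟩ := exists_finite_divides (k := k)
    {W : MPWord X | ∃ f ∈ I, IsLeadingMonomial f W} fun W ⟨f, _, h⟩ => h.isBasic
  choose! r hrI hr using fun W (hW : W ∈ F) => hFT hW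
  refine ⟨r '' F, hFfin.image r, isGroebnerShirshovBasis_of_leading hI ?_ ?_⟩
  · rintro _ ⟨W, hW, rfl⟩
    exact hrI W hW
  · intro f hf h0
    obtain ⟨c, W, hW⟩ := exists_isLeadingTerm h0
    obtain ⟨V, hV, hd⟩ := hF W ⟨f, hf, hW.monomial⟩
    obtain ⟨d, hd'⟩ := hr V hV
    obtain ⟨g, hg, hgW⟩ := IsNormalPoly.of_divides (Set.mem_image_of_mem r hV) hd' hd
    exact ⟨g, W, hg, hW.monomial, hgW.monomial⟩

end LeadingSets

/-! ### Finite presentation and the Noetherian property -/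

section Presentation

open FreeMP

variable {k : Type*} {P : Type*} [Field k] [AddCommGroup P] [Module k P] [PoissonAlgebra k P]

theorem isPoissonIdeal_comap {X : Type*} {I : Submodule k P} (hI : IsPoissonIdeal I)
    (hP : IsMetabelianPoisson k P) (g : X → P) :
    IsPoissonIdeal (I.comap (FreeMP.lift hP g)) := by
  intro x y hy
  simp only [Submodule.mem_comap, lift_pmul, lift_pbr] at hy ⊢
  exact hI _ _ hy

theorem exists_lift_surjective (hP : IsMetabelianPoisson k P) (hfg : IsFGPoisson k P) :
    ∃ (n : ℕ) (g : Fin n → P), Function.Surjective (FreeMP.lift hP g) := by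
  obtain ⟨s, hs, h⟩ := hfg
  obtain ⟨n, g, hg⟩ := hs.fin_param
  refine ⟨n, g, LinearMap.range_eq_top.1 (h _ ?_ ?_)⟩
  · intro x hx
    rw [← hg.2] at hx
    obtain ⟨i, rfl⟩ := hx
    exact ⟨ofLetter k i, rfl⟩
  · rintro _ ⟨x, rfl⟩ _ ⟨y, rfl⟩
    exact ⟨⟨pmul k x y, lift_pmul _ _ _ _⟩, ⟨pbr k x y, lift_pbr _ _ _ _⟩⟩

/-- For a surjection from a free algebra of finite rank, both its kernel and the preimage of an
ideal have finite Gröbner–Shirshov bases. The first provides the relations; the image of the second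
generates the ideal. -/
theorem isFP_and_isNoetherian (hP : IsMetabelianPoisson k P) (hfg : IsFGPoisson k P) :
    IsFPMetabelianPoisson k P ∧ IsNoetherianPoisson k P := by
  obtain ⟨n, g, hsurj⟩ := exists_lift_surjective hP hfg
  constructor
  · have hker : IsPoissonIdeal (LinearMap.ker (FreeMP.lift hP g)) := by
      intro x y hy
      rw [LinearMap.mem_ker] at hy
      simp [LinearMap.mem_ker, hy]
    obtain ⟨R, hR, hGS⟩ := exists_finite_groebnerShirshov hker
    refine ⟨n, R, hR, (Submodule.quotEquivOfEq _ _ hGS.1.symm).trans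
      ((FreeMP.lift hP g).quotKerEquivOfSurjective hsurj), fun x y => ?_⟩
    induction x using Submodule.Quotient.induction_on with | _ x
    induction y using Submodule.Quotient.induction_on with | _ y
    exact ⟨lift_pmul hP g x y, lift_pbr hP g x y⟩
  · intro I hI
    obtain ⟨R, hR, hGS⟩ := exists_finite_groebnerShirshov (isPoissonIdeal_comap hI hP g)
    refine ⟨FreeMP.lift hP g '' R, hR.image _, le_antisymm ?_ (poissonIdealSpan_le hI ?_)⟩
    · intro y hy
      obtain ⟨x, rfl⟩ := hsurj y
      have hx : x ∈ I.comap (FreeMP.lift hP g) := hy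
      rw [hGS.1] at hx
      refine (poissonIdealSpan_le (isPoissonIdeal_comap (isPoissonIdeal_span k _) hP g) ?_) hx
      exact fun r hr => subset_poissonIdealSpan (k := k) _ (Set.mem_image_of_mem _ hr)
    · rintro _ ⟨r, hr, rfl⟩
      have : r ∈ I.comap (FreeMP.lift hP g) := by
        rw [hGS.1]; exact subset_poissonIdealSpan R hr
      exact this

end Presentation

/-! ### Compositions and the composition-diamond lemma -/

theorem MPWord.big_inj {X : Type*} {t t' : Bool} {a a' : X} {m m' : List X} (hm : m ≠ []) (hm' : m' ≠ [])
    (h : big t a m = big t' a' m') : t = t' ∧ a = a' ∧ m = m' := by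
  have hl := congrArg MPWord.letters h
  rw [letters_big (.inr hm), letters_big (.inr hm'), List.cons.injEq] at hl
  refine ⟨?_, hl⟩
  cases t <;> cases t' <;> simp [MPWord.big] at h ⊢

section Composition

open FreeMP

variable {k : Type*} {X : Type*} [Field k] [LinearOrder X]

theorem insertionSort_congr {l l' : List X} (h : l.Perm l') :
    l.insertionSort (· ≤ ·) = l'.insertionSort (· ≤ ·) :=
  List.Perm.eq_of_pairwise (fun _ _ _ _ => le_antisymm)
    (List.pairwise_insertionSort _ _) (List.pairwise_insertionSort _ _)
    ((List.perm_insertionSort _ _).trans (h.trans (List.perm_insertionSort _ _).symm))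

theorem insertionSort_ne_nil {l : List X} (h : l ≠ []) : l.insertionSort (· ≤ ·) ≠ [] :=
  List.ne_nil_of_length_pos (by simpa [List.length_insertionSort, List.length_pos_iff] using h)

theorem MPWord.Divides.trans {U V W : MPWord X} (h : U.Divides V) (h' : V.Divides W) :
    U.Divides W := by
  rcases h with rfl | ⟨t, a, m, p, h5, hm, rfl, rfl⟩
  · exact h'
  rcases h' with rfl | ⟨t', a', m', p', h5', hm', he, rfl⟩
  · exact .inr ⟨t, a, m, p, h5, hm, rfl, rfl⟩
  obtain ⟨rfl, rfl, rfl⟩ := big_inj (insertionSort_ne_nil (by simp [hm])) hm' he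
  refine .inr ⟨t, a, m, p ++ p', h5, hm, rfl, ?_⟩
  rw [← List.append_assoc]
  exact congrArg _ (insertionSort_congr ((List.perm_insertionSort _ _).append_right p'))

theorem MPWord.IsBasic.isLeadingTerm {W : MPWord X} (hW : W.IsBasic k) (h5 : 5 ≤ W.len) :
    IsLeadingTerm (W.eval k) 1 W :=
  .mk' hW (hW.eval_notMem_lowerSpan h5) one_ne_zero (by simp)

theorem MPWord.IsBasic.eval_mem_derived {V : MPWord X} (hV : V.IsBasic k) :
    (∃ a, V = MPWord.lie a []) ∨ V.eval k ∈ derived k X := by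
  cases hV with
  | letter a => exact .inl ⟨a, rfl⟩
  | lie a b l => exact .inr (bracketLetters_mem_derived (pbr_mem_derived _ _) l)
  | com₂ => exact .inr (pmul_mem_derived _ _)
  | com₃ => exact .inr (pmul_mem_derived _ _)
  | mix₂ => exact .inr (pmul_mem_derived _ _)
  | mix₃ => exact .inr (pmul_mem_derived _ _)
  | mix => exact .inr (pmul_mem_derived _ _)

/-- The bracket (a, b) annihilates the derived ideal, so only the letters occurring linearly in `f`
contribute. The bound is three whatever the degree of `f`. -/
theorem pbr_pbr_mem_degSpan (f : FreeMP k X) (a b : X) :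
    pbr k f (pbr k (ofLetter k a) (ofLetter k b)) ∈ degSpan k X 3 := by
  have hf : f ∈ Submodule.span k
      {f : FreeMP k X | ∃ V : MPWord X, V.IsBasic k ∧ f = V.eval k} := by
    rw [span_basic_eq_top]; trivial
  induction hf using Submodule.span_induction with
  | zero => simp
  | add x y _ _ hx hy => rw [add_pbr]; exact add_mem hx hy
  | smul c x _ hx => rw [smul_pbr]; exact Submodule.smul_mem _ c hx
  | mem f hf =>
    obtain ⟨V, hV, rfl⟩ := hf
    rcases hV.eval_mem_derived with ⟨c, rfl⟩ | hd
    · rw [pbr_skew]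
      exact neg_mem (op_letter_mem_degSpan (pbr_letter_mem_degSpan a b) c).2
    · rw [(derived_mul_derived hd (pbr_mem_derived _ _)).2]
      exact zero_mem _

/-- All compositions of the set are trivial. -/
structure IsCompositionClosed (S : Set (FreeMP k X)) : Prop where
  mul : ∀ f, IsMulComposition S f → IsTrivialMulComposition S f
  general : ∀ f W, IsGeneralComposition S f W → IsTrivialModulo S f W

theorem IsMonicSet.ne_zero {S : Set (FreeMP k X)} (hS : IsMonicSet S) : ∀ s ∈ S, s ≠ 0 := by
  intro s hs
  obtain ⟨W, hW⟩ := hS s hs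
  exact hW.monomial.ne_zero

theorem IsMonicSet.coeff_eq_one {S : Set (FreeMP k X)} (hS : IsMonicSet S) {s : FreeMP k X}
    (hs : s ∈ S) {c : k} {W : MPWord X} (h : IsLeadingTerm s c W) : c = 1 := by
  obtain ⟨W', hW'⟩ := hS s hs
  exact h.unique hW'

theorem IsMonicSet.isLeadingTerm {S : Set (FreeMP k X)} (hS : IsMonicSet S) {s : FreeMP k X}
    (hs : s ∈ S) {W : MPWord X} (h : IsLeadingMonomial s W) : IsLeadingTerm s 1 W := by
  obtain ⟨c, h⟩ := h
  have := hS.coeff_eq_one hs h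
  rwa [this] at h

theorem IsNormalPoly.pbr_letter {S : Set (FreeMP k X)} {g : FreeMP k X} (hg : IsNormalPoly S g)
    {W : MPWord X} (hW : IsLeadingMonomial g W) (h5 : 5 ≤ W.len) (a : X) :
    IsNormalPoly S (pbr k g (ofLetter k a)) := by
  cases hg with
  | base _ hs => exact .bracket g W [a] hs hW h5
  | bracket s V l hs hV h5' =>
    rw [← bracketLetters_concat]
    exact .bracket s V _ hs hV h5'

/-- Bracketing starts at leading monomials of length five and does not shorten them. -/
theorem IsNormalPoly.mem_of_len_le {S : Set (FreeMP k X)} {g : FreeMP k X}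
    (hg : IsNormalPoly S g) {W : MPWord X} (hW : IsLeadingMonomial g W) (h4 : W.len ≤ 4) :
    g ∈ S := by
  cases hg with
  | base _ hs => exact hs
  | bracket s V l hs hV h5 =>
    obtain ⟨c, hV⟩ := hV
    obtain ⟨t, a, b, m, rfl, -⟩ := hV.1.exists_big h5
    have := hW.unique (hV.bracketLetters h5 (by simp) l).monomial
    rw [this, MPWord.len_big (.inr (insertionSort_ne_nil (by simp)))] at h4
    rw [MPWord.len_big (.inr (by simp))] at h5
    simp only [List.length_insertionSort, List.length_append] at h4
    omega

/-- Replaces the bound by the leading monomial of `f` with a bound on the length, the form that is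
stable under further brackets. -/
theorem IsTrivialMulComposition.mem_normalSpan {S : Set (FreeMP k X)} {f : FreeMP k X}
    (h : IsTrivialMulComposition S f) {n : ℕ} (hn : f ∈ degSpan k X n) :
    f ∈ normalSpan S fun W => W.len ≤ n := by
  rcases h with rfl | ⟨V, hV, h⟩
  · exact zero_mem _
  · have hVn := hV.len_le_of_mem hn
    refine normalSpan_mono subset_rfl ?_ h
    rintro W (hW | rfl)
    exacts [hW.len_le.trans hVn, hVn]

theorem IsNormalPoly.exists_bracketLetters {S : Set (FreeMP k X)} {g : FreeMP k X}
    (hg : IsNormalPoly S g) {W : MPWord X}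
    (hW : IsLeadingMonomial g W) (h5 : 5 ≤ W.len) :
    ∃ s ∈ S, ∃ p V, IsLeadingMonomial s V ∧ 5 ≤ V.len ∧ g = bracketLetters s p := by
  cases hg with
  | base _ hs => exact ⟨g, hs, [], W, hW, h5, rfl⟩
  | bracket s V l hs hV h5' => exact ⟨s, hs, l, V, hV, h5', rfl⟩

theorem IsCompositionClosed.pbr_pbr_mem {S : Set (FreeMP k X)} (hC : IsCompositionClosed S)
    {s : FreeMP k X} (hs : s ∈ S) (a b : X) :
    pbr k s (pbr k (ofLetter k a) (ofLetter k b)) ∈ normalSpan S fun V => V.len ≤ 3 := by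
  rcases lt_trichotomy a b with h | rfl | h
  · rw [pbr_skew (ofLetter k a), pbr_neg]
    exact neg_mem ((hC.mul _ (.bracket_bracket s b a hs h)).mem_normalSpan
      (pbr_pbr_mem_degSpan s b a))
  · simp
  · exact (hC.mul _ (.bracket_bracket s a b hs h)).mem_normalSpan (pbr_pbr_mem_degSpan s a b)

variable [Finite X]

theorem IsNormalPoly.exists_divides_monic {S : Set (FreeMP k X)} (hS : IsMonicSet S)
    {g : FreeMP k X} (hg : IsNormalPoly S g) :
    ∃ s ∈ S, ∃ V W, IsLeadingTerm s 1 V ∧ V.Divides W ∧ IsLeadingTerm g 1 W := by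
  obtain ⟨s, hs, c, V, W, h, hd, h'⟩ := hg.exists_divides hS.ne_zero
  obtain rfl := hS.coeff_eq_one hs h
  exact ⟨s, hs, V, W, h, hd, h'⟩

theorem IsNormalPoly.isLeadingTerm {S : Set (FreeMP k X)} (hS : IsMonicSet S)
    {g : FreeMP k X} (hg : IsNormalPoly S g) {W : MPWord X} (h : IsLeadingMonomial g W) :
    IsLeadingTerm g 1 W := by
  obtain ⟨s, hs, V, W', -, -, h'⟩ := hg.exists_divides_monic hS
  rwa [h.unique h'.monomial]

namespace IsCompositionClosed

variable {S : Set (FreeMP k X)}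

/-- Up to length four the bracket is a multiplication composition, trivial by assumption; from
length five on it is again a normal polynomial, unless it is zero. -/
theorem pbr_letter_normal (hC : IsCompositionClosed S)
    {g : FreeMP k X}
    (hg : IsNormalPoly S g) {W : MPWord X}
    (hW : IsLeadingMonomial g W) (a : X) :
    pbr k g (ofLetter k a) ∈ normalSpan S fun V => V.len ≤ W.len + 1 := by
  have hdeg := (op_letter_mem_degSpan hW.mem_degSpan a).2
  by_cases h4 : W.len ≤ 4
  · exact (hC.mul _ (.bracket_letter g W a (hg.mem_of_len_le hW h4) hW h4)).mem_normalSpan hdeg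
  · by_cases h0 : pbr k g (ofLetter k a) = 0
    · rw [h0]; exact zero_mem _
    · obtain ⟨c, V, hV⟩ := exists_isLeadingTerm h0
      exact Submodule.subset_span ⟨hg.pbr_letter hW (by omega) a, V, hV.monomial,
        hV.monomial.len_le_of_mem hdeg⟩

theorem pbr_letter_mem (hC : IsCompositionClosed S)
    {f : FreeMP k X} {n : ℕ} (hf : f ∈ normalSpan S fun V => V.len ≤ n)
    (a : X) : pbr k f (ofLetter k a) ∈ normalSpan S fun V => V.len ≤ n + 1 := by
  induction hf using Submodule.span_induction with
  | zero => simp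
  | add x y _ _ hx hy => rw [add_pbr]; exact add_mem hx hy
  | smul c x _ hx => rw [smul_pbr]; exact Submodule.smul_mem _ c hx
  | mem g hg =>
    obtain ⟨hg, W, hW, hn⟩ := hg
    exact normalSpan_mono subset_rfl (fun V hV => hV.trans (by omega)) (hC.pbr_letter_normal hg hW a)

theorem bracketLetters_mem (hC : IsCompositionClosed S)
    {f : FreeMP k X} {n : ℕ} (hf : f ∈ normalSpan S fun V => V.len ≤ n)
    (l : List X) : bracketLetters f l ∈ normalSpan S fun V => V.len ≤ n + l.length := by
  induction l generalizing f n with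
  | nil => exact hf
  | cons a l ih =>
    refine normalSpan_mono subset_rfl (fun V hV => hV.trans ?_) (ih (hC.pbr_letter_mem hf a))
    simp; omega

/-- The analogue of `pbr_mem_lowerSpan` for combinations of normal polynomials. Long ones stay
normal and stay below the bound. After one letter, short ones are rewritten by normal polynomials of
length at most five, while the new bound has length at least six. -/
theorem bracketLetters_mem_lt (hC : IsCompositionClosed S)
    {t : Bool} {a : X} {m : List X} (hm : m ≠ [])
    (hW : (MPWord.big t a m).IsBasic k) (h5 : 5 ≤ (MPWord.big t a m).len) {f : FreeMP k X}
    (hf : f ∈ normalSpan S fun V => V.lt (MPWord.big t a m)) (p : List X) :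
    bracketLetters f p ∈ normalSpan S fun V =>
      V.lt (MPWord.big t a ((m ++ p).insertionSort (· ≤ ·))) := by
  have step : ∀ {m : List X} (c : X), m ≠ [] → (MPWord.big t a m).IsBasic k →
      5 ≤ (MPWord.big t a m).len → ∀ {f : FreeMP k X},
      f ∈ normalSpan S (fun V => V.lt (MPWord.big t a m)) →
      pbr k f (ofLetter k c) ∈ normalSpan S fun V =>
        V.lt (MPWord.big t a (m.orderedInsert (· ≤ ·) c)) := by
    intro m c hm hW h5 f hf
    have hlen : (MPWord.big t a (m.orderedInsert (· ≤ ·) c)).len = (MPWord.big t a m).len + 1 := by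
      rw [MPWord.len_big (.inr hm), MPWord.len_big (.inr (List.ne_nil_of_length_pos
        (by simp [List.orderedInsert_length]))), List.orderedInsert_length]
    have hB := ((hW.isLeadingTerm h5).pbr_letter h5 hm c).1
    induction hf using Submodule.span_induction with
    | zero => simp
    | add x y _ _ hx hy => rw [add_pbr]; exact add_mem hx hy
    | smul c x _ hx => rw [smul_pbr]; exact Submodule.smul_mem _ c hx
    | mem g hg =>
      obtain ⟨hg, V, hV, hlt⟩ := hg
      by_cases h4 : V.len ≤ 4
      · refine normalSpan_mono subset_rfl (fun U hU => .inl ?_) (hC.pbr_letter_normal hg hV c)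
        omega
      · have hlow := pbr_mem_lowerSpan h5 hm c (hV.mem_lowerSpan hlt)
        by_cases h0 : pbr k g (ofLetter k c) = 0
        · rw [h0]; exact zero_mem _
        · obtain ⟨d, U, hU⟩ := exists_isLeadingTerm h0
          exact Submodule.subset_span ⟨hg.pbr_letter hV (by omega) c, U, hU.monomial,
            hU.monomial.lt_of_mem hB hlow⟩
  induction p generalizing f m with
  | nil =>
    have hs : m.Pairwise (· ≤ ·) := by
      obtain ⟨t', a', b', m', he, -, -, -, hs'⟩ := hW.exists_big h5
      rw [(MPWord.big_inj hm (by simp) he).2.2]; exact hs'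
    rw [List.append_nil, hs.insertionSort_eq]
    exact hf
  | cons c p ih =>
    have hne : m.orderedInsert (· ≤ ·) c ≠ [] := List.ne_nil_of_length_pos
      (by simp [List.orderedInsert_length])
    have := ih hne ((hW.isLeadingTerm h5).pbr_letter h5 hm c).1 (by
      rw [MPWord.len_big (.inr hm)] at h5
      rw [MPWord.len_big (.inr hne), List.orderedInsert_length]; omega) (step c hm hW h5 hf)
    rw [insertionSort_congr (((List.perm_orderedInsert _ _ _).append_right p).trans
      List.perm_middle.symm)] at this
    exact this

/-- Letters after the first act on the derived ideal and commute. Exchanging the first two letters d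
and c costs [s, (d, c), l], and (s, (d, c)) is a combination of normal polynomials of length at most
three, so the error is short however long `s` is. -/
theorem bracketLetters_perm_sub_mem (hC : IsCompositionClosed S)
    {s : FreeMP k X} (hs : s ∈ S) {p p' : List X}
    (h : p.Perm p') :
    bracketLetters s p - bracketLetters s p' ∈ normalSpan S fun V => V.len ≤ p.length + 1 := by
  induction h with
  | nil => simp
  | cons c h =>
    rw [bracketLetters_cons, bracketLetters_cons, bracketLetters_perm (pbr_mem_derived _ _) h,
      sub_self]
    exact zero_mem _
  | swap c d l =>
    have : bracketLetters s (d :: c :: l) - bracketLetters s (c :: d :: l) =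
        bracketLetters (pbr k s (pbr k (ofLetter k d) (ofLetter k c))) l := by
      simp only [bracketLetters_cons]
      rw [← bracketLetters_sub, pbr_pbr_left s (ofLetter k d) (ofLetter k c), add_sub_cancel_left]
    rw [this]
    refine normalSpan_mono subset_rfl (fun V hV => hV.trans ?_)
      (hC.bracketLetters_mem (hC.pbr_pbr_mem hs d c) l)
    simp; omega
  | trans h1 _ ih1 ih2 =>
    have := add_mem ih1 (normalSpan_mono subset_rfl (fun V hV => hV.trans
      (by rw [h1.length_eq])) ih2)
    rwa [sub_add_sub_cancel] at this

/-- Remove the common factor: up to order, `p₁` and `p₂` are p and q followed by the same list r,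
where p and q complete `m₁` and `m₂` to their least common multiple. The difference is then a
general composition, trivial by assumption, bracketed with r, up to reordering errors. -/
theorem sub_mem_of_big (hC : IsCompositionClosed S)
    {s₁ s₂ : FreeMP k X} (hs₁ : s₁ ∈ S) (hs₂ : s₂ ∈ S) {t : Bool} {a : X}
    {m₁ m₂ p₁ p₂ : List X} (h₁ : IsLeadingTerm s₁ 1 (MPWord.big t a m₁))
    (h₂ : IsLeadingTerm s₂ 1 (MPWord.big t a m₂)) (hl₁ : 4 ≤ m₁.length) (hl₂ : 4 ≤ m₂.length)
    (hp : (m₁ ++ p₁).Perm (m₂ ++ p₂)) :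
    bracketLetters s₁ p₁ - bracketLetters s₂ p₂ ∈ normalSpan S fun V =>
      V.lt (MPWord.big t a ((m₁ ++ p₁).insertionSort (· ≤ ·))) := by
  have hm₁ : m₁ ≠ [] := by rintro rfl; simp at hl₁
  have hm₂ : m₂ ≠ [] := by rintro rfl; simp at hl₂
  have h5₁ : 5 ≤ (MPWord.big t a m₁).len := by rw [MPWord.len_big (.inr hm₁)]; omega
  obtain ⟨p, q, r, hpq, hdisj, hps, hqs, hp₁, hp₂⟩ : ∃ p q r : List X,
      (m₁ ++ p).Perm (m₂ ++ q) ∧ p.Disjoint q ∧ p.Pairwise (· ≤ ·) ∧ q.Pairwise (· ≤ ·) ∧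
      p₁.Perm (p ++ r) ∧ p₂.Perm (q ++ r) := by
    let M₁ : Multiset X := m₁
    let M₂ : Multiset X := m₂
    let P₁ : Multiset X := p₁
    let P₂ : Multiset X := p₂
    have hM : M₁ + P₁ = M₂ + P₂ := by
      simp only [M₁, M₂, P₁, P₂, Multiset.coe_add]; exact Multiset.coe_eq_coe.2 hp
    have hle : M₂ - M₁ ≤ P₁ := by
      rw [tsub_le_iff_left, hM]; exact Multiset.le_add_right _ _
    have hMM : M₁ + (M₂ - M₁) = M₂ + (M₁ - M₂) := by
      ext x; simp only [Multiset.count_add, Multiset.count_sub]; omega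
    have hP₂ : P₂ = (M₁ - M₂) + (P₁ - (M₂ - M₁)) := by
      apply add_left_cancel (a := M₂)
      rw [← add_assoc, ← hMM, add_assoc, add_tsub_cancel_of_le hle, hM]
    -- In terms of multisets, p is what `m₁` lacks in the least common multiple, q is what `m₂`
    -- lacks, and r is the rest of `p₁`.
    refine ⟨(M₂ - M₁).sort (· ≤ ·), (M₁ - M₂).sort (· ≤ ·), (P₁ - (M₂ - M₁)).toList, ?_, ?_,
      Multiset.pairwise_sort _ _, Multiset.pairwise_sort _ _, ?_, ?_⟩
    · rw [← Multiset.coe_eq_coe, ← Multiset.coe_add, ← Multiset.coe_add, Multiset.sort_eq,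
        Multiset.sort_eq]
      exact hMM
    · intro x hx hx'
      rw [Multiset.mem_sort, ← Multiset.count_pos, Multiset.count_sub] at hx hx'
      omega
    · rw [← Multiset.coe_eq_coe, ← Multiset.coe_add, Multiset.sort_eq, Multiset.coe_toList,
        add_tsub_cancel_of_le hle]
    · rw [← Multiset.coe_eq_coe, ← Multiset.coe_add, Multiset.sort_eq, Multiset.coe_toList]
      exact hP₂
  have hlead := h₁.bracketLetters h5₁ hm₁ p
  have hcomp : IsGeneralComposition S (bracketLetters s₁ p - bracketLetters s₂ q)
      (MPWord.big t a ((m₁ ++ p).insertionSort (· ≤ ·))) := by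
    cases t
    · obtain ⟨l₁, b₁, rfl⟩ := (List.eq_nil_or_concat' m₁).resolve_left hm₁
      obtain ⟨l₂, b₂, rfl⟩ := (List.eq_nil_or_concat' m₂).resolve_left hm₂
      rw [MPWord.big_false_concat] at h₁ h₂
      exact .mix s₁ s₂ a l₁ b₁ l₂ b₂ p q _ hs₁ hs₂ h₁.monomial h₂.monomial hl₁ hl₂ hpq hdisj hps
        hqs hlead.monomial
    · exact .lie s₁ s₂ a m₁ m₂ p q _ hs₁ hs₂ h₁.monomial h₂.monomial hl₁ hl₂ hpq hdisj hps
        hqs hlead.monomial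
  have hne : (m₁ ++ p).insertionSort (· ≤ ·) ≠ [] := insertionSort_ne_nil (by simp [hm₁])
  have hmain := hC.bracketLetters_mem_lt hne hlead.1 (by
    rw [MPWord.len_big (.inr hne), List.length_insertionSort, List.length_append]; omega)
    (hC.general _ _ hcomp) r
  have hsort : ((m₁ ++ p).insertionSort (· ≤ ·) ++ r).insertionSort (· ≤ ·) =
      (m₁ ++ p₁).insertionSort (· ≤ ·) := by
    refine insertionSort_congr (((List.perm_insertionSort _ _).append_right r).trans ?_)
    rw [List.append_assoc]
    exact hp₁.symm.append_left m₁
  rw [hsort, bracketLetters_sub, ← bracketLetters_append, ← bracketLetters_append] at hmain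
  have hne' : (m₁ ++ p₁).insertionSort (· ≤ ·) ≠ [] := insertionSort_ne_nil (by simp [hm₁])
  have hWlen : (MPWord.big t a ((m₁ ++ p₁).insertionSort (· ≤ ·))).len =
      m₁.length + p₁.length + 1 := by
    rw [MPWord.len_big (.inr hne'), List.length_insertionSort, List.length_append]
  have hlen := hp.length_eq
  rw [List.length_append, List.length_append] at hlen
  -- The reordering error has length at most `p₁.length + 1`, and the bound has length `m₁.length +
  -- p₁.length + 1`. The same comparison serves for `e2`.
  have e1 : bracketLetters s₁ p₁ - bracketLetters s₁ (p ++ r) ∈ normalSpan S fun V =>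
      V.lt (MPWord.big t a ((m₁ ++ p₁).insertionSort (· ≤ ·))) :=
    normalSpan_mono subset_rfl (fun V hV => .inl (by omega)) (hC.bracketLetters_perm_sub_mem hs₁ hp₁)
  have e2 : bracketLetters s₂ p₂ - bracketLetters s₂ (q ++ r) ∈ normalSpan S fun V =>
      V.lt (MPWord.big t a ((m₁ ++ p₁).insertionSort (· ≤ ·))) :=
    normalSpan_mono subset_rfl (fun V hV => .inl (by omega)) (hC.bracketLetters_perm_sub_mem hs₂ hp₂)
  have := sub_mem (add_mem e1 hmain) e2
  rwa [sub_add_sub_cancel, sub_sub_sub_cancel_right] at this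

/-- Normal polynomials with the same leading monomial differ by smaller normal polynomials. -/
theorem sub_mem_normalSpan (hC : IsCompositionClosed S)
    (hS : IsMonicSet S) {g₁ g₂ : FreeMP k X} (hg₁ : IsNormalPoly S g₁)
    (hg₂ : IsNormalPoly S g₂) {W : MPWord X} (h₁ : IsLeadingMonomial g₁ W)
    (h₂ : IsLeadingMonomial g₂ W) : g₁ - g₂ ∈ normalSpan S fun V => V.lt W := by
  by_cases h4 : W.len ≤ 4
  · exact hC.general _ _ (.sub g₁ g₂ W (hg₁.mem_of_len_le h₁ h4) (hg₂.mem_of_len_le h₂ h4) h₁ h₂)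
  · obtain ⟨s₁, hs₁, p₁, V₁, hV₁, h5₁, rfl⟩ := hg₁.exists_bracketLetters h₁ (by omega)
    obtain ⟨s₂, hs₂, p₂, V₂, hV₂, h5₂, rfl⟩ := hg₂.exists_bracketLetters h₂ (by omega)
    have hV₁ := hS.isLeadingTerm hs₁ hV₁
    have hV₂ := hS.isLeadingTerm hs₂ hV₂
    obtain ⟨t, a, b₁, m₁, rfl, -, hl₁, -⟩ := hV₁.1.exists_big h5₁
    obtain ⟨t', a', b₂, m₂, rfl, -, hl₂, -⟩ := hV₂.1.exists_big h5₂
    have e1 := h₁.unique (hV₁.bracketLetters h5₁ (by simp) p₁).monomial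
    have e2 := h₂.unique (hV₂.bracketLetters h5₂ (by simp) p₂).monomial
    obtain ⟨rfl, rfl, hsort⟩ := MPWord.big_inj (insertionSort_ne_nil (by simp))
      (insertionSort_ne_nil (by simp)) (e1.symm.trans e2)
    rw [e1]
    refine hC.sub_mem_of_big hs₁ hs₂ hV₁ hV₂ (by simp; omega) (by simp; omega) ?_
    exact (List.perm_insertionSort (· ≤ ·) _).symm.trans
      (hsort.symm ▸ List.perm_insertionSort (· ≤ ·) _)

/-- It suffices to treat letters. Brackets are covered by `pbr_letter_normal`. For products, [s, l,
b]·a = ([s, l]·a, b) - [s, l]·(a, b) allows induction on `l`; the last product is zero inside the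
derived ideal unless `l` is empty, and then it comes from a multiplication composition. -/
theorem isPoissonIdeal_normalSpan (hC : IsCompositionClosed S) :
    IsPoissonIdeal (normalSpan S fun _ => True) := by
  have hbr : ∀ f ∈ normalSpan S (fun _ => True), ∀ a,
      pbr k f (ofLetter k a) ∈ normalSpan S fun _ => True := by
    intro f hf a
    induction hf using Submodule.span_induction with
    | zero => simp
    | add x y _ _ hx hy => rw [add_pbr]; exact add_mem hx hy
    | smul c x _ hx => rw [smul_pbr]; exact Submodule.smul_mem _ c hx
    | mem g hg =>
      obtain ⟨hg, W, hW, -⟩ := hg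
      exact normalSpan_mono subset_rfl (fun _ _ => trivial) (hC.pbr_letter_normal hg hW a)
  have htriv : ∀ f, IsTrivialMulComposition S f → f ∈ normalSpan S fun _ => True := by
    rintro f (rfl | ⟨V, -, h⟩)
    · exact zero_mem _
    · exact normalSpan_mono subset_rfl (fun _ _ => trivial) h
  have hmb : ∀ s ∈ S, ∀ a b, pmul k s (pbr k (ofLetter k a) (ofLetter k b)) ∈
      normalSpan S fun _ => True := by
    intro s hs a b
    rcases lt_trichotomy a b with h | rfl | h
    · rw [pbr_skew (ofLetter k a), pmul_neg]
      exact neg_mem (htriv _ (hC.mul _ (.mul_bracket s b a hs h)))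
    · simp
    · exact htriv _ (hC.mul _ (.mul_bracket s a b hs h))
  have hmul : ∀ s ∈ S, ∀ l : List X, ∀ a,
      pmul k (bracketLetters s l) (ofLetter k a) ∈ normalSpan S fun _ => True := by
    intro s hs l
    induction l using List.reverseRecOn with
    | nil => exact fun a => htriv _ (hC.mul _ (.mul_letter s a hs))
    | append_singleton l b ih =>
      intro a
      have e : pmul k (bracketLetters s (l ++ [b])) (ofLetter k a) =
          pbr k (pmul k (bracketLetters s l) (ofLetter k a)) (ofLetter k b) -
            pmul k (bracketLetters s l) (pbr k (ofLetter k a) (ofLetter k b)) := by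
        rw [bracketLetters_concat, pbr_pmul_left, add_sub_cancel_right]
      rw [e]
      refine sub_mem (hbr _ (ih a) b) ?_
      cases l with
      | nil => exact hmb s hs a b
      | cons c l =>
        rw [bracketLetters_cons, (derived_mul_derived (bracketLetters_mem_derived (pbr_mem_derived s (ofLetter k c)) l)
          (pbr_mem_derived _ _)).1]
        exact zero_mem _
  refine isPoissonIdeal_of_letters (fun f hf a => ?_) hbr
  induction hf using Submodule.span_induction with
  | zero => simp
  | add x y _ _ hx hy => rw [add_pmul]; exact add_mem hx hy
  | smul c x _ hx => rw [smul_pmul]; exact Submodule.smul_mem _ c hx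
  | mem g hg =>
    obtain ⟨hg, -⟩ := hg
    cases hg with
    | base _ hs => exact hmul g hs [] a
    | bracket s V l hs => exact hmul s hs l a

/-- Take the least `W` such that `f` is a combination of normal polynomials with leading monomials
up to `W`. Those with leading monomial exactly `W` agree with a single one modulo smaller normal
polynomials. Its coefficient is nonzero by minimality, so the leading terms do not cancel. -/
theorem exists_leading_of_mem_normalSpan (hC : IsCompositionClosed S)
    (hS : IsMonicSet S) {f : FreeMP k X}
    (hf : f ∈ normalSpan S fun _ => True) (h0 : f ≠ 0) :
    ∃ h W, IsNormalPoly S h ∧ IsLeadingMonomial f W ∧ IsLeadingMonomial h W := by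
  let T : Set (MPWord X) := {W | W.IsBasic k}
  let G : MPWord X → Set (FreeMP k X) := fun V => {g | IsNormalPoly S g ∧ IsLeadingMonomial g V}
  have hspan : ∀ Q : MPWord X → Prop, normalSpan S Q =
      Submodule.span k {g | ∃ V ∈ {V | V ∈ T ∧ Q V}, g ∈ G V} := by
    intro Q
    refine congrArg (Submodule.span k) (Set.ext fun g => ⟨?_, ?_⟩)
    · rintro ⟨hg, W, hW, hQ⟩
      exact ⟨W, ⟨hW.isBasic, hQ⟩, hg, hW⟩
    · rintro ⟨W, ⟨-, hQ⟩, hg, hW⟩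
      exact ⟨hg, W, hW, hQ⟩
  have hmax : ∀ {Q : MPWord X → Prop}, f ∈ normalSpan S Q →
      ∃ W, Q W ∧ f ∈ normalSpan S fun V => V.lt W ∨ V = W := by
    intro Q hQ
    rw [hspan] at hQ
    obtain ⟨W, ⟨hW, hQW⟩, h⟩ := exists_max_of_mem_span (fun V hV => hV.1) hQ h0
    refine ⟨W, hQW, Submodule.span_mono ?_ h⟩
    rintro g ⟨V, hV, hVW, hg, hgV⟩
    exact ⟨hg, V, hgV, hVW⟩
  obtain ⟨W₀, -, hW₀⟩ := hmax hf
  obtain ⟨W, hW, hmin⟩ := MPWord.wellFounded_lt.has_min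
    {W | f ∈ normalSpan S fun V => V.lt W ∨ V = W} ⟨W₀, hW₀⟩
  have hnot : f ∉ normalSpan S fun V => V.lt W := by
    intro h
    obtain ⟨V, hV, h⟩ := hmax h
    exact hmin V h hV
  have hex : ∃ h, IsNormalPoly S h ∧ IsLeadingMonomial h W := by
    by_contra hno
    push Not at hno
    refine hnot (Submodule.span_mono ?_ hW)
    rintro g ⟨hg, V, hV, hVW | rfl⟩
    · exact ⟨hg, V, hV, hVW⟩
    · exact absurd hV (hno g hg)
  obtain ⟨h, hh, hhW⟩ := hex
  have hle : (normalSpan S fun V => V.lt W ∨ V = W) ≤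
      Submodule.span k {h} ⊔ normalSpan S fun V => V.lt W := by
    refine Submodule.span_le.2 ?_
    rintro g ⟨hg, V, hV, hVW | rfl⟩
    · exact Submodule.mem_sup_right (Submodule.subset_span ⟨hg, V, hV, hVW⟩)
    · have := Submodule.add_mem_sup (Submodule.mem_span_singleton_self h)
        (hC.sub_mem_normalSpan hS hg hh hV hhW)
      rwa [add_sub_cancel] at this
  obtain ⟨x, hx, y, hy, rfl⟩ := Submodule.mem_sup.1 (hle hW)
  obtain ⟨c, rfl⟩ := Submodule.mem_span_singleton.1 hx
  have hc : c ≠ 0 := by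
    rintro rfl
    rw [zero_smul, zero_add] at hnot
    exact hnot hy
  refine ⟨h, W, hh, ⟨c, ?_⟩, hhW⟩
  have hlow : (normalSpan S fun V => V.lt W) ≤ lowerSpan k W := by
    refine Submodule.span_le.2 ?_
    rintro g ⟨-, V, hV, hlt⟩
    exact hV.mem_lowerSpan hlt
  have hh1 := hh.isLeadingTerm hS hhW
  have h2 := hh1.smul hc
  refine .mk' hh1.1 hh1.eval_notMem hc ?_
  have := add_mem h2.2.1 (hlow hy)
  rwa [mul_one, sub_add_eq_add_sub] at this

/-- The composition-diamond lemma: if all compositions are trivial, the set is a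
Gröbner–Shirshov basis. -/
theorem isGroebnerShirshovBasis (hC : IsCompositionClosed S)
    (hS : IsMonicSet S) :
    IsGroebnerShirshovBasis S (poissonIdealSpan k S) := by
  refine isGroebnerShirshovBasis_of_leading (isPoissonIdeal_span k S) (subset_poissonIdealSpan S)
    fun f hf h0 => hC.exists_leading_of_mem_normalSpan hS ?_ h0
  refine poissonIdealSpan_le hC.isPoissonIdeal_normalSpan (fun s hs => ?_) hf
  obtain ⟨W, hW⟩ := hS s hs
  exact Submodule.subset_span ⟨.base s hs, W, hW.monomial, trivial⟩

end IsCompositionClosed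

end Composition

/-! ### The completion procedure -/

section Completion

open FreeMP

variable {k : Type*} {X : Type*} [Field k] [LinearOrder X] {S : Set (FreeMP k X)}

theorem IsMulComposition.mem_ideal {I : Submodule k (FreeMP k X)} (hI : IsPoissonIdeal I)
    (hS : S ⊆ I) {f : FreeMP k X} (hf : IsMulComposition S f) : f ∈ I := by
  cases hf with
  | mul_letter s a hs => exact hI.pmul_right (hS hs) _
  | mul_bracket s a b hs => exact hI.pmul_right (hS hs) _
  | bracket_bracket s a b hs => exact hI.pbr_right (hS hs) _
  | bracket_letter s W a hs => exact hI.pbr_right (hS hs) _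

theorem IsGeneralComposition.mem_ideal {I : Submodule k (FreeMP k X)} (hI : IsPoissonIdeal I)
    (hS : S ⊆ I) {f : FreeMP k X} {W : MPWord X} (hf : IsGeneralComposition S f W) : f ∈ I := by
  have h : ∀ s ∈ S, ∀ p, bracketLetters s p ∈ I := fun s hs p => hI.leftNormed (hS hs) _
  cases hf with
  | sub s₁ s₂ W h₁ h₂ => exact sub_mem (hS h₁) (hS h₂)
  | lie s₁ s₂ a l₁ l₂ p q W h₁ h₂ => exact sub_mem (h _ h₁ _) (h _ h₂ _)
  | mix s₁ s₂ a l₁ b₁ l₂ b₂ p q W h₁ h₂ => exact sub_mem (h _ h₁ _) (h _ h₂ _)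

theorem IsTrivialMulComposition.mono {S' : Set (FreeMP k X)} (h : S ⊆ S') {f : FreeMP k X}
    (hf : IsTrivialMulComposition S f) : IsTrivialMulComposition S' f := by
  rcases hf with rfl | ⟨V, hV, hf⟩
  · exact .inl rfl
  · exact .inr ⟨V, hV, normalSpan_mono h (fun _ h => h) hf⟩

theorem bracketLetters_sub_mem_lowerSpan {s₁ s₂ : FreeMP k X} {t : Bool} {a : X}
    {m₁ m₂ p q : List X} {W : MPWord X} (h₁ : IsLeadingTerm s₁ 1 (MPWord.big t a m₁))
    (h₂ : IsLeadingTerm s₂ 1 (MPWord.big t a m₂)) (hl₁ : 4 ≤ m₁.length) (hl₂ : 4 ≤ m₂.length)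
    (hp : (m₁ ++ p).Perm (m₂ ++ q)) (hW : IsLeadingMonomial (bracketLetters s₁ p) W) :
    bracketLetters s₁ p - bracketLetters s₂ q ∈ lowerSpan k W := by
  have hm₁ : m₁ ≠ [] := by rintro rfl; simp at hl₁
  have hm₂ : m₂ ≠ [] := by rintro rfl; simp at hl₂
  have e1 := h₁.bracketLetters (by rw [MPWord.len_big (.inr hm₁)]; omega) hm₁ p
  have e2 := h₂.bracketLetters (by rw [MPWord.len_big (.inr hm₂)]; omega) hm₂ q
  rw [← insertionSort_congr hp] at e2
  rw [hW.unique e1.monomial]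
  exact e1.sub_mem e2

/-- Both members of a general composition have the leading monomial `W` with coefficient one, so the
leading terms cancel. -/
theorem IsGeneralComposition.mem_lowerSpan (hS : IsMonicSet S) {f : FreeMP k X} {W : MPWord X}
    (hf : IsGeneralComposition S f W) : W.IsBasic k ∧ f ∈ lowerSpan k W := by
  cases hf with
  | sub s₁ s₂ W h₁ h₂ hW₁ hW₂ =>
    exact ⟨hW₁.isBasic, (hS.isLeadingTerm h₁ hW₁).sub_mem (hS.isLeadingTerm h₂ hW₂)⟩
  | lie s₁ s₂ a l₁ l₂ p q W h₁ h₂ hW₁ hW₂ hl₁ hl₂ hp _ _ _ hW =>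
    exact ⟨hW.isBasic, bracketLetters_sub_mem_lowerSpan (t := true) (hS.isLeadingTerm h₁ hW₁)
      (hS.isLeadingTerm h₂ hW₂) hl₁ hl₂ hp hW⟩
  | mix s₁ s₂ a l₁ b₁ l₂ b₂ p q W h₁ h₂ hW₁ hW₂ hl₁ hl₂ hp _ _ _ hW =>
    rw [← MPWord.big_false_concat] at hW₁ hW₂
    exact ⟨hW.isBasic, bracketLetters_sub_mem_lowerSpan (hS.isLeadingTerm h₁ hW₁)
      (hS.isLeadingTerm h₂ hW₂) hl₁ hl₂ hp hW⟩

theorem completion_mono {m n : ℕ} (h : m ≤ n) : completion S m ⊆ completion S n := by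
  induction h with
  | refl => exact subset_rfl
  | step _ ih => exact ih.trans Set.subset_union_left

theorem completion_subset_ideal (n : ℕ) : completion S n ⊆ poissonIdealSpan k S := by
  induction n with
  | zero => exact subset_poissonIdealSpan S
  | succ n ih =>
    have hI := isPoissonIdeal_span k S
    rintro g (hg | ⟨f, c, W, hf, -, rfl⟩)
    · exact ih hg
    · refine Submodule.smul_mem _ _ ?_
      rcases hf with ⟨hf, -⟩ | ⟨W, hf, -⟩
      exacts [hf.mem_ideal hI ih, hf.mem_ideal hI ih]

theorem IsMonicSet.completion (hS : IsMonicSet S) (n : ℕ) : IsMonicSet (completion S n) := by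
  induction n with
  | zero => exact hS
  | succ n ih =>
    rintro g (hg | ⟨f, c, W, -, hf, rfl⟩)
    · exact ih g hg
    · have hc := hf.coeff_ne_zero
      have := hf.smul (inv_ne_zero hc)
      rw [inv_mul_cancel₀ hc] at this
      exact ⟨W, this⟩

/-- A composition of a finite stage is trivial with respect to the next stage. -/
theorem normalize_mem_completion {n : ℕ} {f : FreeMP k X}
    (hf : IsNontrivialComposition (completion S n) f) {c : k} {W : MPWord X}
    (h : IsLeadingTerm f c W) :
    f ∈ normalSpan (completion S (n + 1)) fun V => V = W := by
  have hc := h.coeff_ne_zero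
  have h1 := h.smul (inv_ne_zero hc)
  have : c⁻¹ • f ∈ normalSpan (completion S (n + 1)) fun V => V = W :=
    Submodule.subset_span ⟨.base _ (.inr ⟨f, c, W, hf, h, rfl⟩), W, h1.monomial, rfl⟩
  have := Submodule.smul_mem _ c this
  rwa [smul_smul, mul_inv_cancel₀ hc, one_smul] at this

theorem exists_stage₂ {s₁ s₂ : FreeMP k X} (h₁ : s₁ ∈ ⋃ n, completion S n)
    (h₂ : s₂ ∈ ⋃ n, completion S n) : ∃ n, s₁ ∈ completion S n ∧ s₂ ∈ completion S n := by
  obtain ⟨m, hm⟩ := Set.mem_iUnion.1 h₁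
  obtain ⟨n, hn⟩ := Set.mem_iUnion.1 h₂
  exact ⟨max m n, completion_mono (le_max_left _ _) hm, completion_mono (le_max_right _ _) hn⟩

theorem IsMulComposition.exists_stage {f : FreeMP k X}
    (hf : IsMulComposition (⋃ n, completion S n) f) : ∃ n, IsMulComposition (completion S n) f := by
  cases hf with
  | mul_letter s a hs =>
    obtain ⟨n, hn⟩ := Set.mem_iUnion.1 hs
    exact ⟨n, .mul_letter s a hn⟩
  | mul_bracket s a b hs hab =>
    obtain ⟨n, hn⟩ := Set.mem_iUnion.1 hs
    exact ⟨n, .mul_bracket s a b hn hab⟩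
  | bracket_bracket s a b hs hab =>
    obtain ⟨n, hn⟩ := Set.mem_iUnion.1 hs
    exact ⟨n, .bracket_bracket s a b hn hab⟩
  | bracket_letter s W a hs hW hl =>
    obtain ⟨n, hn⟩ := Set.mem_iUnion.1 hs
    exact ⟨n, .bracket_letter s W a hn hW hl⟩

theorem IsGeneralComposition.exists_stage {f : FreeMP k X} {W : MPWord X}
    (hf : IsGeneralComposition (⋃ n, completion S n) f W) :
    ∃ n, IsGeneralComposition (completion S n) f W := by
  cases hf with
  | sub s₁ s₂ W h₁ h₂ hW₁ hW₂ =>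
    obtain ⟨n, hn₁, hn₂⟩ := exists_stage₂ h₁ h₂
    exact ⟨n, .sub s₁ s₂ W hn₁ hn₂ hW₁ hW₂⟩
  | lie s₁ s₂ a l₁ l₂ p q W h₁ h₂ hW₁ hW₂ hl₁ hl₂ hp hd hps hqs hW =>
    obtain ⟨n, hn₁, hn₂⟩ := exists_stage₂ h₁ h₂
    exact ⟨n, .lie s₁ s₂ a l₁ l₂ p q W hn₁ hn₂ hW₁ hW₂ hl₁ hl₂ hp hd hps hqs hW⟩
  | mix s₁ s₂ a l₁ b₁ l₂ b₂ p q W h₁ h₂ hW₁ hW₂ hl₁ hl₂ hp hd hps hqs hW =>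
    obtain ⟨n, hn₁, hn₂⟩ := exists_stage₂ h₁ h₂
    exact ⟨n, .mix s₁ s₂ a l₁ b₁ l₂ b₂ p q W hn₁ hn₂ hW₁ hW₂ hl₁ hl₂ hp hd hps hqs hW⟩

theorem isMonicSet_iUnion_completion (hS : IsMonicSet S) :
    IsMonicSet (⋃ n, completion S n) := by
  intro s hs
  obtain ⟨n, hn⟩ := Set.mem_iUnion.1 hs
  exact hS.completion n s hn

/-- Disjointness forces `p` to divide `m₂`. This bounds the letters that occur in a composition. -/
theorem length_le_of_perm_of_disjoint {m₁ m₂ p q : List X} (h : (m₁ ++ p).Perm (m₂ ++ q))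
    (hd : p.Disjoint q) : p.length ≤ m₂.length := by
  refine (List.subperm_ext_iff.2 fun x hx => ?_).length_le
  have hc := h.count_eq x
  rw [List.count_append, List.count_append, List.count_eq_zero_of_not_mem (hd hx)] at hc
  omega

variable [Finite X]

/-- A composition involves at most two elements and so belongs to a finite stage. If it is not
trivial there, its normalized form is put into the next stage and makes it trivial. For general
compositions its leading monomial is below `W` by cancellation. -/
theorem isCompositionClosed_iUnion_completion (hS : IsMonicSet S) :
    IsCompositionClosed (⋃ n, completion S n) := by
  have hsub : ∀ n, completion S n ⊆ ⋃ n, completion S n := Set.subset_iUnion _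
  constructor
  · intro f hf
    obtain ⟨n, hf⟩ := hf.exists_stage
    by_cases ht : IsTrivialMulComposition (completion S n) f
    · exact ht.mono (hsub n)
    · by_cases h0 : f = 0
      · exact .inl h0
      obtain ⟨c, W, hW⟩ := exists_isLeadingTerm h0
      exact .inr ⟨W, hW.monomial, normalSpan_mono (hsub (n + 1)) (fun V hV => .inr hV)
        (normalize_mem_completion (.inl ⟨hf, ht⟩) hW)⟩
  · intro f W hf
    obtain ⟨n, hf⟩ := hf.exists_stage
    by_cases ht : IsTrivialModulo (completion S n) f W
    · exact normalSpan_mono (hsub n) (fun _ h => h) ht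
    · by_cases h0 : f = 0
      · rw [h0]; exact zero_mem _
      obtain ⟨c, V, hV⟩ := exists_isLeadingTerm h0
      have hlow := hf.mem_lowerSpan (hS.completion n)
      have hlt := hV.monomial.lt_of_mem hlow.1 hlow.2
      refine normalSpan_mono (hsub (n + 1)) ?_ (normalize_mem_completion (.inr ⟨W, hf, ht⟩) hV)
      rintro U rfl
      exact hlt

/-- The union of the stages is a Gröbner–Shirshov basis. By Dickson's lemma its leading monomials
are all divisible by finitely many of them, which are reached at some stage; from there on the stage
supplies a normal polynomial for every leading monomial of the ideal. -/
theorem exists_stage_isGroebnerShirshovBasis (hS : IsMonicSet S) :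
    ∃ t, ∀ n, t ≤ n → IsGroebnerShirshovBasis (completion S n) (poissonIdealSpan k S) := by
  have hmonic := isMonicSet_iUnion_completion hS
  have hG := (isCompositionClosed_iUnion_completion hS).isGroebnerShirshovBasis hmonic
  have hId : poissonIdealSpan k (⋃ n, completion S n) = poissonIdealSpan k S := by
    refine le_antisymm (poissonIdealSpan_le (isPoissonIdeal_span k S)
      (Set.iUnion_subset completion_subset_ideal)) (poissonIdealSpan_le (isPoissonIdeal_span k _) ?_)
    exact (Set.subset_iUnion (completion S) 0).trans (subset_poissonIdealSpan _)
  rw [hId] at hG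
  obtain ⟨F, hFT, hFfin, hF⟩ := exists_finite_divides (k := k)
    {W : MPWord X | ∃ s ∈ ⋃ n, completion S n, IsLeadingTerm s 1 W} fun W ⟨f, _, h⟩ => h.1
  have hst : ∀ W ∈ F, ∃ n, ∃ s ∈ completion S n, IsLeadingTerm s 1 W := by
    intro W hW
    obtain ⟨s, hs, h⟩ := hFT hW
    obtain ⟨n, hn⟩ := Set.mem_iUnion.1 hs
    exact ⟨n, s, hn, h⟩
  choose! st hst using hst
  obtain ⟨t, ht⟩ := (hFfin.image st).bddAbove
  refine ⟨t, fun n hn => isGroebnerShirshovBasis_of_leading (isPoissonIdeal_span k S)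
    (completion_subset_ideal n) fun f hf h0 => ?_⟩
  obtain ⟨g, W, hg, hfW, hgW⟩ := hG.2 f hf h0
  obtain ⟨s, hs, U, W', hU, hd, hg'⟩ := hg.exists_divides_monic hmonic
  obtain rfl := hgW.unique hg'.monomial
  obtain ⟨V, hV, hVU⟩ := hF U ⟨s, hs, hU⟩
  obtain ⟨s', hs', hsV⟩ := hst V hV
  have hs'' := completion_mono ((ht (Set.mem_image_of_mem st hV)).trans hn) hs'
  obtain ⟨g', hg', hgW'⟩ := IsNormalPoly.of_divides hs'' hsV (hVU.trans hd)
  exact ⟨g', W, hg', hfW, hgW'.monomial⟩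

/-- The easy half of the composition-diamond lemma: compositions lie in the ideal, and division
writes them by normal polynomials not exceeding their leading monomials. For a general composition
that monomial is already smaller than `W`. -/
theorem IsGroebnerShirshovBasis.not_isNontrivialComposition {I : Submodule k (FreeMP k X)}
    (hI : IsPoissonIdeal I) (h : IsGroebnerShirshovBasis S I) (hS : IsMonicSet S)
    (f : FreeMP k X) : ¬ IsNontrivialComposition S f := by
  have hSI : S ⊆ I := by
    rw [h.1]; exact subset_poissonIdealSpan S
  rintro (⟨hf, ht⟩ | ⟨W, hf, ht⟩)
  · refine ht ?_
    by_cases h0 : f = 0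
    · exact .inl h0
    · obtain ⟨c, W, hW⟩ := exists_isLeadingTerm h0
      exact .inr ⟨W, hW.monomial,
        mem_normalSpan_of_leading hI hSI h.2 (hf.mem_ideal hI hSI) hW.monomial⟩
  · refine ht ?_
    by_cases h0 : f = 0
    · rw [h0]; exact zero_mem _
    · obtain ⟨c, V, hV⟩ := exists_isLeadingTerm h0
      have hlow := hf.mem_lowerSpan hS
      have hlt := hV.monomial.lt_of_mem hlow.1 hlow.2
      refine normalSpan_mono subset_rfl ?_
        (mem_normalSpan_of_leading hI hSI h.2 (hf.mem_ideal hI hSI) hV.monomial)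
      rintro U (hU | rfl)
      exacts [hU.trans hlt, hlt]

theorem finite_mulComposition (hS : S.Finite) : {f | IsMulComposition S f}.Finite := by
  let g : FreeMP k X × X → FreeMP k X := fun q => pmul k q.1 (ofLetter k q.2)
  let g' : FreeMP k X × X → FreeMP k X := fun q => pbr k q.1 (ofLetter k q.2)
  let h : FreeMP k X × X × X → FreeMP k X := fun q =>
    pmul k q.1 (pbr k (ofLetter k q.2.1) (ofLetter k q.2.2))
  let h' : FreeMP k X × X × X → FreeMP k X := fun q =>
    pbr k q.1 (pbr k (ofLetter k q.2.1) (ofLetter k q.2.2))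
  have f1 : (S ×ˢ (Set.univ : Set X)).Finite := hS.prod Set.finite_univ
  have f2 : (S ×ˢ (Set.univ : Set (X × X))).Finite := hS.prod Set.finite_univ
  refine (((f1.image g).union (f1.image g')).union ((f2.image h).union (f2.image h'))).subset ?_
  intro f hf
  cases hf with
  | mul_letter s a hs => exact .inl (.inl ⟨(s, a), ⟨hs, trivial⟩, rfl⟩)
  | mul_bracket s a b hs => exact .inr (.inl ⟨(s, a, b), ⟨hs, trivial⟩, rfl⟩)
  | bracket_bracket s a b hs => exact .inr (.inr ⟨(s, a, b), ⟨hs, trivial⟩, rfl⟩)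
  | bracket_letter s W a hs => exact .inl (.inr ⟨(s, a), ⟨hs, trivial⟩, rfl⟩)

/-- The lists `p` and `q` are no longer than the leading monomials of `s₂` and `s₁`, whose lengths
are bounded on a finite set. -/
theorem finite_generalComposition (hS : S.Finite) :
    {f | ∃ W, IsGeneralComposition S f W}.Finite := by
  have hB : ∃ B : ℕ, ∀ s ∈ S, ∀ W, IsLeadingMonomial s W → W.len ≤ B := by
    have : ∀ s : FreeMP k X, ∃ n : ℕ, ∀ W, IsLeadingMonomial s W → W.len ≤ n := by
      intro s
      by_cases h : ∃ W, IsLeadingMonomial s W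
      · obtain ⟨W, hW⟩ := h
        exact ⟨W.len, fun V hV => by rw [hV.unique hW]⟩
      · exact ⟨0, fun W hW => absurd ⟨W, hW⟩ h⟩
    choose n hn using this
    obtain ⟨B, hB⟩ := (hS.image n).bddAbove
    exact ⟨B, fun s hs W hW => (hn s W hW).trans (hB (Set.mem_image_of_mem n hs))⟩
  obtain ⟨B, hB⟩ := hB
  let L : Set (List X) := {l | l.length ≤ B}
  have hL : L.Finite := List.finite_length_le X B
  have hfin : ((S ×ˢ S) ×ˢ (L ×ˢ L)).Finite := (hS.prod hS).prod (hL.prod hL)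
  refine (hfin.image fun q => bracketLetters q.1.1 q.2.1 - bracketLetters q.1.2 q.2.2).subset ?_
  rintro f ⟨W, hf⟩
  cases hf with
  | sub s₁ s₂ W h₁ h₂ =>
    exact ⟨((s₁, s₂), ([], [])), ⟨⟨h₁, h₂⟩, Nat.zero_le _, Nat.zero_le _⟩, rfl⟩
  | lie s₁ s₂ a l₁ l₂ p q W h₁ h₂ hW₁ hW₂ hl₁ hl₂ hp hd =>
    refine ⟨((s₁, s₂), (p, q)), ⟨⟨h₁, h₂⟩, ?_, ?_⟩, rfl⟩
    · exact (length_le_of_perm_of_disjoint hp hd).trans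
        ((Nat.le_succ _).trans (hB s₂ h₂ _ hW₂))
    · exact (length_le_of_perm_of_disjoint hp.symm hd.symm).trans
        ((Nat.le_succ _).trans (hB s₁ h₁ _ hW₁))
  | mix s₁ s₂ a l₁ b₁ l₂ b₂ p q W h₁ h₂ hW₁ hW₂ hl₁ hl₂ hp hd =>
    refine ⟨((s₁, s₂), (p, q)), ⟨⟨h₁, h₂⟩, ?_, ?_⟩, rfl⟩
    · exact (length_le_of_perm_of_disjoint hp hd).trans
        ((Nat.le_succ _).trans (hB s₂ h₂ _ hW₂))
    · exact (length_le_of_perm_of_disjoint hp.symm hd.symm).trans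
        ((Nat.le_succ _).trans (hB s₁ h₁ _ hW₁))

theorem finite_completion (hS : S.Finite) (n : ℕ) : (completion S n).Finite := by
  induction n with
  | zero => exact hS
  | succ n ih =>
    refine ih.union ?_
    have hfin : {f | IsNontrivialComposition (completion S n) f}.Finite := by
      refine ((finite_mulComposition ih).union (finite_generalComposition ih)).subset ?_
      rintro f (⟨hf, -⟩ | ⟨W, hf, -⟩)
      exacts [.inl hf, .inr ⟨W, hf⟩]
    -- Normalization is single-valued because the leading coefficient is unique.
    refine (hfin.biUnion (t := fun f => {g | ∃ c W, IsLeadingTerm f c W ∧ g = c⁻¹ • f}) ?_).subset ?_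
    · intro f _
      refine Set.Subsingleton.finite ?_
      rintro _ ⟨c, W, h, rfl⟩ _ ⟨c', W', h', rfl⟩
      rw [h.unique h']
    · rintro g ⟨f, c, W, hf, h, rfl⟩
      exact Set.mem_biUnion hf ⟨c, W, h, rfl⟩

theorem ReducesTo.lt_or_eq_zero {R : Set (FreeMP k X)} {f g : FreeMP k X} (h : ReducesTo R f g)
    {W : MPWord X} (hW : IsLeadingMonomial f W) :
    g = 0 ∨ ∃ V, IsLeadingMonomial g V ∧ V.lt W := by
  obtain ⟨h, c, W', -, hh, hf, rfl⟩ := h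
  obtain rfl := hW.unique hf.monomial
  by_cases h0 : f - c • h = 0
  · exact .inl h0
  · obtain ⟨d, V, hV⟩ := exists_isLeadingTerm h0
    refine .inr ⟨V, hV.monomial, hV.monomial.lt_of_mem hf.1 ?_⟩
    have := hf.sub_smul_mem hh
    rwa [inv_one, mul_one] at this

/-- Zero admits no step, and every step yields zero or lowers the leading monomial. -/
theorem wellFounded_reducesTo (R : Set (FreeMP k X)) :
    WellFounded fun g f => ReducesTo R f g := by
  have h0 : Acc (fun g f => ReducesTo R f g) 0 := by
    refine ⟨_, fun g hg => ?_⟩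
    obtain ⟨h, c, W, -, -, hf, -⟩ := hg
    exact absurd rfl hf.monomial.ne_zero
  have hW : ∀ W : MPWord X, ∀ f, IsLeadingMonomial f W → Acc (fun g f => ReducesTo R f g) f := by
    intro W
    refine MPWord.wellFounded_lt.induction (C := fun W => ∀ f, IsLeadingMonomial f W →
      Acc (fun g f => ReducesTo R f g) f) W ?_
    intro W ih f hf
    refine ⟨_, fun g hg => ?_⟩
    rcases hg.lt_or_eq_zero hf with rfl | ⟨V, hV, hlt⟩
    · exact h0
    · exact ih V hlt g hV
  refine ⟨fun f => ?_⟩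
  by_cases hf : f = 0
  · rw [hf]; exact h0
  · obtain ⟨c, W, h⟩ := exists_isLeadingTerm hf
    exact hW W f h.monomial

/-- Reduction steps do not change the class modulo the ideal. A nonzero element of the ideal always
admits a step, since the basis supplies a monic normal polynomial with the same leading monomial. -/
theorem IsGroebnerShirshovBasis.mem_iff_normalForm {R : Set (FreeMP k X)}
    {I : Submodule k (FreeMP k X)} (hI : IsPoissonIdeal I) (h : IsGroebnerShirshovBasis R I)
    (hR : IsMonicSet R) {f g : FreeMP k X} (hfg : Relation.ReflTransGen (ReducesTo R) f g)
    (hg : ∀ g', ¬ ReducesTo R g g') : f ∈ I ↔ g = 0 := by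
  have hRI : R ⊆ I := by
    rw [h.1]; exact subset_poissonIdealSpan R
  have hiff : f ∈ I ↔ g ∈ I := by
    clear hg
    induction hfg with
    | refl => rfl
    | tail _ hs ih =>
      obtain ⟨n, c, W, hn, -, -, rfl⟩ := hs
      rw [ih]
      exact (I.sub_mem_iff_left (I.smul_mem c (hn.mem_ideal hI hRI))).symm
  rw [hiff]
  refine ⟨fun hgI => ?_, fun h0 => h0 ▸ zero_mem _⟩
  by_contra h0
  obtain ⟨n, W, hn, ⟨c, hgW⟩, hnW⟩ := h.2 g hgI h0
  exact hg _ ⟨n, c, W, hn, hn.isLeadingTerm hR hnW, hgW, rfl⟩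

/-- The completion procedure terminates and yields a finite Gröbner–Shirshov basis. -/
theorem completion_terminates (hfin : S.Finite) (hS : IsMonicSet S) :
    ∃ t : ℕ, (∀ n, t ≤ n → completion S n = completion S t) ∧ (completion S t).Finite ∧
      IsMonicSet (completion S t) ∧
      IsGroebnerShirshovBasis (completion S t) (poissonIdealSpan k S) ∧
      (WellFounded fun g f => ReducesTo (completion S t) f g) ∧
      ∀ f g, Relation.ReflTransGen (ReducesTo (completion S t)) f g →
        (∀ g', ¬ ReducesTo (completion S t) g g') → (f ∈ poissonIdealSpan k S ↔ g = 0) := by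
  obtain ⟨t, ht⟩ := exists_stage_isGroebnerShirshovBasis hS
  have hI := isPoissonIdeal_span k S
  refine ⟨t, fun n hn => ?_, finite_completion hfin t, hS.completion t, ht t le_rfl,
    wellFounded_reducesTo _, fun f g hfg hg =>
      (ht t le_rfl).mem_iff_normalForm hI (hS.completion t) hfg hg⟩
  induction hn with
  | refl => rfl
  | @step n hn ih =>
    -- Stage n is a Gröbner–Shirshov basis and has no nontrivial compositions, so the next stage
    -- adds nothing.
    rw [← ih]
    refine Set.Subset.antisymm ?_ Set.subset_union_left
    rintro g (hg | ⟨f, c, W, hf, -⟩)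
    · exact hg
    · exact absurd hf ((ht n hn).not_isNontrivialComposition hI (hS.completion n) f)

end Completion

/-! ### Residual finiteness -/

section ResidualFiniteness

/-- Finitely generated modules over finitely generated commutative algebras are residually
finite-dimensional. -/
theorem exists_le_finite_quotient {k B M : Type*} [Field k] [CommRing B] [Algebra k B]
    [Algebra.FiniteType k B] [AddCommGroup M] [Module k M] [Module B M] [IsScalarTower k B M]
    [Module.Finite B M] (N : Submodule B M) {m : M} (hm : m ∉ N) :
    ∃ K : Submodule B M, N ≤ K ∧ m ∉ K ∧ Module.Finite k (M ⧸ K) := by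
  have := Algebra.FiniteType.isNoetherianRing k B
  set m' : M ⧸ N := N.mkQ m with hm'
  have hm0 : m' ≠ 0 := fun h => hm ((Submodule.Quotient.mk_eq_zero N).1 h)
  have htors : Ideal.torsionOf B (M ⧸ N) m' ≠ ⊤ := by
    rw [Ne, Ideal.eq_top_iff_one, Ideal.mem_torsionOf_iff, one_smul]
    exact hm0
  obtain ⟨p, hp, hle⟩ := Ideal.exists_le_maximal _ htors
  -- Krull's intersection theorem: if m' lay in all these submodules, it would be fixed by some r in
  -- p. Then 1 - r annihilates m' and lies in p, since p contains the annihilator, and so 1 would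
  -- lie in p.
  have hn : ∃ n : ℕ, m' ∉ (p ^ n • ⊤ : Submodule B (M ⧸ N)) := by
    by_contra! h
    obtain ⟨r, hr⟩ := (Ideal.mem_iInf_smul_pow_eq_bot_iff p m').1 ((Submodule.mem_iInf _).2 h)
    refine hp.ne_top ((Ideal.eq_top_iff_one p).2 ?_)
    have h1 : (1 - (r : B)) ∈ p := hle (by
      rw [Ideal.mem_torsionOf_iff, sub_smul, one_smul, hr, sub_self])
    simpa using add_mem h1 r.2
  obtain ⟨n, hn⟩ := hn
  -- The exponent is raised by one so that the power is contained in p even for n = 0.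
  have hn' : m' ∉ (p ^ (n + 1) • ⊤ : Submodule B (M ⧸ N)) := fun h =>
    hn (Submodule.smul_mono_left (Ideal.pow_le_pow_right n.le_succ) h)
  refine ⟨(p ^ (n + 1) • ⊤ : Submodule B (M ⧸ N)).comap N.mkQ, ?_, hn', ?_⟩
  · intro x hx
    rw [Submodule.mem_comap, Submodule.mkQ_apply, (Submodule.Quotient.mk_eq_zero N).2 hx]
    exact zero_mem _
  let _ := Ideal.Quotient.field p
  -- The Nullstellensatz: the residue field of a finitely generated algebra is finite over `k`.
  have hfin : Module.Finite k (B ⧸ p) := finite_of_finite_type_of_isJacobsonRing k (B ⧸ p)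
  have hle1 : p ^ (n + 1) ≤ p := Ideal.pow_le_self n.succ_ne_zero
  -- Finiteness lifts from B/p because the kernel of the projection is finitely generated and
  -- consists of nilpotent elements.
  have hfin' : Module.Finite k (B ⧸ p ^ (n + 1)) := by
    refine Module.finite_of_surjective_of_ker_le_nilradical
      (Ideal.Quotient.factorₐ k hle1) (Ideal.Quotient.factor_surjective hle1) ?_
      (IsNoetherian.noetherian _)
    intro x hx
    obtain ⟨b, rfl⟩ := Ideal.Quotient.mk_surjective x
    have hb : b ∈ p := Ideal.Quotient.eq_zero_iff_mem.1 hx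
    exact ⟨n + 1, by
      rw [← map_pow]; exact Ideal.Quotient.eq_zero_iff_mem.2 (Ideal.pow_mem_pow hb _)⟩
  set K := (p ^ (n + 1) • ⊤ : Submodule B (M ⧸ N)).comap N.mkQ with hK
  have hann : Module.IsTorsionBySet B (M ⧸ K) (p ^ (n + 1) : Ideal B) := by
    rintro x ⟨b, hb⟩
    obtain ⟨y, rfl⟩ := Submodule.mkQ_surjective K x
    refine (Submodule.Quotient.mk_eq_zero K).2 ?_
    change b • y ∈ K
    rw [hK, Submodule.mem_comap, map_smul]
    exact Submodule.smul_mem_smul hb trivial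
  let _ : Module (B ⧸ p ^ (n + 1)) (M ⧸ K) := hann.module
  have : IsScalarTower B (B ⧸ p ^ (n + 1)) (M ⧸ K) := hann.isScalarTower
  have : IsScalarTower k (B ⧸ p ^ (n + 1)) (M ⧸ K) := by
    refine ⟨fun c b x => ?_⟩
    obtain ⟨b, rfl⟩ := Ideal.Quotient.mk_surjective b
    obtain ⟨y, rfl⟩ := Submodule.mkQ_surjective K x
    exact congrArg K.mkQ (smul_assoc c b y)
  have : Module.Finite (B ⧸ p ^ (n + 1)) (M ⧸ K) := Module.Finite.of_restrictScalars_finite B _ _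
  exact Module.Finite.trans (B ⧸ p ^ (n + 1)) _

open scoped IsMulCommutative in
/-- A space generated by a finite set under finitely many commuting operators is residually
finite-dimensional with respect to the stable subspaces. -/
theorem exists_stable_finite_quotient {k V ι : Type*} [Field k] [AddCommGroup V] [Module k V]
    [Finite ι] (op : ι → Module.End k V) (hop : ∀ i j, op i * op j = op j * op i)
    {G : Set V} (hG : G.Finite)
    (hgen : ∀ U : Submodule k V, G ⊆ U → (∀ i, ∀ x ∈ U, op i x ∈ U) → U = ⊤)
    (N : Submodule k V) (hN : ∀ i, ∀ x ∈ N, op i x ∈ N) {m : V} (hm : m ∉ N) :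
    ∃ K : Submodule k V, N ≤ K ∧ (∀ i, ∀ x ∈ K, op i x ∈ K) ∧ m ∉ K ∧
      Module.Finite k (V ⧸ K) := by
  -- The operators generate a commutative algebra of finite type over which the space is a finitely
  -- generated module; its submodules are the stable subspaces.
  have hcomm : IsMulCommutative (Algebra.adjoin k (Set.range op)) :=
    Algebra.isMulCommutative_adjoin k (by rintro _ ⟨i, rfl⟩ _ ⟨j, rfl⟩; exact hop i j)
  set B := Algebra.adjoin k (Set.range op) with hB
  have hft : Algebra.FiniteType k B :=
    (Subalgebra.fg_iff_finiteType B).1 ⟨(Set.finite_range op).toFinset, by simp [hB]⟩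
  have hst : ∀ (U : Submodule k V), (∀ i, ∀ x ∈ U, op i x ∈ U) → ∀ b ∈ B, ∀ x ∈ U, b x ∈ U := by
    intro U hU b hb
    induction hb using Algebra.adjoin_induction with
    | mem b hb => obtain ⟨i, rfl⟩ := hb; exact hU i
    | algebraMap c => exact fun x hx => U.smul_mem c hx
    | add b b' _ _ h h' => exact fun x hx => U.add_mem (h x hx) (h' x hx)
    | mul b b' _ _ h h' => exact fun x hx => h _ (h' x hx)
  have hopB : ∀ i, op i ∈ B := fun i => Algebra.subset_adjoin ⟨i, rfl⟩
  have hfin : Module.Finite B V := by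
    refine ⟨⟨hG.toFinset, ?_⟩⟩
    rw [Set.Finite.coe_toFinset]
    have := hgen ((Submodule.span B G).restrictScalars k) Submodule.subset_span
      fun i x hx => (Submodule.span B G).smul_mem ⟨op i, hopB i⟩ hx
    exact (Submodule.restrictScalars_eq_top_iff k B V).1 this
  let N' : Submodule B V := { N with smul_mem' := fun b x hx => hst N hN b b.2 x hx }
  obtain ⟨K, hNK, hmK, hK⟩ := exists_le_finite_quotient (k := k) N' (m := m) hm
  exact ⟨K.restrictScalars k, hNK, fun i x hx => K.smul_mem ⟨op i, hopB i⟩ hx, hmK, hK⟩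

namespace FreeMP

variable {k : Type*} {X : Type*} [Field k]

theorem span_letters_sup_derived : Submodule.span k (Set.range (ofLetter k)) ⊔ derived k X = ⊤ := by
  refine eq_top_iff.2 fun x _ => ?_
  induction x using FreeMP.induction with
  | letter a => exact Submodule.mem_sup_left (Submodule.subset_span ⟨a, rfl⟩)
  | zero => exact zero_mem _
  | add x y hx hy => exact add_mem (hx trivial) (hy trivial)
  | smul c x hx => exact Submodule.smul_mem _ c (hx trivial)
  | mul x y => exact Submodule.mem_sup_right (pmul_mem_derived x y)
  | bracket x y => exact Submodule.mem_sup_right (pbr_mem_derived x y)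

/-- The span of the letters together with `U` is closed under both operations, so it is everything,
and on it both operations take values in `U`. -/
theorem derived_le_of_letters {U : Submodule k (FreeMP k X)} (hU : IsPoissonIdeal U)
    (hmul : ∀ a b, pmul k (ofLetter k a) (ofLetter k b) ∈ U)
    (hbr : ∀ a b, pbr k (ofLetter k a) (ofLetter k b) ∈ U) : derived k X ≤ U := by
  set W := Submodule.span k (Set.range (ofLetter k : X → FreeMP k X)) ⊔ U with hW
  have hl : ∀ x ∈ Submodule.span k (Set.range (ofLetter k : X → FreeMP k X)),
      ∀ y ∈ Submodule.span k (Set.range (ofLetter k : X → FreeMP k X)),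
      pmul k x y ∈ U ∧ pbr k x y ∈ U := by
    intro x hx y hy
    induction hx, hy using Submodule.span_induction₂ with
    | mem_mem x y hx hy =>
      obtain ⟨a, rfl⟩ := hx
      obtain ⟨b, rfl⟩ := hy
      exact ⟨hmul a b, hbr a b⟩
    | zero_left => simp
    | zero_right => simp
    | add_left x y z _ _ _ h1 h2 =>
      rw [add_pmul, add_pbr]; exact ⟨add_mem h1.1 h2.1, add_mem h1.2 h2.2⟩
    | add_right x y z _ _ _ h1 h2 =>
      rw [pmul_add, pbr_add]; exact ⟨add_mem h1.1 h2.1, add_mem h1.2 h2.2⟩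
    | smul_left c x y _ _ h =>
      rw [smul_pmul, smul_pbr]; exact ⟨U.smul_mem c h.1, U.smul_mem c h.2⟩
    | smul_right c x y _ _ h =>
      rw [pmul_smul, pbr_smul]; exact ⟨U.smul_mem c h.1, U.smul_mem c h.2⟩
  have hWW : ∀ x ∈ W, ∀ y ∈ W, pmul k x y ∈ U ∧ pbr k x y ∈ U := by
    intro x hx y hy
    obtain ⟨x₁, hx₁, x₂, hx₂, rfl⟩ := Submodule.mem_sup.1 hx
    obtain ⟨y₁, hy₁, y₂, hy₂, rfl⟩ := Submodule.mem_sup.1 hy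
    rw [pmul_add, pbr_add, add_pmul, add_pbr]
    exact ⟨add_mem (add_mem (hl _ hx₁ _ hy₁).1 (hU.pmul_right hx₂ _)) (hU.pmul_left _ hy₂),
      add_mem (add_mem (hl _ hx₁ _ hy₁).2 (hU.pbr_right hx₂ _)) (hU.pbr_left _ hy₂)⟩
  have htop : ∀ x, x ∈ W := by
    intro x
    induction x using FreeMP.induction with
    | letter a => exact Submodule.mem_sup_left (Submodule.subset_span ⟨a, rfl⟩)
    | zero => exact zero_mem _
    | add x y hx hy => exact add_mem hx hy
    | smul c x hx => exact Submodule.smul_mem _ c hx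
    | mul x y hx hy => exact Submodule.mem_sup_right (hWW x hx y hy).1
    | bracket x y hx hy => exact Submodule.mem_sup_right (hWW x hx y hy).2
  refine Submodule.span_le.2 ?_
  rintro _ ⟨x, y, rfl | rfl⟩
  exacts [(hWW x (htop x) y (htop y)).1, (hWW x (htop x) y (htop y)).2]

/-- The derived ideal and finitely many letters span the free algebra, so finite codimension inside
the derived ideal is enough. -/
theorem finite_quotient_of_derived [Finite X] (J : Submodule k (FreeMP k X))
    [Module.Finite k (derived k X ⧸ J.comap (derived k X).subtype)] :
    Module.Finite k (FreeMP k X ⧸ J) := by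
  let g : (derived k X ⧸ J.comap (derived k X).subtype) →ₗ[k] FreeMP k X ⧸ J :=
    Submodule.mapQ _ J (derived k X).subtype le_rfl
  have h : (⊤ : Submodule k (FreeMP k X ⧸ J)) =
      (Submodule.span k (Set.range (ofLetter k))).map J.mkQ ⊔ LinearMap.range g := by
    refine (eq_top_iff.2 fun x _ => ?_).symm
    obtain ⟨x, rfl⟩ := J.mkQ_surjective x
    obtain ⟨y, hy, z, hz, rfl⟩ := Submodule.mem_sup.1
      (span_letters_sup_derived.ge (Submodule.mem_top (x := x)))
    rw [map_add]
    exact Submodule.add_mem_sup (Submodule.mem_map_of_mem hy)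
      ⟨Submodule.Quotient.mk ⟨z, hz⟩, rfl⟩
  refine ⟨h ▸ Submodule.FG.sup (Submodule.FG.map _ (Submodule.fg_span (Set.finite_range _))) ?_⟩
  rw [LinearMap.range_eq_map]
  exact Submodule.FG.map _ Module.Finite.fg_top

/-- The product (`false`) or the bracket (`true`) with a letter, as an operator on the span of
products and brackets. -/
def derivedOp (i : Bool × X) : Module.End k (derived k X) where
  toFun f := match i with
    | (false, a) => ⟨pmul k f (ofLetter k a), pmul_mem_derived _ _⟩
    | (true, a) => ⟨pbr k f (ofLetter k a), pbr_mem_derived _ _⟩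
  map_add' f g := by
    obtain ⟨b, a⟩ := i
    cases b
    · exact Subtype.ext (add_pmul _ _ _)
    · exact Subtype.ext (add_pbr _ _ _)
  map_smul' c f := by
    obtain ⟨b, a⟩ := i
    cases b
    · exact Subtype.ext (smul_pmul _ _ _)
    · exact Subtype.ext (smul_pbr _ _ _)

/-- Two products vanish in either order, a product and a bracket may be exchanged, and two brackets
commute. -/
theorem derivedOp_comm (i j : Bool × X) :
    (derivedOp i * derivedOp j : Module.End k (derived k X)) = derivedOp j * derivedOp i := by
  obtain ⟨b, a⟩ := i
  obtain ⟨b', a'⟩ := j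
  refine LinearMap.ext fun f => Subtype.ext ?_
  cases b <;> cases b'
  · exact (derived_pmul_pmul f.2 _ _).trans (derived_pmul_pmul f.2 _ _).symm
  · exact (derived_pbr_pmul f.2 _ _).symm
  · exact derived_pbr_pmul f.2 _ _
  · exact derived_pbr_comm f.2 _ _

theorem isPoissonIdeal_map_derived {K : Submodule k (derived k X)}
    (hK : ∀ i, ∀ x ∈ K, derivedOp i x ∈ K) : IsPoissonIdeal (K.map (derived k X).subtype) := by
  refine isPoissonIdeal_of_letters ?_ ?_
  · rintro _ ⟨x, hx, rfl⟩ a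
    exact ⟨_, hK (false, a) x hx, rfl⟩
  · rintro _ ⟨x, hx, rfl⟩ a
    exact ⟨_, hK (true, a) x hx, rfl⟩

/-- Finitely generated metabelian Poisson algebras are residually finite-dimensional. -/
theorem exists_finite_quotient [Finite X] {I : Submodule k (FreeMP k X)} (hI : IsPoissonIdeal I)
    {f : FreeMP k X} (hf : f ∉ I) : ∃ J : Submodule k (FreeMP k X), I ≤ J ∧ IsPoissonIdeal J ∧
      f ∉ J ∧ Module.Finite k (FreeMP k X ⧸ J) := by
  -- Modulo `I` the element may be taken from the derived ideal and separated there as a module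
  -- element. If this is impossible, the sum of `I` and the derived ideal already separates it.
  by_cases hfd : f ∈ I ⊔ derived k X
  · obtain ⟨i, hi, a, ha, rfl⟩ := Submodule.mem_sup.1 hfd
    have hop : ∀ j : Bool × X, ∀ x ∈ I.comap (derived k X).subtype,
        derivedOp j x ∈ I.comap (derived k X).subtype := by
      rintro ⟨b, c⟩ x hx
      cases b
      exacts [hI.pmul_right hx _, hI.pbr_right hx _]
    obtain ⟨K, hIK, hKop, haK, hKfin⟩ := exists_stable_finite_quotient (derivedOp (k := k) (X := X))
      derivedOp_comm (G := Set.range (fun p : X × X =>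
          (⟨pmul k (ofLetter k p.1) (ofLetter k p.2), pmul_mem_derived _ _⟩ : derived k X)) ∪
        Set.range (fun p : X × X =>
          (⟨pbr k (ofLetter k p.1) (ofLetter k p.2), pbr_mem_derived _ _⟩ : derived k X)))
      ((Set.finite_range _).union (Set.finite_range _))
      (fun U hG hU => by
        have h := derived_le_of_letters (isPoissonIdeal_map_derived hU)
          (fun a b => ⟨_, hG (Or.inl ⟨(a, b), rfl⟩), rfl⟩)
          (fun a b => ⟨_, hG (Or.inr ⟨(a, b), rfl⟩), rfl⟩)
        refine eq_top_iff.2 fun x _ => ?_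
        obtain ⟨y, hy, hyx⟩ := h x.2
        rwa [← Subtype.ext hyx])
      _ hop (m := ⟨a, ha⟩) fun h => hf (add_mem hi h)
    -- Adding `I` does not absorb a, because K already contains the intersection of `I` with the
    -- derived ideal.
    refine ⟨I ⊔ K.map (derived k X).subtype, le_sup_left,
      hI.sup (isPoissonIdeal_map_derived hKop), fun h => haK ?_, ?_⟩
    · obtain ⟨i', hi', _, ⟨x, hx, rfl⟩, hix⟩ := Submodule.mem_sup.1 h
      have h1 : (⟨a, ha⟩ : derived k X) - x ∈ K := hIK (by
        change a - x ∈ I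
        have : a - x = i' - i := by
          rw [sub_eq_sub_iff_add_eq_add, add_comm a, ← hix]; rfl
        rw [this]; exact sub_mem hi' hi)
      simpa using add_mem h1 hx
    · have : Module.Finite k (derived k X ⧸ (I ⊔ K.map (derived k X).subtype).comap
          (derived k X).subtype) :=
        Module.Finite.of_surjective
          (Submodule.factor (p := K) (fun x hx => Submodule.mem_sup_right ⟨x, hx, rfl⟩))
          (Submodule.factor_surjective _)
      exact finite_quotient_of_derived _
  · refine ⟨I ⊔ derived k X, le_sup_left, hI.sup isPoissonIdeal_derived, hfd, ?_⟩
    have : Subsingleton (derived k X ⧸ (I ⊔ derived k X).comap (derived k X).subtype) :=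
      Submodule.Quotient.subsingleton_iff.2
        (eq_top_iff.2 fun x _ => Submodule.mem_sup_right x.2)
    exact finite_quotient_of_derived _

end FreeMP

end ResidualFiniteness

/-! ### Evaluation of terms in Polish notation -/

section TermEvaluation

/-- The operations that occur in terms, on an arbitrary type; `op false` and `op true` stand for
the product and the bracket. -/
structure OpAlgebra (k β : Type*) where
  zero : β
  add : β → β → β
  smul : k → β → β
  op : Bool → β → β → β

namespace PTerm

variable {k X β γ : Type*}

/-- The value of a term in an algebra. -/
def fold (A : OpAlgebra k β) (g : X → β) : PTerm k X → β
  | var a => g a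
  | zero => A.zero
  | add s t => A.add (s.fold A g) (t.fold A g)
  | smul c t => A.smul c (t.fold A g)
  | mul s t => A.op false (s.fold A g) (t.fold A g)
  | bracket s t => A.op true (s.fold A g) (t.fold A g)

/-- One step of the evaluation of a string in Polish notation from right to left, with a stack of
values. Missing stack entries are read as zero. -/
def step (A : OpAlgebra k β) (g : X → β) : Token k X → List β → List β
  | Sum.inl (Sum.inl c), l => A.smul c (l.headD A.zero) :: l.tail
  | Sum.inl (Sum.inr a), l => g a :: l
  | Sum.inr i, l =>
    if i = 0 then A.zero :: l
    else (if i = 1 then A.add (l.headD A.zero) (l.tail.headD A.zero)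
      else A.op (decide (i = 3)) (l.headD A.zero) (l.tail.headD A.zero)) :: l.tail.tail

/-- The value of a string in Polish notation. -/
def value (A : OpAlgebra k β) (g : X → β) (w : List (Token k X)) : β :=
  (w.foldr (step A g) []).headD A.zero

theorem foldr_step_toTokens (A : OpAlgebra k β) (g : X → β) (t : PTerm k X) (l : List β) :
    t.toTokens.foldr (step A g) l = t.fold A g :: l := by
  induction t generalizing l <;> simp_all [toTokens, step, fold]

theorem value_toTokens (A : OpAlgebra k β) (g : X → β) (t : PTerm k X) :
    value A g t.toTokens = t.fold A g := by
  rw [value, foldr_step_toTokens, List.headD_cons]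

/-- A map that respects the operations respects the values of strings. -/
theorem map_value {A : OpAlgebra k β} {B : OpAlgebra k γ} (φ : β → γ)
    (h0 : φ A.zero = B.zero) (hadd : ∀ x y, φ (A.add x y) = B.add (φ x) (φ y))
    (hsmul : ∀ c x, φ (A.smul c x) = B.smul c (φ x))
    (hop : ∀ b x y, φ (A.op b x y) = B.op b (φ x) (φ y)) (g : X → β) (w : List (Token k X)) :
    φ (value A g w) = value B (φ ∘ g) w := by
  have hhead : ∀ l : List β, φ (l.headD A.zero) = (l.map φ).headD B.zero := by
    rintro (_ | ⟨a, l⟩) <;> simp [h0]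
  have key : (w.foldr (step A g) []).map φ = w.foldr (step B (φ ∘ g)) [] := by
    induction w with
    | nil => rfl
    | cons a w ih =>
      rw [List.foldr_cons, List.foldr_cons, ← ih]
      generalize w.foldr (step A g) [] = l
      rcases a with (c | a) | i
      · simp only [step, List.map_cons, List.map_tail, hsmul, hhead]
      · simp [step]
      · by_cases h : i = 0
        · simp [step, h, h0]
        · simp only [step, if_neg h, List.map_cons, List.map_tail, apply_ite φ, hadd, hop, hhead]
  rw [value, value, hhead, key]

/-- The terms as an algebra. -/
def opAlgebra (k X : Type*) : OpAlgebra k (PTerm k X) :=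
  ⟨zero, add, smul, fun b => if b then bracket else mul⟩

/-- The term denoted by a string; ill-formed strings denote terms as well. -/
def ofTokens (w : List (Token k X)) : PTerm k X := value (opAlgebra k X) var w

theorem ofTokens_toTokens (t : PTerm k X) : ofTokens t.toTokens = t := by
  rw [ofTokens, value_toTokens]
  induction t <;> simp_all [fold, opAlgebra]

/-- Terms are the free algebra for these operations, and `fold` is a homomorphism from it. The
argument does not need the string to be well-formed. -/
theorem value_eq_fold (A : OpAlgebra k β) (g : X → β) (w : List (Token k X)) :
    value A g w = (ofTokens w).fold A g :=
  (map_value (A := opAlgebra k X) (B := A) (fold A g) rfl (fun _ _ => rfl) (fun _ _ => rfl)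
    (by rintro (_ | _) _ _ <;> rfl) var w).symm

end PTerm

end TermEvaluation

/-! ### The identities as a finite list of terms -/

section Laws

open PTerm

variable {k : Type*} [Field k]

/-- The product (`false`) or the bracket (`true`) of two terms. -/
def PTerm.opTerm {X : Type*} (b : Bool) (s t : PTerm k X) : PTerm k X :=
  if b then bracket s t else mul s t

/-- The identities of metabelian Poisson algebras, as terms that have to vanish. -/
def poissonLaws (k : Type*) [Field k] : List (PTerm k (Fin 4)) :=
  [add (mul (var 0) (var 1)) (smul (-1) (mul (var 1) (var 0))),
    add (mul (mul (var 0) (var 1)) (var 2)) (smul (-1) (mul (var 0) (mul (var 1) (var 2)))),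
    bracket (var 0) (var 0),
    -- Anticommutativity follows from the preceding law for arbitrary arguments, but not when the
    -- laws are tested at basis vectors only.
    add (bracket (var 0) (var 1)) (bracket (var 1) (var 0)),
    add (add (bracket (var 0) (bracket (var 1) (var 2))) (bracket (var 1) (bracket (var 2) (var 0))))
      (bracket (var 2) (bracket (var 0) (var 1))),
    add (bracket (var 0) (mul (var 1) (var 2)))
      (smul (-1) (add (mul (bracket (var 0) (var 1)) (var 2))
        (mul (var 1) (bracket (var 0) (var 2)))))] ++
  [false, true].flatMap fun b₁ => [false, true].flatMap fun b₂ => [false, true].map fun b₃ =>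
    opTerm b₁ (opTerm b₂ (var 0) (var 1)) (opTerm b₃ (var 2) (var 3))

variable {V : Type*} [AddCommGroup V] [Module k V] (β : Bool → V →ₗ[k] V →ₗ[k] V)

/-- A vector space with two bilinear operations. -/
def bilinearAlgebra : OpAlgebra k V := ⟨0, (· + ·), (· • ·), fun b x y => β b x y⟩

/-- A dictionary between the list of terms and ordinary identities. The predicate `p` restricts the
arguments, for instance to basis vectors, and the identities hold modulo `L`. -/
theorem forall_poissonLaws {L : Submodule k V} {p : V → Prop} :
    (∀ t ∈ poissonLaws k, ∀ g : Fin 4 → V, (∀ i, p (g i)) → t.fold (bilinearAlgebra β) g ∈ L) ↔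
      (∀ x y, p x → p y → β false x y - β false y x ∈ L) ∧
      (∀ x y z, p x → p y → p z →
        β false (β false x y) z - β false x (β false y z) ∈ L) ∧
      (∀ x, p x → β true x x ∈ L) ∧
      (∀ x y, p x → p y → β true x y + β true y x ∈ L) ∧
      (∀ x y z, p x → p y → p z →
        β true x (β true y z) + β true y (β true z x) + β true z (β true x y) ∈ L) ∧
      (∀ x y z, p x → p y → p z →
        β true x (β false y z) - (β false (β true x y) z + β false y (β true x z)) ∈ L) ∧
      (∀ b₁ b₂ b₃ x y z w, p x → p y → p z → p w → β b₁ (β b₂ x y) (β b₃ z w) ∈ L) := by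
  have hop : ∀ (b : Bool) (s t : PTerm k (Fin 4)) (g : Fin 4 → V),
      (opTerm b s t).fold (bilinearAlgebra β) g =
        β b (s.fold (bilinearAlgebra β) g) (t.fold (bilinearAlgebra β) g) := by
    rintro (_ | _) s t g <;> rfl
  have hneg : ∀ x y : V, x + (-1 : k) • y = x - y := fun x y => by
    rw [neg_one_smul, sub_eq_add_neg]
  constructor
  · intro h
    have key : ∀ t ∈ poissonLaws k, ∀ x y z w, p x → p y → p z → p w →
        t.fold (bilinearAlgebra β) ![x, y, z, w] ∈ L := by
      intro t ht x y z w hx hy hz hw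
      refine h t ht _ fun i => ?_
      fin_cases i <;> assumption
    simp only [poissonLaws, List.cons_append, List.nil_append, List.forall_mem_cons] at key
    obtain ⟨h1, h2, h3, h4, h5, h6, h7⟩ := key
    refine ⟨fun x y hx hy => hneg _ (β false y x) ▸ h1 x y x x hx hy hx hx,
      fun x y z hx hy hz => hneg _ (β false x (β false y z)) ▸ h2 x y z z hx hy hz hz,
      fun x hx => h3 x x x x hx hx hx hx, fun x y hx hy => h4 x y y y hx hy hy hy,
      fun x y z hx hy hz => h5 x y z z hx hy hz hz,
      fun x y z hx hy hz => hneg _ (β false (β true x y) z + β false y (β true x z)) ▸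
        h6 x y z z hx hy hz hz,
      fun b₁ b₂ b₃ x y z w hx hy hz hw => ?_⟩
    have := h7 (opTerm b₁ (opTerm b₂ (var 0) (var 1)) (opTerm b₃ (var 2) (var 3)))
      (by
        refine List.mem_flatMap.2 ⟨b₁, by cases b₁ <;> simp, List.mem_flatMap.2
          ⟨b₂, by cases b₂ <;> simp, List.mem_map.2 ⟨b₃, by cases b₃ <;> simp, rfl⟩⟩⟩)
      x y z w hx hy hz hw
    rwa [hop, hop, hop] at this
  · have hneg' : ∀ {x y : V}, x - y ∈ L → x + (-1 : k) • y ∈ L := fun h => (hneg _ _).symm ▸ h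
    rintro ⟨h1, h2, h3, h4, h5, h6, h7⟩ t ht g hg
    simp only [poissonLaws, List.cons_append, List.nil_append, List.mem_cons, List.mem_flatMap,
      List.mem_map] at ht
    rcases ht with rfl | rfl | rfl | rfl | rfl | rfl | ⟨b₁, -, b₂, -, b₃, -, rfl⟩
    · exact hneg' (h1 _ _ (hg 0) (hg 1))
    · exact hneg' (h2 _ _ _ (hg 0) (hg 1) (hg 2))
    · exact h3 _ (hg 0)
    · exact h4 _ _ (hg 0) (hg 1)
    · exact h5 _ _ _ (hg 0) (hg 1) (hg 2)
    · exact hneg' (h6 _ _ _ (hg 0) (hg 1) (hg 2))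
    · rw [hop, hop, hop]
      exact h7 _ _ _ _ _ _ _ (hg 0) (hg 1) (hg 2) (hg 3)

/-- Terms that are equal in metabelian Poisson algebras have equal values modulo every ideal that
contains the values of the identities. -/
theorem PTerm.Rel.fold_sub_mem {X : Type*} {L : Submodule k V}
    (hL : ∀ b x, ∀ y ∈ L, β b x y ∈ L ∧ β b y x ∈ L)
    (hlaws : ∀ t ∈ poissonLaws k, ∀ g : Fin 4 → V, t.fold (bilinearAlgebra β) g ∈ L)
    (g : X → V) {s t : PTerm k X} (h : Rel s t) :
    s.fold (bilinearAlgebra β) g - t.fold (bilinearAlgebra β) g ∈ L := by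
  obtain ⟨h1, h2, h3, h4, h5, h6, h7⟩ := (forall_poissonLaws β (p := fun _ => True)).1
    fun t ht g _ => hlaws t ht g
  simp only [true_implies] at h1 h2 h3 h4 h5 h6 h7
  have hop : ∀ b x x' y y', x - x' ∈ L → y - y' ∈ L → β b x y - β b x' y' ∈ L := by
    intro b x x' y y' hx hy
    have : β b x y - β b x' y' = β b (x - x') y + β b x' (y - y') := by
      simp only [map_sub, LinearMap.sub_apply]; abel
    rw [this]
    exact add_mem (hL b y _ hx).2 (hL b x' _ hy).1
  have hprod : ∀ s : PTerm k X, s.IsProd →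
      ∃ b x y, s.fold (bilinearAlgebra β) g = β b x y := by
    rintro _ (⟨s, t⟩ | ⟨s, t⟩)
    exacts [⟨false, _, _, rfl⟩, ⟨true, _, _, rfl⟩]
  have hzero : ∀ {x : V}, x ∈ L → x - 0 ∈ L := fun {x} h => by rwa [sub_zero x]
  have heq : ∀ {x y : V}, x = y → x - y ∈ L := fun h => by rw [h, sub_self]; exact zero_mem L
  induction h with
  | refl => exact heq rfl
  | symm _ h => rw [← neg_sub]; exact neg_mem h
  | trans _ _ h h' => simpa using add_mem h h'
  | add_congr _ _ h h' =>
    change _ + _ - (_ + _) ∈ L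
    rw [add_sub_add_comm]; exact add_mem h h'
  | smul_congr c _ h =>
    change c • _ - c • _ ∈ L
    rw [← _root_.smul_sub]; exact L.smul_mem c h
  | mul_congr _ _ h h' => exact hop false _ _ _ _ h h'
  | bracket_congr _ _ h h' => exact hop true _ _ _ _ h h'
  | add_comm => exact heq (_root_.add_comm _ _)
  | add_assoc => exact heq (_root_.add_assoc _ _ _)
  | zero_add => exact heq (_root_.zero_add _)
  | smul_add => exact heq (_root_.smul_add _ _ _)
  | add_smul => exact heq (_root_.add_smul _ _ _)
  | smul_smul c d s => exact heq (_root_.smul_smul c d _).symm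
  | one_smul => exact heq (_root_.one_smul _ _)
  | zero_smul => exact heq (_root_.zero_smul _ _)
  | mul_comm => exact h1 _ _
  | mul_assoc => exact h2 _ _ _
  | mul_add => exact heq (map_add _ _ _)
  | mul_smul => exact heq (map_smul _ _ _)
  | bracket_self => exact hzero (h3 _)
  | add_bracket => exact heq (LinearMap.map_add₂ _ _ _ _)
  | bracket_add => exact heq (map_add _ _ _)
  | smul_bracket => exact heq (LinearMap.map_smul₂ _ _ _ _)
  | bracket_smul => exact heq (map_smul _ _ _)
  | jacobi => exact hzero (h5 _ _ _)
  | leibniz => exact h6 _ _ _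
  | metabelian_mul hs ht =>
    obtain ⟨b, x, y, hx⟩ := hprod _ hs
    obtain ⟨b', x', y', hx'⟩ := hprod _ ht
    refine hzero (x := β false _ _) ?_
    rw [hx, hx']; exact h7 _ _ _ _ _ _ _
  | metabelian_bracket hs ht =>
    obtain ⟨b, x, y, hx⟩ := hprod _ hs
    obtain ⟨b', x', y', hx'⟩ := hprod _ ht
    refine hzero (x := β true _ _) ?_
    rw [hx, hx']; exact h7 _ _ _ _ _ _ _

/-- Consequences of relations hold modulo every ideal that contains the values of the identities
and of the relations. -/
theorem fold_sub_mem_of_mem_span {X : Type*} {L : Submodule k V}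
    (hL : ∀ b x, ∀ y ∈ L, β b x y ∈ L ∧ β b y x ∈ L)
    (hlaws : ∀ t ∈ poissonLaws k, ∀ g : Fin 4 → V, t.fold (bilinearAlgebra β) g ∈ L)
    (g : X → V) {S : Set (PTerm k X)} (hS : ∀ s ∈ S, s.fold (bilinearAlgebra β) g ∈ L)
    {u v : PTerm k X}
    (h : FreeMP.ofTerm u - FreeMP.ofTerm v ∈ poissonIdealSpan k (FreeMP.ofTerm '' S)) :
    u.fold (bilinearAlgebra β) g - v.fold (bilinearAlgebra β) g ∈ L := by
  let φ : FreeMP k X →ₗ[k] V ⧸ L :=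
    { toFun := Quotient.lift (fun t => L.mkQ (t.fold (bilinearAlgebra β) g)) fun _ _ h =>
        (Submodule.Quotient.eq L).2 (PTerm.Rel.fold_sub_mem β hL hlaws g h)
      map_add' := by rintro ⟨s⟩ ⟨t⟩; rfl
      map_smul' := by rintro c ⟨s⟩; rfl }
  have hφ : ∀ t, FreeMP.ofTerm t ∈ LinearMap.ker φ ↔ t.fold (bilinearAlgebra β) g ∈ L :=
    fun t => Submodule.Quotient.mk_eq_zero L
  have hker : IsPoissonIdeal (LinearMap.ker φ) := by
    intro x y hy
    obtain ⟨s, rfl⟩ := FreeMP.ofTerm_surjective x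
    obtain ⟨t, rfl⟩ := FreeMP.ofTerm_surjective y
    have ht := (hφ t).1 hy
    exact ⟨(hφ (s.mul t)).2 (hL false _ _ ht).1, (hφ (s.bracket t)).2 (hL true _ _ ht).1⟩
  have := poissonIdealSpan_le hker (by rintro _ ⟨s, hs, rfl⟩; exact (hφ s).2 (hS s hs)) h
  rw [LinearMap.mem_ker, map_sub, sub_eq_zero] at this
  exact (Submodule.Quotient.eq L).1 this

/-- Identities that hold for basis vectors hold identically. -/
theorem poissonLaws_of_basis (β : Bool → (ℕ →₀ k) →ₗ[k] (ℕ →₀ k) →ₗ[k] (ℕ →₀ k))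
    {L : Submodule k (ℕ →₀ k)} (h : ∀ t ∈ poissonLaws k, ∀ i : Fin 4 → ℕ,
      t.fold (bilinearAlgebra β) (fun j => Finsupp.single (i j) 1) ∈ L) :
    ∀ t ∈ poissonLaws k, ∀ g : Fin 4 → (ℕ →₀ k), t.fold (bilinearAlgebra β) g ∈ L := by
  -- Membership of a linear expression in `L` passes from basis vectors to all vectors; below this
  -- is applied to one variable after another.
  have ext : ∀ F : (ℕ →₀ k) → (ℕ →₀ k), IsLinearMap k F →
      (∀ x ∈ Set.range (fun i : ℕ => Finsupp.single i (1 : k)), F x ∈ L) → ∀ x, F x ∈ L := by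
    intro F hF hb x
    induction x using Finsupp.induction_linear with
    | zero => rw [hF.map_zero]; exact zero_mem L
    | add x y hx hy => rw [hF.map_add]; exact add_mem hx hy
    | single i c =>
      rw [← mul_one c, ← smul_eq_mul, ← Finsupp.smul_single, hF.map_smul]
      exact L.smul_mem c (hb _ ⟨i, rfl⟩)
  obtain ⟨h1, h2, h3, h4, h5, h6, h7⟩ := (forall_poissonLaws β
    (p := (· ∈ Set.range (fun i : ℕ => Finsupp.single i (1 : k))))).1 (by
      intro t ht g hg
      choose i hi using hg
      rw [show g = fun j => Finsupp.single (i j) 1 from funext fun j => (hi j).symm]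
      exact h t ht i)
  have h4' : ∀ x y, β true x y + β true y x ∈ L := fun x y =>
    ext (fun x => β true x y + β true y x) ⟨by intros; simp only [map_add, LinearMap.add_apply]; abel,
      by intros; simp⟩ (fun x hx => ext (fun y => β true x y + β true y x)
        ⟨by intros; simp only [map_add, LinearMap.add_apply]; abel, by intros; simp⟩
        (fun y hy => h4 x y hx hy) y) x
  refine fun t ht g => (forall_poissonLaws β (p := fun _ => True)).2
    ⟨?_, ?_, ?_, fun x y _ _ => h4' x y, ?_, ?_, ?_⟩ t ht g fun _ => trivial
  · exact fun x y _ _ => ext (fun x => β false x y - β false y x)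
      ⟨by intros; simp only [map_add, LinearMap.add_apply]; abel, by intros; simp [smul_sub]⟩
      (fun x hx => ext (fun y => β false x y - β false y x)
        ⟨by intros; simp only [map_add, LinearMap.add_apply]; abel, by intros; simp [smul_sub]⟩
        (fun y hy => h1 x y hx hy) y) x
  · exact fun x y z _ _ _ => ext (fun x => β false (β false x y) z - β false x (β false y z))
      ⟨by intros; simp only [map_add, LinearMap.add_apply]; abel, by intros; simp [smul_sub]⟩
      (fun x hx => ext (fun y => β false (β false x y) z - β false x (β false y z))
        ⟨by intros; simp only [map_add, LinearMap.add_apply]; abel, by intros; simp [smul_sub]⟩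
        (fun y hy => ext (fun z => β false (β false x y) z - β false x (β false y z))
          ⟨by intros; simp only [map_add]; abel, by intros; simp [smul_sub]⟩
          (fun z hz => h2 x y z hx hy hz) z) y) x
  -- The bracket of x with itself is quadratic in x, so sums need the polarized law `h4'`.
  · intro x _
    induction x using Finsupp.induction_linear with
    | zero => simp
    | add x y hx hy =>
      have : β true (x + y) (x + y) = β true x x + β true y y + (β true x y + β true y x) := by
        simp only [map_add, LinearMap.add_apply]; abel
      rw [this]
      exact add_mem (add_mem hx hy) (h4' x y)
    | single i c =>
      rw [← mul_one c, ← smul_eq_mul, ← Finsupp.smul_single, LinearMap.map_smul₂, map_smul]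
      exact L.smul_mem c (L.smul_mem c (h3 _ ⟨i, rfl⟩))
  · exact fun x y z _ _ _ => ext (fun x => β true x (β true y z) + β true y (β true z x) +
      β true z (β true x y))
      ⟨by intros; simp only [map_add, LinearMap.add_apply]; abel, by intros; simp⟩
      (fun x hx => ext (fun y => β true x (β true y z) + β true y (β true z x) +
        β true z (β true x y))
        ⟨by intros; simp only [map_add, LinearMap.add_apply]; abel, by intros; simp⟩
        (fun y hy => ext (fun z => β true x (β true y z) + β true y (β true z x) +
          β true z (β true x y))
          ⟨by intros; simp only [map_add, LinearMap.add_apply]; abel, by intros; simp⟩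
          (fun z hz => h5 x y z hx hy hz) z) y) x
  · exact fun x y z _ _ _ => ext (fun x => β true x (β false y z) -
      (β false (β true x y) z + β false y (β true x z)))
      ⟨by intros; simp only [map_add, LinearMap.add_apply]; abel, by intros; simp [smul_sub]⟩
      (fun x hx => ext (fun y => β true x (β false y z) -
        (β false (β true x y) z + β false y (β true x z)))
        ⟨by intros; simp only [map_add, LinearMap.add_apply]; abel, by intros; simp [smul_sub]⟩
        (fun y hy => ext (fun z => β true x (β false y z) -
          (β false (β true x y) z + β false y (β true x z)))
          ⟨by intros; simp only [map_add]; abel, by intros; simp [smul_sub]⟩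
          (fun z hz => h6 x y z hx hy hz) z) y) x
  · exact fun b₁ b₂ b₃ x y z w _ _ _ _ => ext (fun x => β b₁ (β b₂ x y) (β b₃ z w))
      ⟨by intros; simp, by intros; simp⟩
      (fun x hx => ext (fun y => β b₁ (β b₂ x y) (β b₃ z w)) ⟨by intros; simp, by intros; simp⟩
        (fun y hy => ext (fun z => β b₁ (β b₂ x y) (β b₃ z w)) ⟨by intros; simp, by intros; simp⟩
          (fun z hz => ext (fun w => β b₁ (β b₂ x y) (β b₃ z w))
            ⟨by intros; simp, by intros; simp⟩
            (fun w hw => h7 b₁ b₂ b₃ x y z w hx hy hz hw) w) z) y) x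

end Laws

/-! ### Formal sums as computable vectors -/

section FormalSums

variable {k : Type*} [Field k]

/-- Formal linear combinations of natural numbers, with repetitions allowed. -/
abbrev FormalSum (k : Type*) := List (k × ℕ)

namespace FormalSum

/-- The vector denoted by a formal sum. -/
noncomputable def toFinsupp (f : FormalSum k) : ℕ →₀ k :=
  (f.map fun p => Finsupp.single p.2 p.1).sum

@[simp] theorem toFinsupp_nil : toFinsupp ([] : FormalSum k) = 0 := rfl

@[simp] theorem toFinsupp_cons (p : k × ℕ) (f : FormalSum k) :
    toFinsupp (p :: f) = Finsupp.single p.2 p.1 + toFinsupp f := by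
  simp [toFinsupp]

@[simp] theorem toFinsupp_append (f g : FormalSum k) :
    toFinsupp (f ++ g) = toFinsupp f + toFinsupp g := by
  simp [toFinsupp]

/-- The multiple of a formal sum. -/
def scale (c : k) (f : FormalSum k) : FormalSum k := f.map fun p => (c * p.1, p.2)

@[simp] theorem toFinsupp_scale (c : k) (f : FormalSum k) :
    toFinsupp (scale c f) = c • toFinsupp f := by
  induction f with
  | nil => simp [scale]
  | cons p f ih =>
    rw [scale, List.map_cons, toFinsupp_cons, toFinsupp_cons, smul_add, ← ih,
      Finsupp.smul_single, smul_eq_mul, scale]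

/-- The bilinear extension of a multiplication table. -/
def mul (T : Bool → ℕ → ℕ → FormalSum k) (b : Bool) (f g : FormalSum k) : FormalSum k :=
  f.flatMap fun p => g.flatMap fun q => scale (p.1 * q.1) (T b p.2 q.2)

/-- Formal sums with the operations given by a multiplication table. -/
def opAlgebra (T : Bool → ℕ → ℕ → FormalSum k) : OpAlgebra k (FormalSum k) :=
  ⟨[], (· ++ ·), scale, mul T⟩

/-- The bilinear operations given by a multiplication table. -/
noncomputable def bilin (T : Bool → ℕ → ℕ → FormalSum k) (b : Bool) :
    (ℕ →₀ k) →ₗ[k] (ℕ →₀ k) →ₗ[k] (ℕ →₀ k) :=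
  Finsupp.linearCombination k fun i =>
    Finsupp.linearCombination k fun j => toFinsupp (T b i j)

theorem bilin_single (T : Bool → ℕ → ℕ → FormalSum k) (b : Bool) (i j : ℕ) (c d : k) :
    bilin T b (Finsupp.single i c) (Finsupp.single j d) = (c * d) • toFinsupp (T b i j) := by
  simp [bilin, mul_smul]

theorem toFinsupp_mul (T : Bool → ℕ → ℕ → FormalSum k) (b : Bool) (f g : FormalSum k) :
    toFinsupp (mul T b f g) = bilin T b (toFinsupp f) (toFinsupp g) := by
  induction f with
  | nil => simp [mul]
  | cons p f ih =>
    rw [mul, List.flatMap_cons, toFinsupp_append, toFinsupp_cons, map_add, LinearMap.add_apply,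
      ← ih, mul]
    congr 1
    clear ih
    induction g with
    | nil => simp
    | cons q g ih =>
      rw [List.flatMap_cons, toFinsupp_append, toFinsupp_cons, map_add, bilin_single,
        toFinsupp_scale, ih]

theorem toFinsupp_value {X : Type*} (T : Bool → ℕ → ℕ → FormalSum k) (g : X → FormalSum k)
    (w : List (PTerm.Token k X)) :
    toFinsupp (PTerm.value (opAlgebra T) g w) =
      (PTerm.ofTokens w).fold (bilinearAlgebra (bilin T)) (toFinsupp ∘ g) := by
  rw [← PTerm.value_eq_fold]
  exact PTerm.map_value toFinsupp rfl toFinsupp_append toFinsupp_scale (toFinsupp_mul T) g w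

/-- The coefficient of `i` in a formal sum. -/
def coeff (f : FormalSum k) (i : ℕ) : k :=
  f.foldr (fun p c => (if p.2 = i then p.1 else 0) + c) 0

theorem toFinsupp_apply (f : FormalSum k) (i : ℕ) : toFinsupp f i = coeff f i := by
  induction f with
  | nil => rfl
  | cons p f ih =>
    rw [toFinsupp_cons, Finsupp.add_apply, ih, Finsupp.single_apply]
    rfl

/-- The test whether a formal sum denotes zero. -/
def isZero [Encodable k] (f : FormalSum k) : Bool :=
  f.all fun p => decide (Encodable.encode (coeff f p.2) = Encodable.encode (0 : k))

/-- A coefficient can be nonzero only at an index that occurs in the list, so the test at those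
indices is complete. -/
theorem isZero_iff [Encodable k] (f : FormalSum k) : isZero f = true ↔ toFinsupp f = 0 := by
  simp only [isZero, List.all_eq_true, decide_eq_true_eq, Encodable.encode_inj]
  constructor
  · intro h
    ext i
    rw [toFinsupp_apply, Finsupp.zero_apply]
    by_cases hi : ∃ p ∈ f, p.2 = i
    · obtain ⟨p, hp, rfl⟩ := hi
      exact h p hp
    · push Not at hi
      clear h
      induction f with
      | nil => rfl
      | cons p f ih =>
        rw [List.forall_mem_cons] at hi
        rw [coeff, List.foldr_cons, if_neg hi.1, zero_add]
        exact ih hi.2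
  · intro h p _
    rw [← toFinsupp_apply, h, Finsupp.zero_apply]

/-- The difference of two formal sums. -/
def sub (f g : FormalSum k) : FormalSum k := f ++ scale (-1) g

@[simp] theorem toFinsupp_sub (f g : FormalSum k) :
    toFinsupp (sub f g) = toFinsupp f - toFinsupp g := by
  rw [sub, toFinsupp_append, toFinsupp_scale, neg_one_smul, sub_eq_add_neg]

end FormalSum

end FormalSums

/-! ### Certificates of equality -/

section Certificates

open FormalSum PTerm

variable {k : Type*} [Field k] {X : Type*}

/-- A code for the pair `(i, j)` with one of the two operations. -/
def opCode (b : Bool) (i j : ℕ) : ℕ := Nat.pair (cond b 1 0) (Nat.pair i j)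

/-- The algebra of all nonassociative monomials, coded by natural numbers: even numbers are
letters, odd numbers are products and brackets. -/
def monomialTable (k : Type*) [Field k] (b : Bool) (i j : ℕ) : FormalSum k :=
  [(1, 2 * opCode b i j + 1)]

/-- A letter as a formal sum of coded monomials. -/
def monomialLetter (k : Type*) [Field k] [Encodable X] (a : X) : FormalSum k :=
  [(1, 2 * Encodable.encode a)]

/-- The product (`false`) and the bracket (`true`) as bilinear maps. -/
def poissonOp (k : Type*) (P : Type*) [Field k] [AddCommGroup P] [Module k P]
    [PoissonAlgebra k P] (b : Bool) : P →ₗ[k] P →ₗ[k] P :=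
  cond b PoissonAlgebra.bracket PoissonAlgebra.mul

/-- The element of the free algebra denoted by a coded monomial. -/
noncomputable def monomialValue (k : Type*) [Field k] (X : Type*) [Encodable X] (n : ℕ) :
    FreeMP k X :=
  if n % 2 = 0 then ((Encodable.decode (n / 2) : Option X).map (FreeMP.ofLetter k)).getD 0
  -- The hypothesis `h` is recorded for termination: it makes n positive, so n / 2 and the
  -- components unpaired from it are smaller than n. The final branch is never reached.
  else if h : n % 2 = 1 then
    poissonOp k (FreeMP k X) (decide ((n / 2).unpair.1 = 1))
      (monomialValue k X (n / 2).unpair.2.unpair.1) (monomialValue k X (n / 2).unpair.2.unpair.2)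
  else 0
termination_by n
decreasing_by
  · have h1 := Nat.unpair_left_le (n / 2).unpair.2
    have h2 := Nat.unpair_right_le (n / 2)
    omega
  · have h1 := Nat.unpair_right_le (n / 2).unpair.2
    have h2 := Nat.unpair_right_le (n / 2)
    omega

theorem monomialValue_letter [Encodable X] (a : X) :
    monomialValue k X (2 * Encodable.encode a) = FreeMP.ofLetter k a := by
  rw [monomialValue, if_pos (by omega)]
  simp

theorem monomialValue_op [Encodable X] (b : Bool) (i j : ℕ) :
    monomialValue k X (2 * opCode b i j + 1) =
      poissonOp k (FreeMP k X) b (monomialValue k X i) (monomialValue k X j) := by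
  rw [monomialValue, if_neg (by omega), dif_pos (by omega),
    show (2 * opCode b i j + 1) / 2 = opCode b i j by omega]
  cases b <;> simp [opCode]

/-- The element of the free algebra denoted by a combination of coded monomials. -/
noncomputable def evalMonomials (k : Type*) [Field k] (X : Type*) [Encodable X] :
    (ℕ →₀ k) →ₗ[k] FreeMP k X := Finsupp.linearCombination k (monomialValue k X)

theorem evalMonomials_bilin [Encodable X] (b : Bool) (x y : ℕ →₀ k) :
    evalMonomials k X (bilin (monomialTable k) b x y) =
      poissonOp k (FreeMP k X) b (evalMonomials k X x) (evalMonomials k X y) := by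
  induction x using Finsupp.induction_linear with
  | zero => simp
  | add x x' hx hx' => simp only [map_add, LinearMap.add_apply, hx, hx']
  | single i c =>
    induction y using Finsupp.induction_linear with
    | zero => simp
    | add y y' hy hy' => simp only [map_add, hy, hy']
    | single j d =>
      rw [bilin_single, map_smul]
      simp [evalMonomials, monomialTable, monomialValue_op, smul_smul, mul_comm c]

/-- Terms over any variables are evaluated compatibly with homomorphisms. -/
theorem evalMonomials_fold [Encodable X] {Y : Type*} (g : Y → (ℕ →₀ k)) (t : PTerm k Y) :
    evalMonomials k X (t.fold (bilinearAlgebra (bilin (monomialTable k))) g) =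
      t.evalIn (fun y => evalMonomials k X (g y)) := by
  induction t with
  | var a => rfl
  | zero => exact map_zero _
  | add s t hs ht => exact (map_add _ _ _).trans (congrArg₂ _ hs ht)
  | smul c t ht => exact (map_smul _ _ _).trans (congrArg _ ht)
  | mul s t hs ht =>
    refine (evalMonomials_bilin false _ _).trans ?_
    rw [hs, ht]; rfl
  | bracket s t hs ht =>
    refine (evalMonomials_bilin true _ _).trans ?_
    rw [hs, ht]; rfl

/-- Repeated products and brackets with basis vectors on either side. -/
def applyContext (T : Bool → ℕ → ℕ → FormalSum k) (l : List (Bool × Bool × ℕ))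
    (f : FormalSum k) : FormalSum k :=
  l.foldr (fun t f => cond t.2.1 (FormalSum.mul T t.1 f [(1, t.2.2)])
    (FormalSum.mul T t.1 [(1, t.2.2)] f)) f

/-- The strings of the identities of metabelian Poisson algebras. -/
def lawTokens (k : Type*) [Field k] : List (List (Token k (Fin 4))) :=
  (poissonLaws k).map PTerm.toTokens

/-- An instance of an identity or a relation, put into a context. An item `(n, q, m, l)` refers to
the `n`-th identity at the basis vectors `q`, the `m`-th relation, and the context `l`. -/
def itemSum [Encodable X] (S : List (List (Token k X)))
    (t : ℕ × (Fin 4 → ℕ) × ℕ × List (Bool × Bool × ℕ)) : FormalSum k :=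
  applyContext (monomialTable k) t.2.2.2
    (value (FormalSum.opAlgebra (monomialTable k)) (fun j => [(1, t.2.1 j)])
      ((lawTokens k).getD t.1 []) ++
    value (FormalSum.opAlgebra (monomialTable k)) (monomialLetter k) (S.getD t.2.2.1 []))

/-- The difference of the values of two strings. -/
def valueSub (T : Bool → ℕ → ℕ → FormalSum k) (g : X → FormalSum k) (u v : List (Token k X)) :
    FormalSum k :=
  FormalSum.sub (value (FormalSum.opAlgebra T) g u) (value (FormalSum.opAlgebra T) g v)

/-- The test whether `u - v` is the given combination of consequences of the identities and the
relations. -/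
def checkEq [Encodable k] [Encodable X]
    (p : List (List (Token k X)) × List (Token k X) × List (Token k X))
    (C : List (k × ℕ × (Fin 4 → ℕ) × ℕ × List (Bool × Bool × ℕ))) : Bool :=
  isZero (FormalSum.sub (valueSub (monomialTable k) (monomialLetter k) p.2.1 p.2.2)
    (C.flatMap fun t => scale t.1 (itemSum p.1 t.2)))

/-- The set of relations given by a list of strings. -/
def relators (S : List (List (Token k X))) : Set (PTerm k X) := {t | ∃ s ∈ S, t = ofTokens s}

theorem toFinsupp_flatMap_scale {ι : Type*} (F : ι → FormalSum k) (C : List (k × ι)) :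
    toFinsupp (C.flatMap fun t => scale t.1 (F t.2)) =
      (C.map fun t => t.1 • toFinsupp (F t.2)).sum := by
  induction C with
  | nil => rfl
  | cons t C ih => rw [List.flatMap_cons, toFinsupp_append, ih]; simp

theorem exists_flatMap_scale {ι : Type*} (F : ι → FormalSum k) {x : ℕ →₀ k}
    (hx : x ∈ Submodule.span k (Set.range fun i => toFinsupp (F i))) :
    ∃ C : List (k × ι), toFinsupp (C.flatMap fun t => scale t.1 (F t.2)) = x := by
  induction hx using Submodule.span_induction with
  | mem x hx =>
    obtain ⟨i, rfl⟩ := hx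
    exact ⟨[(1, i)], by simp⟩
  | zero => exact ⟨[], rfl⟩
  | add x y _ _ hx hy =>
    obtain ⟨C, rfl⟩ := hx
    obtain ⟨D, rfl⟩ := hy
    exact ⟨C ++ D, by simp⟩
  | smul c x _ hx =>
    obtain ⟨C, rfl⟩ := hx
    refine ⟨C.map fun t => (c * t.1, t.2), ?_⟩
    rw [toFinsupp_flatMap_scale, toFinsupp_flatMap_scale, List.smul_sum, List.map_map,
      List.map_map]
    congr 2
    funext t
    simp [mul_smul]

theorem FreeMP.fold_poissonLaws {t : PTerm k (Fin 4)} (ht : t ∈ poissonLaws k)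
    (g : Fin 4 → FreeMP k X) : t.fold (bilinearAlgebra (poissonOp k (FreeMP k X))) g = 0 := by
  refine (Submodule.mem_bot k).1 <|
    (forall_poissonLaws (poissonOp k (FreeMP k X)) (L := ⊥) (p := fun _ => True)).2
    (by
      simp only [true_implies, Submodule.mem_bot]
      refine ⟨fun x y => sub_eq_zero.2 (pmul_comm x y),
        fun x y z => sub_eq_zero.2 (pmul_assoc x y z), fun x => pbr_self x,
        fun x y => eq_neg_iff_add_eq_zero.1 (pbr_skew x y), PoissonAlgebra.jacobi,
        fun x y z => sub_eq_zero.2 (pbr_pmul_right x y z), ?_⟩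
      intro b₁ b₂ b₃ x y z w
      have hm : ∀ b (x y : FreeMP k X), poissonOp k (FreeMP k X) b x y ∈ derived k X := by
        rintro (_ | _) x y
        exacts [pmul_mem_derived x y, pbr_mem_derived x y]
      have := derived_mul_derived (hm b₂ x y) (hm b₃ z w)
      cases b₁
      exacts [this.1, this.2]) t ht g fun _ => trivial

theorem FreeMP.evalIn_poissonLaws {t : PTerm k (Fin 4)} (ht : t ∈ poissonLaws k)
    (g : Fin 4 → FreeMP k X) : t.evalIn g = 0 := by
  rw [← fold_poissonLaws ht g]
  clear ht
  induction t <;> simp_all [PTerm.evalIn, PTerm.fold, bilinearAlgebra, poissonOp, pmul, pbr]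

theorem evalMonomials_value [Encodable X] (w : List (Token k X)) :
    evalMonomials k X (toFinsupp
      (value (FormalSum.opAlgebra (monomialTable k)) (monomialLetter k) w)) =
      FreeMP.ofTerm (ofTokens w) := by
  rw [toFinsupp_value, evalMonomials_fold]
  generalize ofTokens w = t
  induction t with
  | var a => simp [evalIn, evalMonomials, monomialLetter, monomialValue_letter]; rfl
  | zero => rfl
  | add s t hs ht => exact congrArg₂ _ hs ht
  | smul c t ht => exact congrArg _ ht
  | mul s t hs ht => exact congrArg₂ _ hs ht
  | bracket s t hs ht => exact congrArg₂ _ hs ht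

theorem toFinsupp_applyContext_mem {T : Bool → ℕ → ℕ → FormalSum k} {L : Submodule k (ℕ →₀ k)}
    (hL : ∀ b x, ∀ y ∈ L, bilin T b x y ∈ L ∧ bilin T b y x ∈ L) (l : List (Bool × Bool × ℕ))
    {f : FormalSum k} (hf : toFinsupp f ∈ L) : toFinsupp (applyContext T l f) ∈ L := by
  induction l with
  | nil => exact hf
  | cons t l ih =>
    obtain ⟨b, s, n⟩ := t
    cases s
    · change toFinsupp (FormalSum.mul T b [(1, n)] (applyContext T l f)) ∈ L
      rw [toFinsupp_mul]
      exact (hL _ _ _ ih).1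
    · change toFinsupp (FormalSum.mul T b (applyContext T l f) [(1, n)]) ∈ L
      rw [toFinsupp_mul]
      exact (hL _ _ _ ih).2

theorem List.getD_eq_default_or_mem {α : Type*} (l : List α) (n : ℕ) (d : α) :
    l.getD n d = d ∨ l.getD n d ∈ l := by
  rcases lt_or_ge n l.length with h | h
  · rw [List.getD_eq_getElem l d h]
    exact Or.inr (List.getElem_mem h)
  · exact Or.inl (List.getD_eq_default l d h)

/-- Identities vanish in the free algebra, relations lie in the ideal, and contexts preserve the
ideal. An index outside its list gives the empty string, whose value is zero, so an item may carry
an identity alone or a relation alone. -/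
theorem evalMonomials_itemSum [Encodable X] (S : List (List (Token k X)))
    (t : ℕ × (Fin 4 → ℕ) × ℕ × List (Bool × Bool × ℕ)) :
    evalMonomials k X (toFinsupp (itemSum S t)) ∈
      poissonIdealSpan k (FreeMP.ofTerm '' relators S) := by
  have hI := isPoissonIdeal_span k (FreeMP.ofTerm '' relators S)
  refine toFinsupp_applyContext_mem
    (L := (poissonIdealSpan k (FreeMP.ofTerm '' relators S)).comap (evalMonomials k X)) ?_ _ ?_
  · intro b x y hy
    rw [Submodule.mem_comap, Submodule.mem_comap, evalMonomials_bilin, evalMonomials_bilin]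
    cases b
    exacts [⟨hI.pmul_left _ hy, hI.pmul_right hy _⟩, ⟨hI.pbr_left _ hy, hI.pbr_right hy _⟩]
  · rw [toFinsupp_append]
    refine add_mem ?_ ?_
    · rcases List.getD_eq_default_or_mem (lawTokens k) t.1 [] with h | h
      · rw [h]; exact zero_mem _
      · obtain ⟨s, hs, hst⟩ := List.mem_map.1 h
        rw [← hst, toFinsupp_value, ofTokens_toTokens, Submodule.mem_comap, evalMonomials_fold,
          FreeMP.evalIn_poissonLaws hs]
        exact zero_mem _
    · rcases List.getD_eq_default_or_mem S t.2.2.1 [] with h | h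
      · rw [h]; exact zero_mem _
      · rw [Submodule.mem_comap, evalMonomials_value]
        exact subset_poissonIdealSpan _ ⟨_, ⟨_, h, rfl⟩, rfl⟩

/-- Soundness of equality certificates: the homomorphism `evalMonomials` turns the checked equation
into an expression of the difference by elements of the ideal. -/
theorem mem_of_checkEq [Encodable k] [Encodable X]
    {p : List (List (Token k X)) × List (Token k X) × List (Token k X)}
    {C : List (k × ℕ × (Fin 4 → ℕ) × ℕ × List (Bool × Bool × ℕ))} (h : checkEq p C = true) :
    FreeMP.ofTerm (ofTokens p.2.1) - FreeMP.ofTerm (ofTokens p.2.2) ∈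
      poissonIdealSpan k (FreeMP.ofTerm '' relators p.1) := by
  rw [checkEq, isZero_iff, toFinsupp_sub, sub_eq_zero, valueSub, toFinsupp_sub,
    toFinsupp_flatMap_scale] at h
  rw [← evalMonomials_value, ← evalMonomials_value, ← map_sub, h, map_list_sum]
  refine list_sum_mem fun x hx => ?_
  simp only [List.map_map, List.mem_map] at hx
  obtain ⟨t, -, rfl⟩ := hx
  rw [Function.comp_apply, map_smul]
  exact Submodule.smul_mem _ _ (evalMonomials_itemSum _ _)

/-- Completeness of equality certificates. In the algebra of all nonassociative monomials the items
span an ideal, because contexts can be prolonged. It contains the values of the identities, by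
multilinearity from basis vectors, and those of the relations, hence those of all their
consequences. -/
theorem exists_checkEq [Encodable k] [Encodable X]
    {p : List (List (Token k X)) × List (Token k X) × List (Token k X)}
    (h : FreeMP.ofTerm (ofTokens p.2.1) - FreeMP.ofTerm (ofTokens p.2.2) ∈
      poissonIdealSpan k (FreeMP.ofTerm '' relators p.1)) : ∃ C, checkEq p C = true := by
  set L := Submodule.span k (Set.range fun t => toFinsupp (itemSum p.1 t)) with hLdef
  have hsingle : ∀ (b : Bool) (i : ℕ), ∀ y ∈ L,
      bilin (monomialTable k) b (Finsupp.single i 1) y ∈ L ∧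
        bilin (monomialTable k) b y (Finsupp.single i 1) ∈ L := by
    intro b i y hy
    induction hy using Submodule.span_induction with
    | mem y hy =>
      obtain ⟨⟨n, q, m, l⟩, rfl⟩ := hy
      refine ⟨Submodule.subset_span ⟨(n, q, m, (b, false, i) :: l), ?_⟩,
        Submodule.subset_span ⟨(n, q, m, (b, true, i) :: l), ?_⟩⟩
      · exact (toFinsupp_mul _ _ _ _).trans (by simp; rfl)
      · exact (toFinsupp_mul _ _ _ _).trans (by simp; rfl)
    | zero => simp
    | add y y' _ _ hy hy' =>
      rw [map_add, map_add, LinearMap.add_apply]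
      exact ⟨add_mem hy.1 hy'.1, add_mem hy.2 hy'.2⟩
    | smul c y _ hy =>
      rw [map_smul, map_smul, LinearMap.smul_apply]
      exact ⟨L.smul_mem c hy.1, L.smul_mem c hy.2⟩
  have hL : ∀ b x, ∀ y ∈ L,
      bilin (monomialTable k) b x y ∈ L ∧ bilin (monomialTable k) b y x ∈ L := by
    intro b x y hy
    induction x using Finsupp.induction_linear with
    | zero => simp
    | add x x' hx hx' =>
      rw [map_add, map_add, LinearMap.add_apply]
      exact ⟨add_mem hx.1 hx'.1, add_mem hx.2 hx'.2⟩
    | single i c =>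
      rw [← mul_one c, ← smul_eq_mul, ← Finsupp.smul_single, map_smul, map_smul,
        LinearMap.smul_apply]
      exact ⟨L.smul_mem c (hsingle b i y hy).1, L.smul_mem c (hsingle b i y hy).2⟩
  have hlaws := poissonLaws_of_basis (bilin (monomialTable k)) (L := L) (by
    intro t ht q
    obtain ⟨n, hn, rfl⟩ := List.getElem_of_mem ht
    -- The relation index is out of range, so the item is the bare identity.
    refine Submodule.subset_span ⟨(n, q, p.1.length, []), ?_⟩
    change toFinsupp (_ ++ _) = _
    rw [toFinsupp_append, toFinsupp_value, List.getD_eq_default p.1 _ le_rfl,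
      List.getD_eq_getElem (lawTokens k) _ (by rwa [lawTokens, List.length_map])]
    change _ + 0 = _
    simp only [lawTokens, List.getElem_map, ofTokens_toTokens, add_zero]
    congr 1
    funext j
    simp)
  have hmem := fold_sub_mem_of_mem_span (bilin (monomialTable k)) hL hlaws
    (toFinsupp ∘ monomialLetter k) (S := relators p.1) (by
      rintro _ ⟨s, hs, rfl⟩
      obtain ⟨n, hn, rfl⟩ := List.getElem_of_mem hs
      -- Here the identity index is out of range, and the item is the bare relation.
      refine Submodule.subset_span ⟨((lawTokens k).length, 0, n, []), ?_⟩
      change toFinsupp (_ ++ _) = _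
      rw [toFinsupp_append, toFinsupp_value _ (monomialLetter k),
        List.getD_eq_default (lawTokens k) _ le_rfl, List.getD_eq_getElem p.1 _ hn]
      exact zero_add _) h
  obtain ⟨C, hC⟩ := exists_flatMap_scale (itemSum p.1) hmem
  refine ⟨C, ?_⟩
  rw [checkEq, isZero_iff, toFinsupp_sub, hC, valueSub, toFinsupp_sub, toFinsupp_value,
    toFinsupp_value, sub_self]

end Certificates

/-! ### Certificates of inequality: finite-dimensional models -/

section FiniteModels

open FormalSum PTerm

variable {k : Type*} [Field k] {X : Type*}

/-- The multiplication table stored in a list. -/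
def listTable (M : List (FormalSum k)) (b : Bool) (i j : ℕ) : FormalSum k :=
  M.getD (opCode b i j) []

/-- The images of the letters stored in a list. -/
def listLetter [Encodable X] (G : List (FormalSum k)) (a : X) : FormalSum k :=
  G.getD (Encodable.encode a) []

/-- A coding of quadruples by natural numbers. -/
def quad (n : ℕ) (j : Fin 4) : ℕ :=
  if j = 0 then n.unpair.1.unpair.1 else if j = 1 then n.unpair.1.unpair.2
  else if j = 2 then n.unpair.2.unpair.1 else n.unpair.2.unpair.2

/-- A bound for the codes of quadruples of numbers that are less than `m`. -/
def quadBound (m : ℕ) : ℕ := Nat.pair (Nat.pair m m) (Nat.pair m m)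

theorem exists_quad {m : ℕ} (q : Fin 4 → ℕ) (hq : ∀ j, q j < m) :
    ∃ n < quadBound m, quad n = q := by
  have hpair : ∀ {a b c d : ℕ}, a < c → b < d → Nat.pair a b < Nat.pair c d := fun h h' =>
    (Nat.pair_lt_pair_left _ h).trans (Nat.pair_lt_pair_right _ h')
  refine ⟨Nat.pair (Nat.pair (q 0) (q 1)) (Nat.pair (q 2) (q 3)),
    hpair (hpair (hq 0) (hq 1)) (hpair (hq 2) (hq 3)), ?_⟩
  funext j
  fin_cases j <;> simp [quad]

/-- The test whether the identities in a list hold for all basis vectors in the range of a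
multiplication table. -/
def checkLaws [Encodable k] (L : List (List (Token k (Fin 4)))) (M : List (FormalSum k)) : Bool :=
  (List.range (quadBound M.length)).all fun n => L.all fun w =>
    isZero (value (FormalSum.opAlgebra (listTable M)) (fun j => [(1, quad n j)]) w)

/-- The test whether the tables define a metabelian Poisson algebra in which the relations hold
and the two given elements are different. -/
def checkNe [Encodable k] [Encodable X]
    (p : List (List (Token k X)) × List (Token k X) × List (Token k X))
    (C : List (FormalSum k) × List (FormalSum k)) : Bool :=
  checkLaws (lawTokens k) C.1 &&
  ((p.1.all fun s => isZero (value (FormalSum.opAlgebra (listTable C.1)) (listLetter C.2) s)) &&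
    !isZero (valueSub (listTable C.1) (listLetter C.2) p.2.1 p.2.2))

/-- Pairing never falls below its arguments, so such an entry lies outside the list. Therefore a
stored table involves only finitely many basis vectors, and the identities can be checked in finite
time. -/
theorem listTable_eq_nil {k : Type*} {M : List (FormalSum k)} {i j : ℕ} (b : Bool)
    (h : M.length ≤ i ∨ M.length ≤ j) : listTable M b i j = [] := by
  refine List.getD_eq_default _ _ ?_
  have h1 := Nat.right_le_pair (cond b 1 0) (Nat.pair i j)
  have h2 := Nat.left_le_pair i j
  have h3 := Nat.right_le_pair i j
  unfold opCode
  omega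

theorem bilin_single_left_eq_zero {M : List (FormalSum k)} {i : ℕ} (b : Bool) (h : M.length ≤ i)
    (y : ℕ →₀ k) : bilin (listTable M) b (Finsupp.single i 1) y = 0 := by
  induction y using Finsupp.induction_linear with
  | zero => simp
  | add y y' hy hy' => rw [map_add, hy, hy', add_zero]
  | single j c => rw [bilin_single, listTable_eq_nil b (Or.inl h)]; simp

theorem bilin_single_right_eq_zero {M : List (FormalSum k)} {j : ℕ} (b : Bool) (h : M.length ≤ j)
    (x : ℕ →₀ k) : bilin (listTable M) b x (Finsupp.single j 1) = 0 := by
  induction x using Finsupp.induction_linear with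
  | zero => simp
  | add x x' hx hx' => rw [map_add, LinearMap.add_apply, hx, hx', add_zero]
  | single i c => rw [bilin_single, listTable_eq_nil b (Or.inr h)]; simp

/-- Identities with at least one argument outside of the table hold trivially. -/
theorem poissonLaws_of_lt {M : List (FormalSum k)}
    (h : ∀ t ∈ poissonLaws k, ∀ q : Fin 4 → ℕ, (∀ j, q j < M.length) →
      t.fold (bilinearAlgebra (bilin (listTable M))) (fun j => Finsupp.single (q j) 1) = 0) :
    ∀ t ∈ poissonLaws k, ∀ q : Fin 4 → ℕ,
      t.fold (bilinearAlgebra (bilin (listTable M))) (fun j => Finsupp.single (q j) 1) ∈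
        (⊥ : Submodule k (ℕ →₀ k)) := by
  set β := bilin (listTable M) with hβ
  obtain ⟨h1, h2, h3, h4, h5, h6, h7⟩ := (forall_poissonLaws β (L := ⊥)
    (p := (· ∈ (fun i : ℕ => Finsupp.single i (1 : k)) '' {i | i < M.length}))).1 (by
      intro t ht g hg
      choose i hi hig using hg
      rw [show g = fun j => Finsupp.single (i j) 1 from funext fun j => (hig j).symm]
      exact h t ht i hi)
  have hdich : ∀ x ∈ Set.range (fun i : ℕ => Finsupp.single i (1 : k)),
      x ∈ (fun i : ℕ => Finsupp.single i (1 : k)) '' {i | i < M.length} ∨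
        ((∀ b y, β b x y = 0) ∧ ∀ b y, β b y x = 0) := by
    rintro _ ⟨i, rfl⟩
    rcases lt_or_ge i M.length with hi | hi
    · exact Or.inl ⟨i, hi, rfl⟩
    · exact Or.inr ⟨fun b => bilin_single_left_eq_zero b hi,
        fun b => bilin_single_right_eq_zero b hi⟩
  refine fun t ht q => (forall_poissonLaws β (L := ⊥)
    (p := (· ∈ Set.range (fun i : ℕ => Finsupp.single i (1 : k))))).2
      ⟨?_, ?_, ?_, ?_, ?_, ?_, ?_⟩ t ht _ fun j => ⟨q j, rfl⟩
  · intro x y hx hy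
    rcases hdich x hx with hx | ⟨hx, hx'⟩
    · rcases hdich y hy with hy | ⟨hy, hy'⟩
      · exact h1 x y hx hy
      · simp [hy, hy']
    · simp [hx, hx']
  · intro x y z hx hy hz
    rcases hdich x hx with hx | ⟨hx, hx'⟩
    · rcases hdich y hy with hy | ⟨hy, hy'⟩
      · rcases hdich z hz with hz | ⟨hz, hz'⟩
        · exact h2 x y z hx hy hz
        · simp [hz']
      · simp [hy, hy']
    · simp [hx]
  · intro x hx
    rcases hdich x hx with hx | ⟨hx, hx'⟩
    · exact h3 x hx
    · simp [hx]
  · intro x y hx hy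
    rcases hdich x hx with hx | ⟨hx, hx'⟩
    · rcases hdich y hy with hy | ⟨hy, hy'⟩
      · exact h4 x y hx hy
      · simp [hy, hy']
    · simp [hx, hx']
  · intro x y z hx hy hz
    rcases hdich x hx with hx | ⟨hx, hx'⟩
    · rcases hdich y hy with hy | ⟨hy, hy'⟩
      · rcases hdich z hz with hz | ⟨hz, hz'⟩
        · exact h5 x y z hx hy hz
        · simp [hz, hz']
      · simp [hy, hy']
    · simp [hx, hx']
  · intro x y z hx hy hz
    rcases hdich x hx with hx | ⟨hx, hx'⟩
    · rcases hdich y hy with hy | ⟨hy, hy'⟩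
      · rcases hdich z hz with hz | ⟨hz, hz'⟩
        · exact h6 x y z hx hy hz
        · simp [hz']
      · simp [hy, hy']
    · simp [hx]
  · intro b₁ b₂ b₃ x y z w hx hy hz hw
    rcases hdich x hx with hx | ⟨hx, hx'⟩
    · rcases hdich y hy with hy | ⟨hy, hy'⟩
      · rcases hdich z hz with hz | ⟨hz, hz'⟩
        · rcases hdich w hw with hw | ⟨hw, hw'⟩
          · exact h7 b₁ b₂ b₃ x y z w hx hy hz hw
          · simp [hw']
        · simp [hz]
      · simp [hy']
    · simp [hx]

/-- Soundness of inequality certificates: the tables define a model of the identities and the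
relations, so everything in the ideal has value zero there. -/
theorem not_mem_of_checkNe [Encodable k] [Encodable X]
    {p : List (List (Token k X)) × List (Token k X) × List (Token k X)}
    {C : List (FormalSum k) × List (FormalSum k)} (h : checkNe p C = true) :
    FreeMP.ofTerm (ofTokens p.2.1) - FreeMP.ofTerm (ofTokens p.2.2) ∉
      poissonIdealSpan k (FreeMP.ofTerm '' relators p.1) := by
  simp only [checkNe, checkLaws, Bool.and_eq_true, List.all_eq_true, List.mem_range, Bool.not_eq_true',
    isZero_iff] at h
  obtain ⟨hlaw, hS, hne⟩ := h
  intro hmem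
  have hlaws := poissonLaws_of_basis (bilin (listTable C.1)) (poissonLaws_of_lt (by
    intro t ht q hq
    obtain ⟨n, hn, rfl⟩ := exists_quad q hq
    have := hlaw n hn _ (List.mem_map_of_mem ht)
    rw [toFinsupp_value, ofTokens_toTokens] at this
    rw [← this]
    congr 1
    funext j
    simp))
  have := fold_sub_mem_of_mem_span (bilin (listTable C.1)) (L := ⊥)
    (by rintro b x y hy; rw [(Submodule.mem_bot k).1 hy]; simp) hlaws
    (toFinsupp ∘ listLetter C.2) (S := relators p.1) (by
      rintro _ ⟨s, hs, rfl⟩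
      rw [Submodule.mem_bot, ← toFinsupp_value]
      exact hS s hs) hmem
  rw [Submodule.mem_bot, ← toFinsupp_value, ← toFinsupp_value, ← toFinsupp_sub, ← isZero_iff] at this
  rw [valueSub, this] at hne
  exact Bool.noConfusion hne

theorem opCode_lt {i j d : ℕ} (b : Bool) (hi : i < d) (hj : j < d) :
    opCode b i j < Nat.pair 2 (Nat.pair d d) := by
  have h1 : Nat.pair i j < Nat.pair d d :=
    (Nat.pair_lt_pair_left _ hi).trans (Nat.pair_lt_pair_right _ hj)
  exact (Nat.pair_lt_pair_left _ (by cases b <;> simp)).trans (Nat.pair_lt_pair_right _ h1)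

/-- Completeness of inequality certificates. A separating finite-dimensional quotient is stored by
the structure constants of a basis and the coordinates of the letters. -/
theorem exists_checkNe [Encodable k] [Encodable X] [Finite X]
    {p : List (List (Token k X)) × List (Token k X) × List (Token k X)}
    (h : FreeMP.ofTerm (ofTokens p.2.1) - FreeMP.ofTerm (ofTokens p.2.2) ∉
      poissonIdealSpan k (FreeMP.ofTerm '' relators p.1)) : ∃ C, checkNe p C = true := by
  obtain ⟨J, hIJ, hJ, hf, hfin⟩ := FreeMP.exists_finite_quotient (isPoissonIdeal_span k _) h
  set d := Module.finrank k (FreeMP k X ⧸ J) with hd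
  let e : Module.Basis (Fin d) k (FreeMP k X ⧸ J) := Module.finBasis k _
  choose r hr using fun i => J.mkQ_surjective (e i)
  let coord : FreeMP k X → FormalSum k := fun f =>
    (List.finRange d).map fun i => (e.repr (J.mkQ f) i, (i : ℕ))
  -- `θ` lifts coordinate vectors to the free algebra; basis vectors with index at least `d` go to
  -- zero.
  let θ : (ℕ →₀ k) →ₗ[k] FreeMP k X :=
    Finsupp.linearCombination k fun i => if hi : i < d then r ⟨i, hi⟩ else 0
  have hcoord : ∀ f, toFinsupp (coord f) =
      ∑ i : Fin d, Finsupp.single (i : ℕ) (e.repr (J.mkQ f) i) := by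
    intro f
    simp only [toFinsupp, coord, List.map_map, Function.comp_def]
    rw [← List.ofFn_eq_map, List.sum_ofFn]
  -- `Ψ` takes the coordinates of the residue class. It vanishes exactly on `J`, and `θ` inverts it
  -- modulo `J`.
  let Ψ : FreeMP k X →ₗ[k] (ℕ →₀ k) :=
    { toFun := fun f => toFinsupp (coord f)
      map_add' := fun f g => by
        rw [hcoord, hcoord, hcoord, ← Finset.sum_add_distrib]
        simp
      map_smul' := fun c f => by
        rw [hcoord, hcoord, Finset.smul_sum]
        simp }
  have hΨ : ∀ f, toFinsupp (coord f) = Ψ f := fun _ => rfl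
  have hΨJ : ∀ f ∈ J, Ψ f = 0 := by
    intro f hf
    rw [← hΨ, hcoord, Submodule.mkQ_apply, (Submodule.Quotient.mk_eq_zero J).2 hf]
    simp
  have hθΨ : ∀ f, θ (Ψ f) - f ∈ J := by
    intro f
    rw [← Submodule.ker_mkQ J, LinearMap.mem_ker, map_sub, sub_eq_zero, ← hΨ, hcoord, map_sum,
      map_sum]
    conv_rhs => rw [← e.sum_repr (J.mkQ f)]
    refine Finset.sum_congr rfl fun i _ => ?_
    simp only [θ, Finsupp.linearCombination_single, i.2, dif_pos, map_smul, Fin.eta, hr]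
  have hΨker : ∀ f, Ψ f = 0 → f ∈ J := by
    intro f h0
    have := hθΨ f
    rw [h0, map_zero, zero_sub] at this
    exact neg_mem_iff.1 this
  set op := poissonOp k (FreeMP k X) with hop
  have hopJ : ∀ b x, ∀ y ∈ J, op b x y ∈ J ∧ op b y x ∈ J := by
    rintro (_ | _) x y hy
    exacts [⟨hJ.pmul_left x hy, hJ.pmul_right hy x⟩, ⟨hJ.pbr_left x hy, hJ.pbr_right hy x⟩]
  have hΨl : ∀ b f g, Ψ (op b (θ (Ψ f)) g) = Ψ (op b f g) := by
    intro b f g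
    rw [← sub_eq_zero, ← map_sub, ← LinearMap.sub_apply, ← map_sub]
    exact hΨJ _ (hopJ b g _ (hθΨ f)).2
  have hΨr : ∀ b f g, Ψ (op b f (θ (Ψ g))) = Ψ (op b f g) := by
    intro b f g
    rw [← sub_eq_zero, ← map_sub, ← map_sub]
    exact hΨJ _ (hopJ b f _ (hθΨ g)).1
  -- By `opCode_lt` the list is long enough for all pairs of indices below `d`. Entries with a
  -- larger index denote zero because `θ` does.
  let M : List (FormalSum k) := (List.range (Nat.pair 2 (Nat.pair d d))).map fun n =>
    coord (op (decide (n.unpair.1 = 1)) (θ (Finsupp.single n.unpair.2.unpair.1 1))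
      (θ (Finsupp.single n.unpair.2.unpair.2 1)))
  have htable : ∀ b i j, toFinsupp (listTable M b i j) =
      Ψ (op b (θ (Finsupp.single i 1)) (θ (Finsupp.single j 1))) := by
    intro b i j
    rcases lt_or_ge (opCode b i j) (Nat.pair 2 (Nat.pair d d)) with hlt | hge
    · rw [listTable, List.getD_eq_getElem M [] (by simpa [M] using hlt)]
      simp only [M, List.getElem_map, List.getElem_range, hΨ, opCode, Nat.unpair_pair]
      cases b <;> simp
    · rw [listTable, List.getD_eq_default M [] (by simpa [M] using hge), toFinsupp_nil]
      by_cases hi : i < d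
      · have hj : ¬ j < d := fun hj => absurd (opCode_lt b hi hj) (not_lt.2 hge)
        simp [θ, hj]
      · simp [θ, hi]
  have hβ : ∀ b x y, bilin (listTable M) b x y = Ψ (op b (θ x) (θ y)) := by
    intro b x y
    induction x using Finsupp.induction_linear with
    | zero => simp
    | add x x' hx hx' => simp only [map_add, LinearMap.add_apply, hx, hx']
    | single i c =>
      induction y using Finsupp.induction_linear with
      | zero => simp
      | add y y' hy hy' => simp only [map_add, hy, hy']
      | single j c' =>
        have hs : ∀ (i : ℕ) (c : k), Finsupp.single i c = c • Finsupp.single i 1 := by simp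
        rw [bilin_single, htable, hs i c, hs j c', map_smul, map_smul, LinearMap.smul_apply,
          map_smul, map_smul, map_smul, map_smul, smul_smul]
  obtain ⟨N, hN⟩ := (Set.finite_range (Encodable.encode : X → ℕ)).bddAbove
  let G : List (FormalSum k) := (List.range (N + 1)).map fun n =>
    ((Encodable.decode n : Option X).map fun a => coord (FreeMP.ofLetter k a)).getD []
  have hletter : ∀ a : X, toFinsupp (listLetter G a) = Ψ (FreeMP.ofLetter k a) := by
    intro a
    have ha : Encodable.encode a < N + 1 := Nat.lt_succ_of_le (hN ⟨a, rfl⟩)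
    rw [listLetter, List.getD_eq_getElem G [] (by simpa [G] using ha)]
    simp [G, hΨ]
  have hvalue : ∀ w : List (Token k X),
      toFinsupp (value (FormalSum.opAlgebra (listTable M)) (listLetter G) w) =
        Ψ (FreeMP.ofTerm (ofTokens w)) := by
    intro w
    rw [toFinsupp_value]
    generalize ofTokens w = t
    induction t with
    | var a => exact hletter a
    | zero => exact (map_zero Ψ).symm
    | add s t hs ht => exact (congrArg₂ (· + ·) hs ht).trans (map_add Ψ _ _).symm
    | smul c t ht => exact (congrArg (c • ·) ht).trans (map_smul Ψ _ _).symm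
    | mul s t hs ht =>
      refine (hβ false _ _).trans ?_
      rw [hs, ht, hΨl, hΨr]; rfl
    | bracket s t hs ht =>
      refine (hβ true _ _).trans ?_
      rw [hs, ht, hΨl, hΨr]; rfl
  have hlaws := (forall_poissonLaws (bilin (listTable M)) (L := ⊥) (p := fun _ => True)).2 (by
    have hop7 := (forall_poissonLaws op (L := ⊥) (p := fun _ => True)).1
      fun t ht g _ => (Submodule.mem_bot k).2 (FreeMP.fold_poissonLaws ht g)
    simp only [true_implies, Submodule.mem_bot] at hop7
    obtain ⟨h1, h2, h3, h4, h5, h6, h7⟩ := hop7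
    simp only [true_implies, Submodule.mem_bot, hβ, hΨl, hΨr, ← map_add, ← map_sub]
    refine ⟨?_, ?_, ?_, ?_, ?_, ?_, ?_⟩ <;> intros
    · rw [h1, map_zero]
    · rw [h2, map_zero]
    · rw [h3, map_zero]
    · rw [h4, map_zero]
    · rw [h5, map_zero]
    · rw [h6, map_zero]
    · rw [h7, map_zero])
  refine ⟨(M, G), ?_⟩
  simp only [checkNe, checkLaws, Bool.and_eq_true, List.all_eq_true, List.mem_range, Bool.not_eq_true',
    isZero_iff]
  refine ⟨fun n _ w hw => ?_, fun s hs => ?_, ?_⟩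
  · obtain ⟨t, ht, rfl⟩ := List.mem_map.1 hw
    rw [toFinsupp_value, ofTokens_toTokens]
    exact (Submodule.mem_bot k).1 (hlaws t ht _ fun _ => trivial)
  · rw [hvalue]
    exact hΨJ _ (hIJ (subset_poissonIdealSpan _ ⟨_, ⟨s, hs, rfl⟩, rfl⟩))
  · rw [Bool.eq_false_iff, Ne, isZero_iff, valueSub, toFinsupp_sub, hvalue, hvalue, ← map_sub]
    exact fun h0 => hf (hΨker _ h0)

end FiniteModels

/-! ### Computability of list operations -/

section ListRecursion

variable {α β σ : Type*} [Primcodable α] [Primcodable β] [Primcodable σ]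

theorem Nat.rec_getElem?_eq_foldl {β σ : Type*} (h : β × σ → σ) (s : σ) (r : List β) (n : ℕ) :
    (Nat.rec s (fun i s => Option.casesOn (r[i]?) s fun b => h (b, s)) n : σ) =
      (r.take n).foldl (fun s b => h (b, s)) s := by
  induction n with
  | zero => simp
  | succ n ih =>
    rw [List.take_add_one, List.foldl_append, ← ih]
    rcases hr : r[n]? with _ | b <;> simp [hr]

/-- The fold is a primitive recursion over the positions of the reversed list. The number of steps
is its length, so the branch for a missing entry is never taken. -/
theorem Computable.list_foldr {f : α → List β} {g : α → σ} {h : α → β × σ → σ}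
    (hf : Computable f) (hg : Computable g) (hh : Computable₂ h) :
    Computable fun a => (f a).foldr (fun b s => h a (b, s)) (g a) := by
  have hstep : Computable₂ fun (a : α) (p : ℕ × σ) =>
      (Option.casesOn ((f a).reverse[p.1]?) p.2 fun b => h a (b, p.2) : σ) := by
    refine Computable.option_casesOn (Computable.list_getElem?.comp
      (Computable.list_reverse.comp (hf.comp Computable.fst))
      (Computable.fst.comp Computable.snd)) (Computable.snd.comp Computable.snd) ?_
    exact hh.comp (Computable.fst.comp Computable.fst)
      (Computable.snd.pair (Computable.snd.comp (Computable.snd.comp Computable.fst)))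
  refine (Computable.nat_rec (Computable.list_length.comp hf) hg hstep).of_eq fun a => ?_
  have := Nat.rec_getElem?_eq_foldl (h a) (g a) (f a).reverse (f a).length
  rw [List.take_of_length_le (by simp), List.foldl_reverse] at this
  exact this

theorem Computable.list_map {f : α → List β} {h : α → β → σ}
    (hf : Computable f) (hh : Computable₂ h) : Computable fun a => (f a).map (h a) := by
  refine (Computable.list_foldr (h := fun a p => h a p.1 :: p.2) hf (Computable.const [])
    (Computable.list_cons.comp (hh.comp Computable.fst (Computable.fst.comp Computable.snd))
      (Computable.snd.comp Computable.snd))).of_eq fun a => ?_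
  induction f a <;> simp_all

theorem Computable.list_flatMap {f : α → List β} {h : α → β → List σ}
    (hf : Computable f) (hh : Computable₂ h) : Computable fun a => (f a).flatMap (h a) := by
  refine (Computable.list_foldr (h := fun a p => h a p.1 ++ p.2) hf (Computable.const [])
    (Computable.list_append.comp (hh.comp Computable.fst (Computable.fst.comp Computable.snd))
      (Computable.snd.comp Computable.snd))).of_eq fun a => ?_
  induction f a <;> simp_all [List.flatMap_cons]

theorem Computable.list_all {f : α → List β} {h : α → β → Bool}
    (hf : Computable f) (hh : Computable₂ h) : Computable fun a => (f a).all (h a) := by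
  refine (Computable.list_foldr (h := fun a p => h a p.1 && p.2) hf (Computable.const true)
    (Primrec.and.to_comp.comp (hh.comp Computable.fst (Computable.fst.comp Computable.snd))
      (Computable.snd.comp Computable.snd))).of_eq fun a => ?_
  induction f a <;> simp_all

theorem Computable.list_getD {f : α → List β} {n : α → ℕ} (d : β)
    (hf : Computable f) (hn : Computable n) : Computable fun a => (f a).getD (n a) d :=
  (Computable.option_getD (Computable.list_getElem?.comp hf hn) (Computable.const d)).of_eq
    fun _ => (List.getD_eq_getElem?_getD).symm

theorem Computable.decide_eq {f g : α → β} [DecidableEq β] (hf : Computable f)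
    (hg : Computable g) : Computable fun a => decide (f a = g a) :=
  (Primrec.eq (α := β)).decide.to_comp.comp hf hg

end ListRecursion

/-! ### Computability of the operations on formal sums -/

section ComputableFormalSums

open FormalSum PTerm

variable {k : Type*} [Field k] [Primcodable k] {α : Type*} [Primcodable α]

theorem IsComputableField.computable_scale (hk : IsComputableField k) {c : α → k} {f : α → FormalSum k}
    (hc : Computable c) (hf : Computable f) : Computable fun a => scale (c a) (f a) :=
  Computable.list_map hf ((hk.mul.comp (hc.comp Computable.fst)
    (Computable.fst.comp Computable.snd)).pair (Computable.snd.comp Computable.snd))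

/-- The table may depend on the parameter, since in an inequality certificate it is part of the
input. -/
theorem IsComputableField.computable_mul (hk : IsComputableField k)
    {T : α → Bool → ℕ → ℕ → FormalSum k}
    (hT : Computable fun p : α × Bool × ℕ × ℕ => T p.1 p.2.1 p.2.2.1 p.2.2.2)
    {b : α → Bool} {f g : α → FormalSum k}
    (hb : Computable b) (hf : Computable f) (hg : Computable g) :
    Computable fun a => FormalSum.mul (T a) (b a) (f a) (g a) := by
  refine Computable.list_flatMap hf (Computable.list_flatMap (hg.comp Computable.fst) ?_)
  have ha : Computable fun q : (α × k × ℕ) × k × ℕ => q.1.1 := Computable.fst.comp Computable.fst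
  refine hk.computable_scale (hk.mul.comp (Computable.fst.comp (Computable.snd.comp Computable.fst))
    (Computable.fst.comp Computable.snd)) ?_
  exact hT.comp (ha.pair ((hb.comp ha).pair
    ((Computable.snd.comp (Computable.snd.comp Computable.fst)).pair
      (Computable.snd.comp Computable.snd))))

theorem IsComputableField.computable_isZero (hk : IsComputableField k) :
    Computable (FormalSum.isZero : FormalSum k → Bool) := by
  have hcoeff : Computable fun p : FormalSum k × ℕ => coeff p.1 p.2 := by
    refine Computable.list_foldr (h := fun (p : FormalSum k × ℕ) q =>
      (if q.1.2 = p.2 then q.1.1 else 0) + q.2) Computable.fst (Computable.const 0) ?_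
    refine hk.add.comp ?_ (Computable.snd.comp Computable.snd)
    refine (Computable.cond (Computable.decide_eq
      (Computable.snd.comp (Computable.fst.comp Computable.snd))
      (Computable.snd.comp Computable.fst)) (Computable.fst.comp (Computable.fst.comp Computable.snd))
      (Computable.const 0)).of_eq fun _ => Bool.cond_decide _ _ _
  exact Computable.list_all Computable.id (Computable.decide_eq (Computable.encode.comp
    (hcoeff.comp (Computable.fst.pair (Computable.snd.comp Computable.snd)))) (Computable.const _))

theorem IsComputableField.computable_sub (hk : IsComputableField k) {f g : α → FormalSum k}
    (hf : Computable f) (hg : Computable g) : Computable fun a => FormalSum.sub (f a) (g a) :=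
  Computable.list_append.comp hf (hk.computable_scale (Computable.const _) hg)

theorem Computable.list_headD {β : Type*} [Primcodable β] {f : α → List β} (d : β)
    (hf : Computable f) : Computable fun a => (f a).headD d :=
  (Computable.list_getD d hf (Computable.const 0)).of_eq fun a => by cases f a <;> rfl

theorem Computable.list_tail {β : Type*} [Primcodable β] {f : α → List β}
    (hf : Computable f) : Computable fun a => (f a).tail := Primrec.list_tail.to_comp.comp hf

theorem IsComputableField.computable_step_symbol (hk : IsComputableField k)
    {T : α → Bool → ℕ → ℕ → FormalSum k}
    (hT : Computable fun p : α × Bool × ℕ × ℕ => T p.1 p.2.1 p.2.2.1 p.2.2.2)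
    {i : α → Fin 4} (hi : Computable i) {l : α → List (FormalSum k)} (hl : Computable l) :
    Computable fun a => bif decide (i a = 0) then [] :: l a else
      (bif decide (i a = 1) then (l a).headD [] ++ (l a).tail.headD []
        else FormalSum.mul (T a) (decide (i a = 3)) ((l a).headD []) ((l a).tail.headD [])) ::
          (l a).tail.tail := by
  have hd : ∀ j : Fin 4, Computable fun a => decide (i a = j) := fun j =>
    Computable.decide_eq hi (Computable.const j)
  have h1 := Computable.list_headD [] hl
  have h2 := Computable.list_headD [] (Computable.list_tail hl)
  refine Computable.cond (hd 0) (Computable.list_cons.comp (Computable.const _) hl)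
    (Computable.list_cons.comp ?_ (Computable.list_tail (Computable.list_tail hl)))
  exact Computable.cond (hd 1) (Computable.list_append.comp h1 h2)
    (hk.computable_mul hT (hd 3) h1 h2)

theorem IsComputableField.computable_step (hk : IsComputableField k) {X : Type*} [Primcodable X]
    {T : α → Bool → ℕ → ℕ → FormalSum k}
    (hT : Computable fun p : α × Bool × ℕ × ℕ => T p.1 p.2.1 p.2.2.1 p.2.2.2)
    {g : α → X → FormalSum k} (hg : Computable₂ g) {w : α → Token k X} (hw : Computable w)
    {l : α → List (FormalSum k)} (hl : Computable l) :
    Computable fun a => step (FormalSum.opAlgebra (T a)) (g a) (w a) (l a) := by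
  have hinl : Computable₂ fun (a : α) (s : k ⊕ X) =>
      (Sum.casesOn s (fun c => FormalSum.scale c ((l a).headD []) :: (l a).tail)
        (fun x => g a x :: l a) : List (FormalSum k)) := by
    have hl' : Computable fun q : (α × (k ⊕ X)) × k => l q.1.1 :=
      hl.comp (Computable.fst.comp Computable.fst)
    have hl'' : Computable fun q : (α × (k ⊕ X)) × X => l q.1.1 :=
      hl.comp (Computable.fst.comp Computable.fst)
    refine Computable.sumCasesOn Computable.snd ?_ ?_
    · exact Computable.list_cons.comp
        (hk.computable_scale Computable.snd (Computable.list_headD [] hl'))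
        (Computable.list_tail hl')
    · exact Computable.list_cons.comp (hg.comp
        (Computable.fst.comp Computable.fst) Computable.snd) hl''
  have hT' : Computable fun p : (α × Fin 4) × Bool × ℕ × ℕ => T p.1.1 p.2.1 p.2.2.1 p.2.2.2 :=
    hT.comp ((Computable.fst.comp Computable.fst).pair Computable.snd)
  have hinr := hk.computable_step_symbol (T := fun q : α × Fin 4 => T q.1) hT' Computable.snd
    (hl.comp Computable.fst)
  refine (Computable.sumCasesOn hw hinl hinr.to₂).of_eq fun a => ?_
  rcases w a with (c | x) | i
  · rfl
  · rfl
  · simp only [step, Bool.cond_decide]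
    rfl

theorem IsComputableField.computable_value (hk : IsComputableField k) {X : Type*} [Primcodable X]
    {T : α → Bool → ℕ → ℕ → FormalSum k}
    (hT : Computable fun p : α × Bool × ℕ × ℕ => T p.1 p.2.1 p.2.2.1 p.2.2.2)
    {g : α → X → FormalSum k} (hg : Computable₂ g) {w : α → List (Token k X)}
    (hw : Computable w) :
    Computable fun a => value (FormalSum.opAlgebra (T a)) (g a) (w a) := by
  refine Computable.list_headD [] (Computable.list_foldr
    (h := fun a p => step (FormalSum.opAlgebra (T a)) (g a) p.1 p.2) hw (Computable.const []) ?_)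
  have hT' : Computable fun p : (α × Token k X × List (FormalSum k)) × Bool × ℕ × ℕ =>
      T p.1.1 p.2.1 p.2.2.1 p.2.2.2 :=
    hT.comp ((Computable.fst.comp Computable.fst).pair Computable.snd)
  have hg' : Computable₂ fun (p : α × Token k X × List (FormalSum k)) (x : X) => g p.1 x :=
    hg.comp (Computable.fst.comp Computable.fst) Computable.snd
  exact hk.computable_step (T := fun p : α × Token k X × List (FormalSum k) => T p.1)
    (g := fun p : α × Token k X × List (FormalSum k) => g p.1) hT' hg'
    (Computable.fst.comp Computable.snd) (Computable.snd.comp Computable.snd)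

end ComputableFormalSums

/-! ### The decision procedure -/

section Decision

open FormalSum PTerm

variable {k : Type*} [Field k] [Primcodable k] {X : Type*} [Primcodable X]
  {α : Type*} [Primcodable α]

theorem computable_opCode :
    Computable fun p : Bool × ℕ × ℕ => opCode p.1 p.2.1 p.2.2 :=
  Primrec₂.natPair.to_comp.comp
    (Computable.cond Computable.fst (Computable.const 1) (Computable.const 0))
    (Primrec₂.natPair.to_comp.comp (Computable.fst.comp Computable.snd)
      (Computable.snd.comp Computable.snd))

theorem Computable.single {n : α → ℕ} (hn : Computable n) :
    Computable fun a => ([(1, n a)] : FormalSum k) :=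
  Computable.list_cons.comp ((Computable.const 1).pair hn) (Computable.const [])

theorem computable_monomialTable :
    Computable fun p : α × Bool × ℕ × ℕ => monomialTable k p.2.1 p.2.2.1 p.2.2.2 :=
  Computable.single (Computable.succ.comp (Primrec.nat_double.to_comp.comp
    (computable_opCode.comp Computable.snd)))

theorem computable_monomialLetter :
    Computable₂ fun (_ : α) (a : X) => monomialLetter k a :=
  Computable.single (Primrec.nat_double.to_comp.comp (Computable.encode.comp Computable.snd))

theorem IsComputableField.computable_applyContext (hk : IsComputableField k)
    {l : α → List (Bool × Bool × ℕ)} (hl : Computable l) {f : α → FormalSum k}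
    (hf : Computable f) : Computable fun a => applyContext (monomialTable k) (l a) (f a) := by
  refine Computable.list_foldr (h := fun (_ : α) (p : (Bool × Bool × ℕ) × FormalSum k) =>
    cond p.1.2.1 (FormalSum.mul (monomialTable k) p.1.1 p.2 [(1, p.1.2.2)])
      (FormalSum.mul (monomialTable k) p.1.1 [(1, p.1.2.2)] p.2)) hl hf ?_
  have ht : Computable fun q : α × (Bool × Bool × ℕ) × FormalSum k => q.2.1 :=
    Computable.fst.comp Computable.snd
  have hg : Computable fun q : α × (Bool × Bool × ℕ) × FormalSum k => q.2.2 :=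
    Computable.snd.comp Computable.snd
  have hb := Computable.fst.comp ht
  have hs := Computable.fst.comp (Computable.snd.comp ht)
  have hn := Computable.single (k := k) (Computable.snd.comp (Computable.snd.comp ht))
  exact Computable.cond hs
    (hk.computable_mul (T := fun _ => monomialTable k) computable_monomialTable hb hg hn)
    (hk.computable_mul (T := fun _ => monomialTable k) computable_monomialTable hb hn hg)

theorem IsComputableField.computable_itemSum (hk : IsComputableField k)
    {S : α → List (List (Token k X))} (hS : Computable S)
    {t : α → ℕ × (Fin 4 → ℕ) × ℕ × List (Bool × Bool × ℕ)} (ht : Computable t) :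
    Computable fun a => itemSum (S a) (t a) := by
  refine hk.computable_applyContext
    (Computable.snd.comp (Computable.snd.comp (Computable.snd.comp ht)))
    (Computable.list_append.comp ?_ ?_)
  · refine hk.computable_value (T := fun _ => monomialTable k) computable_monomialTable
      (g := fun a j => [(1, (t a).2.1 j)]) ?_
      (Computable.list_getD [] (Computable.const _) (Computable.fst.comp ht))
    exact Computable.single (Computable.fin_app.comp
      (Computable.fst.comp (Computable.snd.comp (ht.comp Computable.fst))) Computable.snd)
  · exact hk.computable_value (T := fun _ => monomialTable k) computable_monomialTable
      computable_monomialLetter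
      (Computable.list_getD [] hS (Computable.fst.comp (Computable.snd.comp (Computable.snd.comp ht))))

theorem IsComputableField.computable_valueSub (hk : IsComputableField k)
    {T : α → Bool → ℕ → ℕ → FormalSum k}
    (hT : Computable fun p : α × Bool × ℕ × ℕ => T p.1 p.2.1 p.2.2.1 p.2.2.2)
    {g : α → X → FormalSum k} (hg : Computable₂ g) {u v : α → List (Token k X)}
    (hu : Computable u) (hv : Computable v) :
    Computable fun a => valueSub (T a) (g a) (u a) (v a) :=
  hk.computable_sub (hk.computable_value hT hg hu) (hk.computable_value hT hg hv)

theorem IsComputableField.computable_checkEq (hk : IsComputableField k) :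
    Computable₂ (checkEq (k := k) (X := X)) := by
  refine hk.computable_isZero.comp (hk.computable_sub ?_ ?_)
  · exact hk.computable_valueSub (T := fun _ => monomialTable k) computable_monomialTable
      computable_monomialLetter
      (Computable.fst.comp (Computable.snd.comp Computable.fst))
      (Computable.snd.comp (Computable.snd.comp Computable.fst))
  · exact Computable.list_flatMap Computable.snd (hk.computable_scale
      (Computable.fst.comp Computable.snd)
      (hk.computable_itemSum (Computable.fst.comp (Computable.fst.comp Computable.fst))
        (Computable.snd.comp Computable.snd)))

theorem computable_quad : Computable₂ quad := by
  have h1 : Computable fun p : ℕ × Fin 4 => p.1.unpair.1 :=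
    Computable.fst.comp (Computable.unpair.comp Computable.fst)
  have h2 : Computable fun p : ℕ × Fin 4 => p.1.unpair.2 :=
    Computable.snd.comp (Computable.unpair.comp Computable.fst)
  have hd : ∀ j : Fin 4, Computable fun p : ℕ × Fin 4 => decide (p.2 = j) := fun j =>
    Computable.decide_eq Computable.snd (Computable.const j)
  refine (Computable.cond (hd 0) (Computable.fst.comp (Computable.unpair.comp h1))
    (Computable.cond (hd 1) (Computable.snd.comp (Computable.unpair.comp h1))
      (Computable.cond (hd 2) (Computable.fst.comp (Computable.unpair.comp h2))
        (Computable.snd.comp (Computable.unpair.comp h2))))).of_eq fun p => ?_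
  simp only [quad, Bool.cond_decide]

theorem computable_quadBound : Computable quadBound :=
  have h := Primrec₂.natPair.to_comp.comp Computable.id Computable.id
  Primrec₂.natPair.to_comp.comp h h

theorem computable_listTable {k : Type*} [Primcodable k] {M : α → List (FormalSum k)}
    (hM : Computable M) :
    Computable fun p : α × Bool × ℕ × ℕ => listTable (M p.1) p.2.1 p.2.2.1 p.2.2.2 :=
  Computable.list_getD [] (hM.comp Computable.fst) (computable_opCode.comp Computable.snd)

theorem computable_listLetter {k : Type*} [Primcodable k] {G : α → List (FormalSum k)}
    (hG : Computable G) :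
    Computable₂ fun (a : α) (x : X) => listLetter (G a) x :=
  Computable.list_getD [] (hG.comp Computable.fst) (Computable.encode.comp Computable.snd)

theorem IsComputableField.computable_checkLaws (hk : IsComputableField k)
    (L : List (List (Token k (Fin 4)))) : Computable (checkLaws L) := by
  let Q := (List (FormalSum k) × ℕ) × List (Token k (Fin 4))
  let T : Q → Bool → ℕ → ℕ → FormalSum k := fun q => listTable q.1.1
  let g : Q → Fin 4 → FormalSum k := fun q j => [(1, quad q.1.2 j)]
  have hT : Computable fun p : Q × Bool × ℕ × ℕ => T p.1 p.2.1 p.2.2.1 p.2.2.2 :=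
    computable_listTable (M := fun q : Q => q.1.1) (Computable.fst.comp Computable.fst)
  have hn : Computable fun p : Q × Fin 4 => quad p.1.1.2 p.2 := computable_quad.comp
    (Computable.snd.comp (Computable.fst.comp Computable.fst)) Computable.snd
  have hg : Computable₂ g := Computable.single hn
  have hv : Computable fun q : Q => value (FormalSum.opAlgebra (T q)) (g q) q.2 :=
    hk.computable_value hT hg Computable.snd
  have hall : Computable₂ fun (M : List (FormalSum k)) (n : ℕ) => L.all fun w =>
      FormalSum.isZero
        (value (FormalSum.opAlgebra (listTable M)) (fun j => [(1, quad n j)]) w) :=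
    Computable.list_all (f := fun _ : List (FormalSum k) × ℕ => L)
      (h := fun q w => FormalSum.isZero
        (value (FormalSum.opAlgebra (listTable q.1)) (fun j => [(1, quad q.2 j)]) w))
      (Computable.const L) (hk.computable_isZero.comp hv)
  have hrange : Computable fun M : List (FormalSum k) => List.range (quadBound M.length) :=
    Primrec.list_range.to_comp.comp (computable_quadBound.comp Computable.list_length)
  exact Computable.list_all hrange hall

theorem IsComputableField.computable_checkNe (hk : IsComputableField k) :
    Computable₂ (checkNe (k := k) (X := X)) := by
  let P := (List (List (Token k X)) × List (Token k X) × List (Token k X)) ×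
    List (FormalSum k) × List (FormalSum k)
  have hM : Computable fun q : P => q.2.1 := Computable.fst.comp Computable.snd
  have hG : Computable fun q : P => q.2.2 := Computable.snd.comp Computable.snd
  have hv := hk.computable_value (α := P × List (Token k X))
    (T := fun q => listTable q.1.2.1) (g := fun q => listLetter q.1.2.2)
    (computable_listTable (M := fun q : P × List (Token k X) => q.1.2.1)
      (hM.comp Computable.fst))
    (computable_listLetter (G := fun q : P × List (Token k X) => q.1.2.2)
      (hG.comp Computable.fst)) Computable.snd
  have hrel : Computable fun q : P => q.1.1.all fun s =>
      FormalSum.isZero (value (FormalSum.opAlgebra (listTable q.2.1)) (listLetter q.2.2) s) :=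
    Computable.list_all (Computable.fst.comp Computable.fst) (hk.computable_isZero.comp hv)
  have hsub := hk.computable_valueSub (α := P) (T := fun q => listTable q.2.1)
    (g := fun q => listLetter q.2.2) (computable_listTable (M := fun q : P => q.2.1) hM)
    (computable_listLetter (G := fun q : P => q.2.2) hG)
    (Computable.fst.comp (Computable.snd.comp Computable.fst))
    (Computable.snd.comp (Computable.snd.comp Computable.fst))
  exact Primrec.and.to_comp.comp ((hk.computable_checkLaws _).comp hM)
    (Primrec.and.to_comp.comp hrel (Primrec.not.to_comp.comp (hk.computable_isZero.comp hsub)))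

/-- A set of inputs such that both membership and non-membership have verifiable certificates is
decidable. -/
theorem exists_computable_decide {C D : Type*} [Primcodable C] [Primcodable D] {P : α → Prop}
    {c : α → C → Bool} {d : α → D → Bool} (hc : Computable₂ c) (hd : Computable₂ d)
    (hP : ∀ a, P a ↔ ∃ x, c a x = true) (hnP : ∀ a, ¬ P a ↔ ∃ y, d a y = true) :
    ∃ f : α → Bool, Computable f ∧ ∀ a, f a = true ↔ P a := by
  classical
  -- Candidates for both kinds of certificates are enumerated together, through the codes of a sum
  -- type; the first valid one gives the answer.
  let F : α → ℕ → Option Bool := fun a n => (Encodable.decode n : Option (C ⊕ D)).bind fun s =>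
    Sum.casesOn s (fun x => bif c a x then some true else none)
      (fun y => bif d a y then some false else none)
  have hF : Computable₂ F := by
    refine Computable.option_bind (Computable.decode.comp Computable.snd) ?_
    refine Computable.sumCasesOn Computable.snd ?_ ?_
    · exact Computable.cond (hc.comp (Computable.fst.comp (Computable.fst.comp Computable.fst))
        Computable.snd) (Computable.const _) (Computable.const _)
    · exact Computable.cond (hd.comp (Computable.fst.comp (Computable.fst.comp Computable.fst))
        Computable.snd) (Computable.const _) (Computable.const _)
  -- Any valid certificate gives the correct answer, so the order of the search does not matter.
  have hval : ∀ a n b, b ∈ F a n → b = decide (P a) := by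
    intro a n b hb
    obtain ⟨s, -, hs⟩ := Option.bind_eq_some_iff.1 hb
    rcases s with x | y
    · rcases h : c a x with _ | _
      · simp [h] at hs
      · have hPa := (hP a).2 ⟨x, h⟩
        simp only [h, cond_true, Option.some.injEq] at hs
        rw [← hs, decide_eq_true hPa]
    · rcases h : d a y with _ | _
      · simp [h] at hs
      · have hPa := (hnP a).2 ⟨y, h⟩
        simp only [h, cond_true, Option.some.injEq] at hs
        rw [← hs, decide_eq_false hPa]
  refine ⟨fun a => decide (P a), Partrec.of_eq_tot (Partrec.rfindOpt hF) fun a => ?_,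
    fun a => decide_eq_true_iff⟩
  -- The search ends because either `P a` or its negation has a certificate.
  have hdom : (Nat.rfindOpt (F a)).Dom := by
    rw [Nat.rfindOpt_dom]
    by_cases h : P a
    · obtain ⟨x, hx⟩ := (hP a).1 h
      exact ⟨Encodable.encode (Sum.inl x : C ⊕ D), true, by
        change F a _ = some true
        simp only [F, Encodable.encodek, Option.bind_some, hx, cond_true]⟩
    · obtain ⟨y, hy⟩ := (hnP a).1 h
      exact ⟨Encodable.encode (Sum.inr y : C ⊕ D), false, by
        change F a _ = some false
        simp only [F, Encodable.encodek, Option.bind_some, hy, cond_true]⟩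
  obtain ⟨n, hn⟩ := Nat.rfindOpt_spec (Part.get_mem hdom)
  rw [← hval a n _ hn]
  exact Part.get_mem hdom

/-- The word problem for finitely presented metabelian Poisson algebras over a computable field is
solvable. -/
theorem exists_computable_wordProblem (hk : IsComputableField k) [Finite X] :
    ∃ decide : List (List (Token k X)) × List (Token k X) × List (Token k X) → Bool,
      Computable decide ∧
      ∀ (S : List (PTerm k X)) (u v : PTerm k X),
        decide (S.map PTerm.toTokens, u.toTokens, v.toTokens) = true ↔
          (Submodule.Quotient.mk (FreeMP.ofTerm u) :
              PresentedMP k X {s | ∃ r ∈ S, s = FreeMP.ofTerm r}) =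
            Submodule.Quotient.mk (FreeMP.ofTerm v) := by
  obtain ⟨f, hf, hfP⟩ := exists_computable_decide
    (P := fun p : List (List (Token k X)) × List (Token k X) × List (Token k X) =>
      FreeMP.ofTerm (ofTokens p.2.1) - FreeMP.ofTerm (ofTokens p.2.2) ∈
        poissonIdealSpan k (FreeMP.ofTerm '' relators p.1))
    hk.computable_checkEq hk.computable_checkNe
    (fun p => ⟨exists_checkEq, fun ⟨_, h⟩ => mem_of_checkEq h⟩)
    (fun p => ⟨exists_checkNe, fun ⟨_, h⟩ => not_mem_of_checkNe h⟩)
  refine ⟨f, hf, fun S u v => ?_⟩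
  have hrel : FreeMP.ofTerm '' relators (S.map PTerm.toTokens) =
      {s | ∃ r ∈ S, s = FreeMP.ofTerm r} := by
    ext s
    simp [relators, ofTokens_toTokens, eq_comm]
  rw [hfP, Submodule.Quotient.eq, ofTokens_toTokens, ofTokens_toTokens, hrel]

end Decision

theorem theorem3p20 {k : Type*} [Field k] :
    -- Every `MP_k(X | S)` with `X` finite has a finite Gröbner–Shirshov basis.
    (∀ (X : Type*) [LinearOrder X] [Finite X] (S : Set (FreeMP k X)),
      ∃ R : Set (FreeMP k X), R.Finite ∧ IsGroebnerShirshovBasis R (poissonIdealSpan k S)) ∧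
    -- Finitely generated metabelian Poisson algebras are finitely presented and Noetherian.
    (∀ (P : Type*) [AddCommGroup P] [Module k P] [PoissonAlgebra k P],
      IsMetabelianPoisson k P → IsFGPoisson k P →
        IsFPMetabelianPoisson k P ∧ IsNoetherianPoisson k P) ∧
    -- For finite `X` and `S`, completion stops after finitely many steps at a finite
    -- Gröbner–Shirshov basis; reduction modulo it terminates and decides membership in `Id(S)`.
    (∀ (X : Type*) [LinearOrder X] [Finite X] (S : Set (FreeMP k X)), S.Finite → IsMonicSet S →
      ∃ t : ℕ, (∀ n, t ≤ n → completion S n = completion S t) ∧ (completion S t).Finite ∧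
        IsMonicSet (completion S t) ∧
        IsGroebnerShirshovBasis (completion S t) (poissonIdealSpan k S) ∧
        (WellFounded fun g f => ReducesTo (completion S t) f g) ∧
        ∀ f g, Relation.ReflTransGen (ReducesTo (completion S t)) f g →
          (∀ g', ¬ ReducesTo (completion S t) g g') →
          (f ∈ poissonIdealSpan k S ↔ g = 0)) ∧
    -- Over a computable field the word problem is solvable, uniformly in the finite set `S` of
    -- relations: one algorithm decides whether `u = v` holds in `MP_k(X | S)`.
    (∀ [Primcodable k], IsComputableField k → ∀ (X : Type*) [Finite X] [Primcodable X],
      ∃ decide : List (List (PTerm.Token k X)) × List (PTerm.Token k X) ×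
          List (PTerm.Token k X) → Bool,
        Computable decide ∧
        ∀ (S : List (PTerm k X)) (u v : PTerm k X),
          decide (S.map PTerm.toTokens, u.toTokens, v.toTokens) = true ↔
            (Submodule.Quotient.mk (FreeMP.ofTerm u) :
                PresentedMP k X {s | ∃ r ∈ S, s = FreeMP.ofTerm r}) =
              Submodule.Quotient.mk (FreeMP.ofTerm v)) := by
  refine ⟨fun X _ _ S => exists_finite_groebnerShirshov (isPoissonIdeal_span k S),
    fun P _ _ _ hP hfg => isFP_and_isNoetherian hP hfg,
    fun X _ _ S hfin hS => completion_terminates hfin hS,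
    fun hk X _ _ => exists_computable_wordProblem hk⟩
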